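/- \textbf{Notation.} Let $m,n,p,q,N\ge 1$ be integers and let $K>0$ and $\lambda>0$ be real. The classical domains are $R_I(m,n)=\{Z\in\mathbb C^{m\times n}: I-Z\overline Z^t>0\}$, $R_{II}(p)=\{Z\in\mathbb C^{p\times p}: Z=Z^t,\ I-Z\overline Z^t>0\}$, $R_{III}(q)=\{Z\in\mathbb C^{q\times q}: Z=-Z^t,\ I-Z\overline Z^t>0\}$, $R_{IV}(n)=\{Z\in\mathbb C^{n}: 1+|ZZ^t|^2-2Z\overline Z^t>0,\ |ZZ^t|<1\}$ (row vectors), with coordinates the entries $z_{ij}$ of $Z$ (for $i\le j$ in type II, for $i<j$ in type III). Put $h(Z,Z_0)=\det(I-Z\overline{Z_0}^t)$ for types I, II, III and $h(Z,Z_0)=1+(ZZ^t)\overline{(Z_0Z_0^t)}-2Z\overline{Z_0}^t$ for type IV, and let $c=m+n,\ p+1,\ q-1,\ n$ for $R=R_I(m,n),\ R_{II}(p),\ R_{III}(q),\ R_{IV}(n)$ respectively. The Cartan--Hartogs domain over $R$ is $$Y=\{(Z,W): Z\in R,\ W\in\mathbb C^N,\ |W|^{2K}<h(Z,Z)\},$$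 denoted $Y_I,Y_{II},Y_{III},Y_{IV}$ in the four cases. On $Y$ put $$X=|W|^2h(Z,Z)^{-1/K},\qquad G_\lambda=(1-X)^{-\lambda}\,h(Z,Z)^{-(c+N/K)} .$$ Let $\mathrm{Aut}(Y)$ be the set of the maps $$(Z,W)\mapsto\bigl(\varphi(Z),\ W\,h(Z_0,Z_0)^{\frac1{2K}}\,h(Z,Z_0)^{-\frac1K}\bigr),\qquad Z_0\in R,$$ with any holomorphic branch of the power $h(\cdot,Z_0)^{-1/K}$ on $R$ that comes from a holomorphic logarithm of $h(\cdot,Z_0)$, where $\varphi$ is of the following form. * Type I: $\varphi(Z)=A(Z-Z_0)(I-\overline{Z_0}^tZ)^{-1}D^{-1}$, with $\overline A^tA=(I-Z_0\overline{Z_0}^t)^{-1}$ and $\overline D^tD=(I-\overline{Z_0}^tZ_0)^{-1}$. * Types II, III: $\varphi(Z)=A(Z-Z_0)(I-\overline{Z_0}^tZ)^{-1}\overline A^{\,-1}$, with $\overline A^tA=(I-Z_0\overline{Z_0}^t)^{-1}$. * Type IV: with $e(Z)=\bigl(\tfrac12(ZZ^t+1),\tfrac i2(ZZ^t-1)\bigr)$,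 $\varphi(Z)=\bigl[(e(Z)-ZX_0^t)A(1,i)^t\bigr]^{-1}\,(Z-e(Z)X_0)D$, where $X_0$ is the real $2\times n$ matrix with $Z_0=e(Z_0)X_0$, and $A,D$ are real matrices with $AA^t=(I-X_0X_0^t)^{-1}$, $\det A>0$, $DD^t=(I-X_0^tX_0)^{-1}$. For a real function $u$ on a domain, the metric with potential $u$ is $\omega^2=dz\,T\,\overline{dz}^t$, $T=\bigl(\partial^2u/\partial z_i\partial\overline z_j\bigr)$; it is Kähler if $u$ is smooth and $T$ is positive definite everywhere. The Bergman metric $\omega_B(Y)$ has potential $\log k(z,z)$, where $k$ is the Bergman kernel, that is, the reproducing kernel of the space of square integrable holomorphic functions on $Y$. \textbf{Theorem.} For all such $m,n,p,q,N,K,\lambda$, and for each of $Y=Y_I,Y_{II},Y_{III},Y_{IV}$: 1. $\log G_\lambda$ is the potential of a Kähler metric $\omega_{G_\lambda}(Y)$ on $Y$. 2. This metric is complete: $Y$ with the distance given by the infimum of the $\omega_{G_\lambda}$-lengths of $C^1$ curves in $Y$ is a complete metric space. 3. Every $f\in\mathrm{Aut}(Y)$ is a holomorphic automorphism of $Y$,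 and $\omega_{G_\lambda}(Y)$ is invariant under $f$. 4. The Bergman kernel of $Y$ exists, the Bergman metric $\omega_B(Y)$ is a Kähler metric, and it is quasi-isometric to $\omega_{G_\lambda}(Y)$: there are constants $a,b>0$ with $$b\,\omega_{G_\lambda}(z;v)\le\omega_B(z;v)\le a\,\omega_{G_\lambda}(z;v)\qquad\text{for all } z\in Y \text{ and all tangent vectors } v .$$ -/

import Mathlib

open scoped ContDiff ComplexOrder Matrix ENNReal Topology ComplexConjugate

noncomputable section

/-! ### Kähler metrics given by a potential on a domain of `ℂ^ι` -/

section Kahler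

variable {ι : Type*} [Fintype ι] [DecidableEq ι]

/-- The Wirtinger derivative `∂f/∂z_j = (∂f/∂x_j - i ∂f/∂y_j)/2`. -/
def wirtinger (j : ι) (f : (ι → ℂ) → ℂ) (z : ι → ℂ) : ℂ :=
  (fderiv ℝ f z (Pi.single j 1) - Complex.I * fderiv ℝ f z (Pi.single j Complex.I)) / 2

/-- The conjugate Wirtinger derivative `∂f/∂z̄_j = (∂f/∂x_j + i ∂f/∂y_j)/2`. -/
def wirtingerBar (j : ι) (f : (ι → ℂ) → ℂ) (z : ι → ℂ) : ℂ :=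
  (fderiv ℝ f z (Pi.single j 1) + Complex.I * fderiv ℝ f z (Pi.single j Complex.I)) / 2

/-- The metric matrix `(∂²u/∂z_i ∂z̄_j)` of the potential `u`. -/
def metricMatrix (u : (ι → ℂ) → ℝ) (z : ι → ℂ) : Matrix ι ι ℂ :=
  Matrix.of fun i j => wirtinger i (wirtingerBar j fun x => (u x : ℂ)) z

/-- The length `ω(z; v)` of the tangent vector `v` at `z` in the metric with potential `u`:
`ω² = v T v̄ᵗ` with `T = (∂²u/∂z_i ∂z̄_j)`. -/
def metricLength (u : (ι → ℂ) → ℝ) (z v : ι → ℂ) : ℝ :=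
  Real.sqrt (∑ i, ∑ j, v i * metricMatrix u z i j * conj (v j)).re

/-- `u` is smooth and `(∂²u/∂z_i ∂z̄_j)` is positive definite on `D`, that is, `u` is the potential
of a Kähler metric on `D`. -/
def IsKahlerPotentialOn (u : (ι → ℂ) → ℝ) (D : Set (ι → ℂ)) : Prop :=
  ContDiffOn ℝ ∞ u D ∧ ∀ z ∈ D, (metricMatrix u z).PosDef

/-- The distance on `D` of the metric with potential `u`: the infimum of the lengths of the
`C¹` curves in `D` from `z` to `w`. -/
def metricEDist (u : (ι → ℂ) → ℝ) (D : Set (ι → ℂ)) (z w : ι → ℂ) : ℝ≥0∞ :=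
  ⨅ (γ : ℝ → ι → ℂ) (_ : ContDiffOn ℝ 1 γ (Set.Icc 0 1)) (_ : Set.MapsTo γ (Set.Icc 0 1) D)
    (_ : γ 0 = z) (_ : γ 1 = w),
    ∫⁻ t in Set.Icc (0 : ℝ) 1,
      ENNReal.ofReal (metricLength u (γ t) (derivWithin γ (Set.Icc 0 1) t))

/-- The metric with potential `u` is complete on `D`: every Cauchy sequence of `D` for its
distance converges, for this distance, to a point of `D`. -/
def IsCompleteMetricOn (u : (ι → ℂ) → ℝ) (D : Set (ι → ℂ)) : Prop :=
  ∀ s : ℕ → ι → ℂ, (∀ k, s k ∈ D) →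
    (∀ ε : ℝ≥0∞, 0 < ε → ∃ M, ∀ j ≥ M, ∀ k ≥ M, metricEDist u D (s j) (s k) < ε) →
    ∃ z ∈ D, Filter.Tendsto (fun k => metricEDist u D (s k) z) Filter.atTop (𝓝 0)

/-- `f` restricts to a biholomorphic map of `D` onto itself. -/
def IsHolomorphicAutomorphism (f : (ι → ℂ) → ι → ℂ) (D : Set (ι → ℂ)) : Prop :=
  DifferentiableOn ℂ f D ∧ Set.MapsTo f D D ∧
    ∃ g : (ι → ℂ) → ι → ℂ, DifferentiableOn ℂ g D ∧ Set.MapsTo g D D ∧ Set.InvOn g f D D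

/-- The metric with potential `u` on `D` is invariant under the family `A` of maps: each of them
is a holomorphic automorphism of `D` and preserves the lengths of tangent vectors. -/
def IsInvariantMetricOn (u : (ι → ℂ) → ℝ) (D : Set (ι → ℂ)) (A : Set ((ι → ℂ) → ι → ℂ)) : Prop :=
  ∀ f ∈ A, IsHolomorphicAutomorphism f D ∧
    ∀ z ∈ D, ∀ v, metricLength u (f z) (fderiv ℂ f z v) = metricLength u z v

/-- Quasi-isometry (equivalence) on `D` of the metrics with potentials `u` and `u'`. -/
def QuasiIsometricOn (u u' : (ι → ℂ) → ℝ) (D : Set (ι → ℂ)) : Prop :=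
  ∃ a b : ℝ, 0 < a ∧ 0 < b ∧ ∀ z ∈ D, ∀ v,
    b * metricLength u' z v ≤ metricLength u z v ∧ metricLength u z v ≤ a * metricLength u' z v

/-- Membership in the Bergman space `A²(D)` of square integrable holomorphic functions. -/
def MemBergmanSpace (f : (ι → ℂ) → ℂ) (D : Set (ι → ℂ)) : Prop :=
  DifferentiableOn ℂ f D ∧ MeasureTheory.MemLp f 2 (MeasureTheory.volume.restrict D)

/-- `k` is the Bergman kernel of `D`, the reproducing kernel of `A²(D)`; it is determined on
`D × D`. -/
def IsBergmanKernel (k : (ι → ℂ) → (ι → ℂ) → ℂ) (D : Set (ι → ℂ)) : Prop :=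
  ∀ w ∈ D, MemBergmanSpace (fun z => k z w) D ∧
    ∀ f, MemBergmanSpace f D → f w = ∫ z in D, f z * conj (k z w)

/-- The potential `log k(z, z)` of the Bergman metric. -/
def bergmanPotential (k : (ι → ℂ) → (ι → ℂ) → ℂ) (z : ι → ℂ) : ℝ :=
  Real.log (k z z).re

/-- The metric with potential `u` is quasi-isometric on `D` to the Bergman metric of `D`
(the existence of the Bergman kernel and of the Bergman metric being part of the assertion). -/
def IsEquivalentToBergman (u : (ι → ℂ) → ℝ) (D : Set (ι → ℂ)) : Prop :=
  (∃ k, IsBergmanKernel k D) ∧ ∀ k, IsBergmanKernel k D →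
    IsKahlerPotentialOn (bergmanPotential k) D ∧ QuasiIsometricOn (bergmanPotential k) u D

end Kahler

/-! ### Hartogs domains over a domain `R ⊆ ℂ^κ`

Points of `ℂ^κ × ℂ^N` are functions `z` on `κ ⊕ Fin N`, with `Z = z ∘ Sum.inl` and
`W = z ∘ Sum.inr`. The function `h (Z, Z₀)` is holomorphic in `Z` and antiholomorphic in `Z₀`. -/

section Hartogs

variable {κ : Type*} {N : ℕ}

/-- `|W|²`. -/
def fiberNormSq (z : κ ⊕ Fin N → ℂ) : ℝ := ∑ k, ‖z (Sum.inr k)‖ ^ 2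

/-- `{(Z, W) : Z ∈ R, W ∈ ℂ^N, |W|^{2K} < h(Z, Z)}`. -/
def hartogsDomain (R : Set (κ → ℂ)) (h : (κ → ℂ) → (κ → ℂ) → ℂ) (N : ℕ) (K : ℝ) :
    Set (κ ⊕ Fin N → ℂ) :=
  {z | z ∘ Sum.inl ∈ R ∧ fiberNormSq z ^ K < (h (z ∘ Sum.inl) (z ∘ Sum.inl)).re}

/-- `X = |W|² h(Z, Z)^{-1/K}`. -/
def hartogsX (h : (κ → ℂ) → (κ → ℂ) → ℂ) (K : ℝ) (z : κ ⊕ Fin N → ℂ) : ℝ :=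
  fiberNormSq z * (h (z ∘ Sum.inl) (z ∘ Sum.inl)).re ^ (-(1 / K))

/-- `G_l = (1 - X)^{-l} h(Z, Z)^{-(c + N/K)}`. -/
def hartogsG (h : (κ → ℂ) → (κ → ℂ) → ℂ) (c K l : ℝ) (z : κ ⊕ Fin N → ℂ) : ℝ :=
  (1 - hartogsX h K z) ^ (-l) * (h (z ∘ Sum.inl) (z ∘ Sum.inl)).re ^ (-(c + N / K))

/-- The potential `log G_l`. -/
def hartogsPotential (h : (κ → ℂ) → (κ → ℂ) → ℂ) (c K l : ℝ) (z : κ ⊕ Fin N → ℂ) : ℝ :=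
  Real.log (hartogsG h c K l z)

/-- The maps `(Z, W) ↦ (φ(Z), W h(Z₀, Z₀)^{1/(2K)} h(Z, Z₀)^{-1/K})` with `Z₀ ∈ R` and `φ` one of
the automorphisms `Φ Z₀` of `R` that send `Z₀` to `0`. The power `h(Z, Z₀)^{-1/K}` is
`exp (-L(Z)/K)`, where `L` is any holomorphic branch on `R` of `log h(·, Z₀)`. -/
def hartogsAut [Fintype κ] (R : Set (κ → ℂ)) (h : (κ → ℂ) → (κ → ℂ) → ℂ)
    (Φ : (κ → ℂ) → Set ((κ → ℂ) → κ → ℂ)) (N : ℕ) (K : ℝ) :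
    Set ((κ ⊕ Fin N → ℂ) → κ ⊕ Fin N → ℂ) :=
  {f | ∃ Z₀ ∈ R, ∃ φ ∈ Φ Z₀, ∃ L : (κ → ℂ) → ℂ, DifferentiableOn ℂ L R ∧
    (∀ Z ∈ R, Complex.exp (L Z) = h Z Z₀) ∧
    ∀ z ∈ hartogsDomain R h N K,
      f z ∘ Sum.inl = φ (z ∘ Sum.inl) ∧
      ∀ k, f z (Sum.inr k) = z (Sum.inr k) *
        (((h Z₀ Z₀).re ^ (1 / (2 * K)) : ℝ) : ℂ) * Complex.exp (-(L (z ∘ Sum.inl) / K))}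

end Hartogs

/-! ### The classical domains -/

/-- `det (I - Z Z̄₀ᵗ)`. -/
def detNorm {m n : ℕ} (Z Z₀ : Matrix (Fin m) (Fin n) ℂ) : ℂ := (1 - Z * Z₀ᴴ).det

/-- The `m × n` matrix with coordinates `z`. -/
def matI {m n : ℕ} (z : Fin m × Fin n → ℂ) : Matrix (Fin m) (Fin n) ℂ :=
  Matrix.of fun i j => z (i, j)

/-- The symmetric matrix with coordinates `z_{ij} = z_{ji}`. -/
def matII {p : ℕ} (z : Sym2 (Fin p) → ℂ) : Matrix (Fin p) (Fin p) ℂ :=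
  Matrix.of fun i j => z s(i, j)

/-- The coordinates `z_{ij}`, `i < j`, of skew-symmetric `q × q` matrices. -/
abbrev SkewIndex (q : ℕ) : Type := {ij : Fin q × Fin q // ij.1 < ij.2}

/-- The skew-symmetric matrix with coordinates `z_{ij}`, `i < j`. -/
def matIII {q : ℕ} (z : SkewIndex q → ℂ) : Matrix (Fin q) (Fin q) ℂ :=
  Matrix.of fun i j =>
    if hij : i < j then z ⟨(i, j), hij⟩ else if hji : j < i then -z ⟨(j, i), hji⟩ else 0

def domI (m n : ℕ) : Set (Fin m × Fin n → ℂ) := {z | (1 - matI z * (matI z)ᴴ).PosDef}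

def domII (p : ℕ) : Set (Sym2 (Fin p) → ℂ) := {z | (1 - matII z * (matII z)ᴴ).PosDef}

def domIII (q : ℕ) : Set (SkewIndex q → ℂ) := {z | (1 - matIII z * (matIII z)ᴴ).PosDef}

/-- `β(Z, Z₀) = 1 + (Z Zᵗ) conj(Z₀ Z₀ᵗ) - 2 Z Z̄₀ᵗ`. -/
def normIV {n : ℕ} (z z₀ : Fin n → ℂ) : ℂ := 1 + (z ⬝ᵥ z) * conj (z₀ ⬝ᵥ z₀) - 2 * (z ⬝ᵥ star z₀)

def domIV (n : ℕ) : Set (Fin n → ℂ) := {z | 0 < (normIV z z).re ∧ ‖z ⬝ᵥ z‖ < 1}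

def normI {m n : ℕ} (z z₀ : Fin m × Fin n → ℂ) : ℂ := detNorm (matI z) (matI z₀)

def normII {p : ℕ} (z z₀ : Sym2 (Fin p) → ℂ) : ℂ := detNorm (matII z) (matII z₀)

def normIII {q : ℕ} (z z₀ : SkewIndex q → ℂ) : ℂ := detNorm (matIII z) (matIII z₀)

/-- The matrix `A (Z - Z₀) (I - Z̄₀ᵗ Z)⁻¹ D⁻¹`. -/
def mobiusMatrix {m n : ℕ} (Z₀ : Matrix (Fin m) (Fin n) ℂ) (A : Matrix (Fin m) (Fin m) ℂ)
    (D : Matrix (Fin n) (Fin n) ℂ) (Z : Matrix (Fin m) (Fin n) ℂ) : Matrix (Fin m) (Fin n) ℂ :=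
  A * (Z - Z₀) * (1 - Z₀ᴴ * Z)⁻¹ * D⁻¹

/-- `Z ↦ A (Z - Z₀) (I - Z̄₀ᵗ Z)⁻¹ D⁻¹`, `Āᵗ A = (I - Z₀ Z̄₀ᵗ)⁻¹`, `D̄ᵗ D = (I - Z̄₀ᵗ Z₀)⁻¹`. -/
def movesI (m n : ℕ) (z₀ : Fin m × Fin n → ℂ) : Set ((Fin m × Fin n → ℂ) → Fin m × Fin n → ℂ) :=
  {φ | ∃ (A : Matrix (Fin m) (Fin m) ℂ) (D : Matrix (Fin n) (Fin n) ℂ),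
    Aᴴ * A = (1 - matI z₀ * (matI z₀)ᴴ)⁻¹ ∧ Dᴴ * D = (1 - (matI z₀)ᴴ * matI z₀)⁻¹ ∧
    ∀ z ∈ domI m n, matI (φ z) = mobiusMatrix (matI z₀) A D (matI z)}

/-- `Z ↦ A (Z - Z₀) (I - Z̄₀ᵗ Z)⁻¹ Ā⁻¹`, `Āᵗ A = (I - Z₀ Z̄₀ᵗ)⁻¹`, on symmetric matrices. -/
def movesII (p : ℕ) (z₀ : Sym2 (Fin p) → ℂ) : Set ((Sym2 (Fin p) → ℂ) → Sym2 (Fin p) → ℂ) :=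
  {φ | ∃ A : Matrix (Fin p) (Fin p) ℂ, Aᴴ * A = (1 - matII z₀ * (matII z₀)ᴴ)⁻¹ ∧
    ∀ z ∈ domII p, matII (φ z) = mobiusMatrix (matII z₀) A (A.map conj) (matII z)}

/-- `Z ↦ A (Z - Z₀) (I - Z̄₀ᵗ Z)⁻¹ Ā⁻¹`, `Āᵗ A = (I - Z₀ Z̄₀ᵗ)⁻¹`, on skew-symmetric matrices. -/
def movesIII (q : ℕ) (z₀ : SkewIndex q → ℂ) : Set ((SkewIndex q → ℂ) → SkewIndex q → ℂ) :=
  {φ | ∃ A : Matrix (Fin q) (Fin q) ℂ, Aᴴ * A = (1 - matIII z₀ * (matIII z₀)ᴴ)⁻¹ ∧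
    ∀ z ∈ domIII q, matIII (φ z) = mobiusMatrix (matIII z₀) A (A.map conj) (matIII z)}

/-- The vector `e(Z) = ((Z Zᵗ + 1)/2, i (Z Zᵗ - 1)/2)`. -/
def vecIV {n : ℕ} (z : Fin n → ℂ) : Fin 2 → ℂ :=
  ![(z ⬝ᵥ z + 1) / 2, Complex.I * (z ⬝ᵥ z - 1) / 2]

/-- A real matrix regarded as a complex one. -/
def toComplexMatrix {m n : ℕ} (M : Matrix (Fin m) (Fin n) ℝ) : Matrix (Fin m) (Fin n) ℂ :=
  M.map fun x => (x : ℂ)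

/-- `Z ↦ [(e(Z) - Z X₀ᵗ) A (1, i)ᵗ]⁻¹ (Z - e(Z) X₀) D`, where `X₀` is the real `2 × n` matrix with
`Z₀ = e(Z₀) X₀`, and `A`, `D` are real with `A Aᵗ = (I - X₀ X₀ᵗ)⁻¹`, `D Dᵗ = (I - X₀ᵗ X₀)⁻¹`,
`det A > 0`. -/
def movesIV (n : ℕ) (z₀ : Fin n → ℂ) : Set ((Fin n → ℂ) → Fin n → ℂ) :=
  {φ | ∃ (X₀ : Matrix (Fin 2) (Fin n) ℝ) (A : Matrix (Fin 2) (Fin 2) ℝ)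
      (D : Matrix (Fin n) (Fin n) ℝ),
    z₀ = vecIV z₀ ᵥ* toComplexMatrix X₀ ∧
    A * Aᵀ = (1 - X₀ * X₀ᵀ)⁻¹ ∧ D * Dᵀ = (1 - X₀ᵀ * X₀)⁻¹ ∧ 0 < A.det ∧
    ∀ z ∈ domIV n, φ z =
      (((vecIV z - z ᵥ* toComplexMatrix X₀ᵀ) ᵥ* toComplexMatrix A) ⬝ᵥ ![1, Complex.I])⁻¹ •
        ((z - vecIV z ᵥ* toComplexMatrix X₀) ᵥ* toComplexMatrix D)}

/-! ### The Cartan–Hartogs domains, their automorphisms and the functions `log G_l` -/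

def YI (m n N : ℕ) (K : ℝ) : Set (Fin m × Fin n ⊕ Fin N → ℂ) :=
  hartogsDomain (domI m n) normI N K

def YII (p N : ℕ) (K : ℝ) : Set (Sym2 (Fin p) ⊕ Fin N → ℂ) :=
  hartogsDomain (domII p) normII N K

def YIII (q N : ℕ) (K : ℝ) : Set (SkewIndex q ⊕ Fin N → ℂ) :=
  hartogsDomain (domIII q) normIII N K

def YIV (n N : ℕ) (K : ℝ) : Set (Fin n ⊕ Fin N → ℂ) :=
  hartogsDomain (domIV n) normIV N K

def autYI (m n N : ℕ) (K : ℝ) :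
    Set ((Fin m × Fin n ⊕ Fin N → ℂ) → Fin m × Fin n ⊕ Fin N → ℂ) :=
  hartogsAut (domI m n) normI (movesI m n) N K

def autYII (p N : ℕ) (K : ℝ) : Set ((Sym2 (Fin p) ⊕ Fin N → ℂ) → Sym2 (Fin p) ⊕ Fin N → ℂ) :=
  hartogsAut (domII p) normII (movesII p) N K

def autYIII (q N : ℕ) (K : ℝ) : Set ((SkewIndex q ⊕ Fin N → ℂ) → SkewIndex q ⊕ Fin N → ℂ) :=
  hartogsAut (domIII q) normIII (movesIII q) N K

def autYIV (n N : ℕ) (K : ℝ) : Set ((Fin n ⊕ Fin N → ℂ) → Fin n ⊕ Fin N → ℂ) :=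
  hartogsAut (domIV n) normIV (movesIV n) N K

def logGI (m n N : ℕ) (K l : ℝ) : (Fin m × Fin n ⊕ Fin N → ℂ) → ℝ :=
  hartogsPotential normI ((m : ℝ) + n) K l

def logGII (p N : ℕ) (K l : ℝ) : (Sym2 (Fin p) ⊕ Fin N → ℂ) → ℝ :=
  hartogsPotential normII ((p : ℝ) + 1) K l

def logGIII (q N : ℕ) (K l : ℝ) : (SkewIndex q ⊕ Fin N → ℂ) → ℝ :=
  hartogsPotential normIII ((q : ℝ) - 1) K l

def logGIV (n N : ℕ) (K l : ℝ) : (Fin n ⊕ Fin N → ℂ) → ℝ :=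
  hartogsPotential normIV (n : ℝ) K l

end

/-!
The theorem is proved at once for all Hartogs domains `Y` over a bounded homogeneous domain
`R ⊆ ℂ^κ` whose norm function `h` transforms under the automorphisms `φ` with `φ z₀ = 0` by
`h(φz, φw) h(z, z₀) h(z₀, w) = h(z, w) h(z₀, z₀)`; the precise requirements are collected in
`IsHomogeneousDatum`. It then remains to exhibit the four families of classical domains as such
data. The unit ball, as a domain of one-row matrices, is one too, and it serves as reference domain.

*Reduction to points `(0, W)`.* All metrics occur through the Levi form `leviForm u z v` of a
potential, which obeys the chain rule for holomorphic maps and vanishes on `log |g|²` for `g`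
holomorphic without zeros. By the transformation law, the lift of `φ` to `Y` preserves `X`, and
changes `log G` by a pluriharmonic function, so it preserves the metric. The lift needs a
holomorphic logarithm of `h(·, z₀)` on the star-shaped domain `R` (`exists_holomorphic_log`). Every
point of `Y` is moved to a point `(0, W)` (`exists_mem_hartogsAut`), where the Levi form of `log G`
is explicit and positive definite, and comparable, uniformly in `W`, with the form `ballForm` of the
unit ball (`exists_ballForm_bounds`).

*The Bergman metric.* No formula for the Bergman kernel is used. With `ev z` the evaluation
functional at `z` on the Bergman space, `k(z, z) = ‖ev z‖²`, and the Levi form of `log ‖ev‖²` times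
`‖ev‖²` is the squared distance of `d ev(v)` from the line through `ev` (`leviForm_log_norm_sq`).
Both `‖ev‖²` and this distance are monotone under injective holomorphic maps, up to the Jacobian
determinant. At `(0, W)` the linear maps `(Z, W) ↦ (s Z, W)`, for suitable `s`, embed the ball in
`Y` and `Y` in the ball, because `h(Z, Z)` lies between `1 - C|Z|²` and `1 - c|Z|²`; they fix
`(0, W)`. So the Bergman metrics of `Y` and of the ball are equivalent at these points
(`leviForm_bergmanLog_le_of_clm`), that of the ball is equivalent to `ballForm` by homogeneity, and
invariance carries the comparison to all of `Y`.

*Completeness.* The function `-log (1 - X) - log h(Z, Z)` exhausts `Y`, in the sense that its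
sublevel sets are closed in `ℂ^κ × ℂ^N`, and its differential is bounded in the metric: for the
first summand this is checked at `(0, W)`, for the second it is `exists_fderiv_log_sq_le`, a
consequence of the Cauchy estimates for bounded holomorphic functions. The metric also dominates the
euclidean one. Hence a Cauchy sequence stays in a sublevel set and converges in `Y`
(`isCompleteMetricOn_of_exhaustion`).

*The classical domains.* For types I, II, III the maps are fractional linear maps of matrices, and
the transformation law is the invariance of a hermitian form under a block matrix
(`IsMobiusData.form_invariant`). For type IV the domain is embedded in the null quadric of a form of
signature `(2, n)` (`lieLift`), on which the maps act linearly; `h` is the hermitian version of the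
form, and that the denominators have no zeros follows by continuity along rays from the orientation
condition `det A > 0` (`IsLieBallMap.norm_lieNum_lt`).
-/


/-! ### Holomorphic functions of several variables -/

section SeveralVariables

open Metric Set Filter

lemma exists_forall_norm_le_ball {E F : Type*} [PseudoMetricSpace E] [SeminormedAddCommGroup F]
    {f : E → F} {U : Set E} (hU : IsOpen U)
    (hf : ContinuousOn f U) {z : E} (hz : z ∈ U) :
    ∃ r > 0, ∃ M, ball z r ⊆ U ∧ ∀ x ∈ ball z r, ‖f x‖ ≤ M := by
  have h1 : ∀ᶠ x in 𝓝 z, ‖f x‖ < ‖f z‖ + 1 :=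
    (hf.continuousAt (hU.mem_nhds hz)).norm.eventually_lt_const (by linarith)
  obtain ⟨r, hr, hsub⟩ := Metric.eventually_nhds_iff_ball.1 (h1.and (hU.mem_nhds hz))
  exact ⟨r, hr, ‖f z‖ + 1, fun x hx => (hsub x hx).2, fun x hx => (hsub x hx).1.le⟩

variable {E F : Type*} [NormedAddCommGroup E] [NormedSpace ℂ E] [NormedAddCommGroup F]
  [NormedSpace ℂ F]

lemma norm_fderiv_le_of_norm_le {f : E → F} {z : E} {r M : ℝ} (hr : 0 < r)
    (hd : DifferentiableOn ℂ f (ball z r)) (hM : ∀ x ∈ ball z r, ‖f x‖ ≤ M) :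
    ‖fderiv ℂ f z‖ ≤ 2 * M / r := by
  refine Complex.norm_fderiv_le_div_of_mapsTo_ball hd (fun x hx => ?_) hr
  rw [mem_closedBall, dist_eq_norm]
  exact (norm_sub_le _ _).trans (by linarith [hM x hx, hM z (mem_ball_self hr)])

lemma norm_sub_sub_fderiv_le {f : E → F} {z : E} {r M : ℝ} (hr : 0 < r)
    (hd : DifferentiableOn ℂ f (ball z r)) (hM : ∀ x ∈ ball z r, ‖f x‖ ≤ M) {x : E}
    (hx : x ∈ ball z r) :
    ‖f x - f z - fderiv ℂ f z (x - z)‖ ≤ 4 * M * (‖x - z‖ / r) ^ 2 := by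
  have hfz : DifferentiableAt ℂ f z := hd.differentiableAt (ball_mem_nhds z hr)
  set g : E → F := fun x => f x - f z - fderiv ℂ f z (x - z) with hg
  have hgz : g z = 0 := by simp [hg]
  have hM0 : 0 ≤ M := (norm_nonneg _).trans (hM z (mem_ball_self hr))
  have key := Complex.dist_le_mul_div_pow_of_mapsTo_ball_of_isLittleO (f := g) (c := z) (z := x)
    (R₁ := r) (R₂ := 4 * M) (n := 1) ?_ ?_ ?_ hx
  · simpa [hgz, dist_eq_norm, hg] using key
  · exact (hd.sub_const _).sub
      ((fderiv ℂ f z).differentiable.comp (differentiable_id.sub_const z)).differentiableOn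
  · intro y hy
    rw [mem_closedBall, hgz, dist_zero_right]
    have h1 := norm_fderiv_le_of_norm_le hr hd hM
    have h2 : ‖fderiv ℂ f z (y - z)‖ ≤ 2 * M := by
      refine ((fderiv ℂ f z).le_opNorm _).trans ?_
      have : ‖y - z‖ ≤ r := by rw [← dist_eq_norm]; exact (mem_ball.1 hy).le
      calc _ ≤ 2 * M / r * r := by gcongr
        _ = 2 * M := by field_simp
    calc ‖g y‖ ≤ ‖f y‖ + ‖f z‖ + ‖fderiv ℂ f z (y - z)‖ :=
          (norm_sub_le _ _).trans (by gcongr; exact norm_sub_le _ _)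
      _ ≤ 4 * M := by linarith [hM y hy, hM z (mem_ball_self hr)]
  · simpa [hgz, hg] using hfz.hasFDerivAt.isLittleO.norm_right

lemma continuousOn_fderiv_complex {f : E → F} {U : Set E} (hU : IsOpen U)
    (hf : DifferentiableOn ℂ f U) : ContinuousOn (fderiv ℂ f) U := by
  intro z hz
  obtain ⟨r, hr, M, hrU, hM⟩ := exists_forall_norm_le_ball hU hf.continuousOn hz
  have hM0 : 0 ≤ M := (norm_nonneg _).trans (hM z (mem_ball_self hr))
  have hlip : ∀ x ∈ ball z (r / 2), ‖fderiv ℂ f x‖ ≤ 2 * M / (r / 2) := by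
    intro x hx
    have : ball x (r / 2) ⊆ ball z r := ball_subset_ball' (by linarith [mem_ball.1 hx])
    exact norm_fderiv_le_of_norm_le (half_pos hr) (hf.mono (this.trans hrU))
      fun y hy => hM y (this hy)
  have hdiff : ∀ x ∈ ball z (r / 2), DifferentiableAt ℂ f x := fun x hx =>
    hf.differentiableAt (hU.mem_nhds (hrU (ball_subset_ball (by linarith) hx)))
  refine ContinuousAt.continuousWithinAt ?_
  refine Metric.continuousAt_iff.2 fun ε hε => ?_
  -- On `ball z (r / 2)` the map `f` is `C`-Lipschitz, so Cauchy's estimate applied to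
  -- `y ↦ f (y + (x - z)) - f y` bounds `f' x - f' z`.
  set C := 2 * M / (r / 2) with hC
  have hC0 : 0 ≤ C := by positivity
  refine ⟨min (r / 4) (ε * (r / 4) / (2 * C + 1)), by positivity, fun x hx => ?_⟩
  have hx1 : dist x z < r / 4 := hx.trans_le (min_le_left _ _)
  have hx2 : dist x z < ε * (r / 4) / (2 * C + 1) := hx.trans_le (min_le_right _ _)
  have hmem : ∀ y ∈ ball z (r / 4), y + (x - z) ∈ ball z (r / 2) := fun y hy => by
    simp only [mem_ball, dist_eq_norm] at hx1 hy ⊢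
    calc ‖y + (x - z) - z‖ = ‖(y - z) + (x - z)‖ := by congr 1; abel
      _ ≤ ‖y - z‖ + ‖x - z‖ := norm_add_le _ _
      _ < r / 2 := by linarith
  have hmem' : ∀ y ∈ ball z (r / 4), y ∈ ball z (r / 2) := fun y hy =>
    ball_subset_ball (by linarith) hy
  set g : E → F := fun y => f (y + (x - z)) - f y with hg
  have hgd : ∀ y ∈ ball z (r / 4),
      HasFDerivAt g (fderiv ℂ f (y + (x - z)) - fderiv ℂ f y) y := fun y hy =>
    ((hasFDerivAt_comp_add_right _).2 (hdiff _ (hmem y hy)).hasFDerivAt).sub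
      (hdiff y (hmem' y hy)).hasFDerivAt
  have hgb : ∀ y ∈ ball z (r / 4), ‖g y‖ ≤ C * ‖x - z‖ := fun y hy => by
    have := (convex_ball z (r / 2)).norm_image_sub_le_of_norm_fderiv_le (𝕜 := ℂ) hdiff hlip
      (hmem' y hy) (hmem y hy)
    simpa using this
  have h1 := norm_fderiv_le_of_norm_le (by positivity : 0 < r / 4)
    (fun y hy => (hgd y hy).differentiableAt.differentiableWithinAt) hgb
  rw [(hgd z (mem_ball_self (by positivity))).fderiv, add_sub_cancel] at h1
  rw [dist_eq_norm]
  refine h1.trans_lt ?_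
  rw [lt_div_iff₀ (by positivity), dist_eq_norm] at hx2
  rw [div_lt_iff₀ (by positivity)]
  nlinarith [norm_nonneg (x - z)]

/-- A directional derivative of a holomorphic function is holomorphic: differentiate Cauchy's
formula along the complex line in that direction under the integral sign. -/
lemma differentiableOn_fderiv_apply_complex [CompleteSpace F] {f : E → F} {U : Set E}
    (hU : IsOpen U) (hf : DifferentiableOn ℂ f U) (v : E) :
    DifferentiableOn ℂ (fun z => fderiv ℂ f z v) U := by
  intro z hz
  refine DifferentiableAt.differentiableWithinAt ?_
  obtain ⟨r, hr, M, hrU, hM⟩ := exists_forall_norm_le_ball hU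
    (continuousOn_fderiv_complex hU hf) hz
  obtain ⟨δ, hδ, hδv⟩ : ∃ δ > 0, δ * ‖v‖ < r / 2 :=
    ⟨r / 2 / (‖v‖ + 1), by positivity, by
      rw [div_mul_eq_mul_div, div_lt_iff₀ (by positivity)]
      nlinarith [norm_nonneg v]⟩
  have hmem : ∀ x ∈ ball z (r / 2), ∀ ζ : ℂ, ‖ζ‖ ≤ δ → x + ζ • v ∈ ball z r := by
    intro x hx ζ hζ
    rw [mem_ball, dist_eq_norm] at *
    calc ‖x + ζ • v - z‖ = ‖(x - z) + ζ • v‖ := by congr 1; abel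
      _ ≤ ‖x - z‖ + ‖ζ‖ * ‖v‖ := (norm_add_le _ _).trans (by rw [norm_smul])
      _ ≤ ‖x - z‖ + δ * ‖v‖ := by gcongr
      _ < r := by linarith
  have hfd : ∀ x ∈ ball z r, HasFDerivAt f (fderiv ℂ f x) x := fun x hx =>
    (hf.differentiableAt (hU.mem_nhds (hrU hx))).hasFDerivAt
  have hcm : ∀ θ : ℝ, ‖circleMap 0 δ θ‖ ≤ δ := fun θ => by simp [abs_of_pos hδ]
  -- Cauchy's formula for the derivative along the line
  have hform : ∀ x ∈ ball z (r / 2), fderiv ℂ f x v = (2 * Real.pi * Complex.I : ℂ)⁻¹ •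
      ∫ θ in (0 : ℝ)..2 * Real.pi, (deriv (circleMap 0 δ) θ * ((circleMap 0 δ θ) ^ 2)⁻¹) •
        f (x + circleMap 0 δ θ • v) := by
    intro x hx
    have hline : ∀ ζ : ℂ, HasFDerivAt (fun ζ : ℂ => x + ζ • v)
        ((ContinuousLinearMap.id ℂ ℂ).smulRight v) ζ := fun ζ =>
      ((hasFDerivAt_id ζ).smul_const v).const_add x
    have hgd : DifferentiableOn ℂ (fun ζ : ℂ => f (x + ζ • v)) (closedBall 0 δ) := by
      intro ζ hζ
      exact ((hfd _ (hmem x hx ζ (by simpa using hζ))).comp ζ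
        (hline ζ)).differentiableAt.differentiableWithinAt
    have h0 := hgd.deriv_eq_smul_circleIntegral hδ
    have h1 : deriv (fun ζ : ℂ => f (x + ζ • v)) 0 = fderiv ℂ f x v := by
      have := (hfd (x + (0 : ℂ) • v) (hmem x hx 0 (by simpa using hδ.le))).comp 0 (hline 0)
      have := this.hasDerivAt.deriv
      simpa [Function.comp_def] using this
    rw [← h1, eq_inv_smul_iff₀ (by simp [Real.pi_ne_zero]), ← h0, circleIntegral]
    refine intervalIntegral.integral_congr fun θ _ => ?_
    simp [smul_smul]
  have hev : (fun x => fderiv ℂ f x v) =ᶠ[𝓝 z] fun x => (2 * Real.pi * Complex.I : ℂ)⁻¹ •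
      ∫ θ in (0 : ℝ)..2 * Real.pi, (deriv (circleMap 0 δ) θ * ((circleMap 0 δ θ) ^ 2)⁻¹) •
        f (x + circleMap 0 δ θ • v) := by
    filter_upwards [ball_mem_nhds z (half_pos hr)] with x hx using hform x hx
  refine DifferentiableAt.congr_of_eventuallyEq ?_ hev
  refine DifferentiableAt.const_smul ?_ _
  have hcirc : Continuous fun θ : ℝ => deriv (circleMap 0 δ) θ * ((circleMap 0 δ θ) ^ 2)⁻¹ := by
    simp only [deriv_circleMap]
    refine Continuous.mul (by fun_prop) (Continuous.inv₀ (by fun_prop) fun θ => ?_)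
    exact pow_ne_zero _ (circleMap_ne_center hδ.ne')
  have hpath : ∀ x ∈ ball z (r / 2), ∀ θ : ℝ, x + circleMap 0 δ θ • v ∈ U := fun x hx θ =>
    hrU (hmem x hx _ (hcm θ))
  have hcont : ∀ x ∈ ball z (r / 2), Continuous fun θ : ℝ =>
      (deriv (circleMap 0 δ) θ * ((circleMap 0 δ θ) ^ 2)⁻¹) • f (x + circleMap 0 δ θ • v) := by
    intro x hx
    refine hcirc.smul (hf.continuousOn.comp_continuous (by fun_prop) (hpath x hx))
  have hcont' : Continuous fun θ : ℝ => (deriv (circleMap 0 δ) θ * ((circleMap 0 δ θ) ^ 2)⁻¹) •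
      fderiv ℂ f (z + circleMap 0 δ θ • v) :=
    hcirc.smul ((continuousOn_fderiv_complex hU hf).comp_continuous (by fun_prop)
      (hpath z (mem_ball_self (half_pos hr))))
  refine (intervalIntegral.hasFDerivAt_integral_of_dominated_of_fderiv_le
    (F' := fun x θ => (deriv (circleMap 0 δ) θ * ((circleMap 0 δ θ) ^ 2)⁻¹) •
      fderiv ℂ f (x + circleMap 0 δ θ • v))
    (bound := fun θ => ‖deriv (circleMap 0 δ) θ * ((circleMap 0 δ θ) ^ 2)⁻¹‖ * M)
    (ball_mem_nhds z (half_pos hr)) ?_ ?_ ?_ ?_ ?_ ?_).differentiableAt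
  · filter_upwards [ball_mem_nhds z (half_pos hr)] with x hx
    exact (hcont x hx).aestronglyMeasurable
  · exact (hcont z (mem_ball_self (half_pos hr))).intervalIntegrable _ _
  · exact hcont'.aestronglyMeasurable
  · refine .of_forall fun θ _ x hx => ?_
    rw [norm_smul]
    gcongr
    exact hM _ (hmem x hx _ (hcm θ))
  · exact (hcirc.norm.mul continuous_const).intervalIntegrable _ _
  · refine .of_forall fun θ _ x hx => ?_
    exact ((hasFDerivAt_comp_add_right _).2 (hfd _ (hmem x hx _ (hcm θ)))).const_smul _

/-- Holomorphic functions on an open set of a finite dimensional space are smooth. -/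
lemma contDiffOn_complex [FiniteDimensional ℂ E] [CompleteSpace F] {f : E → F}
    {U : Set E} (hU : IsOpen U) (hf : DifferentiableOn ℂ f U) : ContDiffOn ℂ ∞ f U := by
  rw [contDiffOn_infty]
  intro n
  induction n generalizing f with
  | zero => simpa using hf.continuousOn
  | succ n ih =>
    push_cast
    rw [contDiffOn_succ_iff_fderiv_of_isOpen hU]
    refine ⟨hf, by simp, ?_⟩
    rw [contDiffOn_clm_apply]
    exact fun v => ih (differentiableOn_fderiv_apply_complex hU hf v)

lemma differentiableOn_matrix_det {n : Type*} [Fintype n] [DecidableEq n] {M : E → Matrix n n ℂ}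
    {U : Set E} (h : ∀ i j, DifferentiableOn ℂ (fun z => M z i j) U) :
    DifferentiableOn ℂ (fun z => (M z).det) U := by
  simp only [Matrix.det_apply]
  refine DifferentiableOn.fun_sum fun σ _ => DifferentiableOn.const_smul ?_ _
  exact fun z hz => (HasFDerivWithinAt.finsetProd fun i _ =>
    ((h (σ i) i) z hz).hasFDerivWithinAt).differentiableWithinAt

end SeveralVariables

section MeanValue

open Metric Set MeasureTheory

variable {ι : Type*} [Fintype ι]

lemma measurePreserving_smul_of_norm_one {a : ℂ} (ha : ‖a‖ = 1) :
    MeasurePreserving (fun y : ι → ℂ => a • y) volume volume := by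
  have h : MeasurePreserving (fun z : ℂ => a * z) volume volume :=
    (rotation (⟨a, by simp [Submonoid.unitSphere, ha]⟩ : Circle)).measurePreserving
  exact volume_preserving_pi fun _ => h

lemma setIntegral_closedBall_smul {a : ℂ} (ha : ‖a‖ = 1) (r : ℝ) (g : (ι → ℂ) → ℂ) :
    ∫ y in closedBall (0 : ι → ℂ) r, g (a • y) = ∫ y in closedBall (0 : ι → ℂ) r, g y := by
  have hemb : MeasurableEmbedding fun y : ι → ℂ => a • y :=
    (Homeomorph.smulOfNeZero a (by intro h; simp [h] at ha)).measurableEmbedding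
  rw [← (measurePreserving_smul_of_norm_one ha).setIntegral_preimage_emb hemb g]
  congr 2
  ext y
  simp [norm_smul, ha]

/-- The mean value property on polydiscs: average over the rotations `y ↦ e^{iθ} y`, and use the
mean value property on circles in complex lines. -/
lemma setIntegral_closedBall_add_eq {f : (ι → ℂ) → ℂ} {z : ι → ℂ} {r : ℝ}
    {U : Set (ι → ℂ)} (hU : IsOpen U) (hf : DifferentiableOn ℂ f U) (hsub : closedBall z r ⊆ U) :
    ∫ y in closedBall (0 : ι → ℂ) r, f (z + y) =
      (volume.real (closedBall (0 : ι → ℂ) r) : ℂ) * f z := by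
  set B := closedBall (0 : ι → ℂ) r with hB
  have hmem : ∀ y ∈ B, ∀ ζ : ℂ, ‖ζ‖ ≤ 1 → z + ζ • y ∈ U := fun y hy ζ hζ => by
    apply hsub
    rw [hB, mem_closedBall_zero_iff] at hy
    rw [mem_closedBall, dist_eq_norm, add_sub_cancel_left, norm_smul]
    nlinarith [norm_nonneg ζ, norm_nonneg y]
  have hmean : ∀ y ∈ B, Real.circleAverage (fun ζ : ℂ => f (z + ζ • y)) 0 1 = f z := by
    intro y hy
    have hd : DifferentiableOn ℂ (fun ζ : ℂ => f (z + ζ • y)) (closedBall 0 1) := by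
      intro ζ hζ
      have h1 : DifferentiableAt ℂ f (z + ζ • y) :=
        hf.differentiableAt (hU.mem_nhds (hmem y hy ζ (by simpa using hζ)))
      have h2 : DifferentiableAt ℂ (fun ζ : ℂ => z + ζ • y) ζ := by fun_prop
      exact (h1.comp ζ h2).differentiableWithinAt
    have := DiffContOnCl.circleAverage (f := fun ζ : ℂ => f (z + ζ • y)) (c := 0) (R := 1)
      (by rw [abs_one]; exact hd.diffContOnCl_ball subset_rfl)
    simpa using this
  have hcont : ContinuousOn (fun p : (ι → ℂ) × ℝ => f (z + circleMap 0 1 p.2 • p.1))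
      (B ×ˢ Icc 0 (2 * Real.pi)) := by
    refine hf.continuousOn.comp (by fun_prop) fun p hp => ?_
    exact hmem p.1 hp.1 _ (by simp)
  have hint : Integrable (Function.uncurry fun (y : ι → ℂ) (θ : ℝ) => f (z + circleMap 0 1 θ • y))
      ((volume.restrict B).prod (volume.restrict (Ioc 0 (2 * Real.pi)))) := by
    rw [Measure.prod_restrict]
    exact (hcont.integrableOn_compact ((isCompact_closedBall _ _).prod isCompact_Icc)).mono_set
      (prod_mono le_rfl Ioc_subset_Icc_self)
  have hswap := integral_integral_swap hint
  have h1 : ∫ y in B, ∫ θ in Ioc 0 (2 * Real.pi), f (z + circleMap 0 1 θ • y) =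
      ∫ y in B, (2 * Real.pi : ℂ) * f z := by
    refine setIntegral_congr_fun measurableSet_closedBall fun y hy => ?_
    have h := hmean y hy
    rw [Real.circleAverage, intervalIntegral.integral_of_le (by positivity)] at h
    rw [← h, Complex.real_smul]
    push_cast
    rw [← mul_assoc, mul_inv_cancel₀ (by simp [Real.pi_ne_zero]), one_mul]
  have h2 : ∀ θ : ℝ, ∫ y in B, f (z + circleMap 0 1 θ • y) = ∫ y in B, f (z + y) := fun θ =>
    setIntegral_closedBall_smul (a := circleMap 0 1 θ) (by simp) r fun y => f (z + y)
  simp only [h2] at hswap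
  rw [h1] at hswap
  simp only [integral_const, measureReal_restrict_apply MeasurableSet.univ, univ_inter,
    Complex.real_smul, Real.volume_real_Ioc] at hswap
  rw [sub_zero, max_eq_left (by positivity)] at hswap
  have hpi : (2 * Real.pi : ℂ) ≠ 0 := by simp [Real.pi_ne_zero]
  apply mul_left_cancel₀ hpi
  push_cast at hswap
  rw [← hswap]
  ring

/-- Point evaluations are bounded in `L²`-norm, locally uniformly. -/
lemma exists_forall_norm_le_eLpNorm {U : Set (ι → ℂ)} (hU : IsOpen U) {z : ι → ℂ} {r : ℝ}
    (hr : 0 < r) (hsub : closedBall z (2 * r) ⊆ U) :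
    ∃ C, 0 ≤ C ∧ ∀ f : (ι → ℂ) → ℂ, DifferentiableOn ℂ f U → MemLp f 2 (volume.restrict U) →
      ∀ x ∈ closedBall z r, ‖f x‖ ≤ C * (eLpNorm f 2 (volume.restrict U)).toReal := by
  set V := volume.real (closedBall (0 : ι → ℂ) r) with hV
  have hVpos : 0 < V := by
    rw [hV, Measure.real, ENNReal.toReal_pos_iff]
    exact ⟨measure_closedBall_pos _ _ hr, measure_closedBall_lt_top⟩
  refine ⟨V⁻¹ * V ^ (1 / 2 : ℝ), by positivity, fun f hf hL x hx => ?_⟩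
  have hxsub : closedBall x r ⊆ U := (closedBall_subset_closedBall' (by
    linarith [mem_closedBall.1 hx])).trans hsub
  -- the mean value property on `closedBall x r` and the Cauchy–Schwarz inequality
  have hmv := setIntegral_closedBall_add_eq hU hf hxsub
  have htr : MeasurePreserving (fun y : ι → ℂ => x + y) volume volume :=
    measurePreserving_add_left volume x
  have hemb : MeasurableEmbedding fun y : ι → ℂ => x + y :=
    (Homeomorph.addLeft x).measurableEmbedding
  have hpre : (fun y : ι → ℂ => x + y) ⁻¹' closedBall x r = closedBall 0 r := by
    ext y; simp [dist_eq_norm]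
  have hset : ∫ y in closedBall (0 : ι → ℂ) r, ‖f (x + y)‖ = ∫ y in closedBall x r, ‖f y‖ := by
    rw [← htr.setIntegral_preimage_emb hemb (fun y => ‖f y‖), hpre]
  have hVx : volume (closedBall x r) = volume (closedBall (0 : ι → ℂ) r) := by
    rw [← hpre, htr.measure_preimage measurableSet_closedBall.nullMeasurableSet]
  have hLx : MemLp f 2 (volume.restrict (closedBall x r)) :=
    hL.mono_measure (Measure.restrict_mono hxsub le_rfl)
  have hfin : IsFiniteMeasure (volume.restrict (closedBall x r)) :=
    ⟨by simpa using measure_closedBall_lt_top⟩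
  have hL1 : ∫ y in closedBall x r, ‖f y‖ =
      (eLpNorm f 1 (volume.restrict (closedBall x r))).toReal := by
    rw [integral_norm_eq_lintegral_enorm hLx.1, eLpNorm_one_eq_lintegral_enorm]
  have hHolder := eLpNorm_le_eLpNorm_mul_rpow_measure_univ (μ := volume.restrict (closedBall x r))
    (f := f) (p := 1) (q := 2) (by norm_num) hLx.1
  have hmono : eLpNorm f 2 (volume.restrict (closedBall x r)) ≤
      eLpNorm f 2 (volume.restrict U) :=
    eLpNorm_mono_measure f (Measure.restrict_mono hxsub le_rfl)
  have hb : ∫ y in closedBall x r, ‖f y‖ ≤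
      (eLpNorm f 2 (volume.restrict U)).toReal * V ^ (1 / 2 : ℝ) := by
    rw [hL1, hV, Measure.real, ENNReal.toReal_rpow, ← ENNReal.toReal_mul]
    refine ENNReal.toReal_mono (ENNReal.mul_ne_top hL.2.ne
      (ENNReal.rpow_ne_top_of_nonneg (by norm_num) measure_closedBall_lt_top.ne)) ?_
    refine hHolder.trans ?_
    rw [Measure.restrict_apply_univ, hVx]
    norm_num
    gcongr
  have h3 : V * ‖f x‖ ≤ ∫ y in closedBall x r, ‖f y‖ := by
    rw [← hset]
    calc V * ‖f x‖ = ‖(V : ℂ) * f x‖ := by simp [abs_of_pos hVpos]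
      _ = ‖∫ y in closedBall (0 : ι → ℂ) r, f (x + y)‖ := by rw [hmv]
      _ ≤ _ := norm_integral_le_integral_norm _
  have h4 : V * ‖f x‖ ≤ (eLpNorm f 2 (volume.restrict U)).toReal * V ^ (1 / 2 : ℝ) := h3.trans hb
  calc ‖f x‖ = V⁻¹ * (V * ‖f x‖) := by field_simp
    _ ≤ V⁻¹ * ((eLpNorm f 2 (volume.restrict U)).toReal * V ^ (1 / 2 : ℝ)) := by gcongr
    _ = _ := by ring

end MeanValue



/-! ### The Levi form of a potential -/

section SecondDerivative

variable {E F G : Type*} [NormedAddCommGroup E] [NormedSpace ℝ E] [NormedAddCommGroup F]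
  [NormedSpace ℝ F] [NormedAddCommGroup G] [NormedSpace ℝ G]

lemma ContDiffAt.differentiableAt_fderiv_two {u : E → F} {z : E} (hu : ContDiffAt ℝ 2 u z) :
    DifferentiableAt ℝ (fderiv ℝ u) z :=
  (hu.fderiv_right (m := 1) (by norm_num)).differentiableAt (by norm_num)

lemma fderiv_fderiv_comp {u : F → G} {f : E → F} {z : E} (hu : ContDiffAt ℝ 2 u (f z))
    (hf : ContDiffAt ℝ 2 f z) (a b : E) :
    fderiv ℝ (fderiv ℝ (u ∘ f)) z a b =
      fderiv ℝ (fderiv ℝ u) (f z) (fderiv ℝ f z a) (fderiv ℝ f z b) +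
        fderiv ℝ u (f z) (fderiv ℝ (fderiv ℝ f) z a b) := by
  have h1 : ∀ᶠ x in 𝓝 z, DifferentiableAt ℝ f x :=
    (hf.eventually (by simp)).mono fun x hx => hx.differentiableAt (by norm_num)
  have h2 : ∀ᶠ x in 𝓝 z, DifferentiableAt ℝ u (f x) :=
    hf.continuousAt.eventually
      ((hu.eventually (by simp)).mono fun x hx => hx.differentiableAt (by norm_num))
  have hev : fderiv ℝ (u ∘ f) =ᶠ[𝓝 z] fun x => (fderiv ℝ u (f x)).comp (fderiv ℝ f x) := by
    filter_upwards [h1, h2] with x hx hx' using fderiv_comp x hx' hx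
  have hf1 : HasFDerivAt f (fderiv ℝ f z) z := (hf.differentiableAt (by norm_num)).hasFDerivAt
  have hu2 : HasFDerivAt (fun x => fderiv ℝ u (f x))
      ((fderiv ℝ (fderiv ℝ u) (f z)).comp (fderiv ℝ f z)) z :=
    (hu.differentiableAt_fderiv_two.hasFDerivAt).comp z hf1
  have hf2 : HasFDerivAt (fderiv ℝ f) (fderiv ℝ (fderiv ℝ f) z) z :=
    hf.differentiableAt_fderiv_two.hasFDerivAt
  rw [hev.fderiv_eq, (hu2.clm_comp hf2).fderiv]
  simp [add_comm]

lemma fderiv_fderiv_clm (L : F →L[ℝ] G) (z : F) : fderiv ℝ (fderiv ℝ (L : F → G)) z = 0 := by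
  have : fderiv ℝ (L : F → G) = fun _ => L := by ext1 x; exact L.fderiv
  rw [this]; simp

end SecondDerivative

section LeviForm

variable {E F : Type*} [NormedAddCommGroup E] [NormedSpace ℂ E] [NormedSpace ℝ E]
  [NormedAddCommGroup F] [NormedSpace ℂ F] [NormedSpace ℝ F]

/-- The Levi form `∑ ∂²u/∂z_i∂z̄_j v_i v̄_j`, which is a quarter of the Laplacian of
`ζ ↦ u (z + ζ v)` at `0`. -/
noncomputable def leviForm (u : E → ℝ) (z v : E) : ℝ :=
  (fderiv ℝ (fderiv ℝ u) z v v + fderiv ℝ (fderiv ℝ u) z (Complex.I • v) (Complex.I • v)) / 4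

/-- The squared modulus `|∂u(v)|²` of the holomorphic differential of a real function. -/
noncomputable def dbarSq (u : E → ℝ) (z v : E) : ℝ :=
  ((fderiv ℝ u z v) ^ 2 + (fderiv ℝ u z (Complex.I • v)) ^ 2) / 4

lemma Filter.EventuallyEq.leviForm_eq {u u' : E → ℝ} {z : E} (h : u =ᶠ[𝓝 z] u') (v : E) :
    leviForm u z v = leviForm u' z v := by
  unfold leviForm
  rw [h.fderiv.fderiv_eq]

lemma Filter.EventuallyEq.dbarSq_eq {u u' : E → ℝ} {z : E} (h : u =ᶠ[𝓝 z] u') (v : E) :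
    dbarSq u z v = dbarSq u' z v := by
  unfold dbarSq
  rw [h.fderiv_eq]

lemma leviForm_add {u u' : E → ℝ} {z : E} (hu : ContDiffAt ℝ 2 u z) (hu' : ContDiffAt ℝ 2 u' z)
    (v : E) : leviForm (fun x => u x + u' x) z v = leviForm u z v + leviForm u' z v := by
  have hev : fderiv ℝ (fun x => u x + u' x) =ᶠ[𝓝 z] fun x => fderiv ℝ u x + fderiv ℝ u' x := by
    filter_upwards [hu.eventually (by simp), hu'.eventually (by simp)] with x hx hx'
    exact fderiv_fun_add (hx.differentiableAt (by norm_num)) (hx'.differentiableAt (by norm_num))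
  unfold leviForm
  rw [hev.fderiv_eq,
    fderiv_fun_add hu.differentiableAt_fderiv_two hu'.differentiableAt_fderiv_two]
  simp only [add_apply]
  ring

lemma leviForm_const_mul {u : E → ℝ} {z : E} (hu : ContDiffAt ℝ 2 u z) (c : ℝ) (v : E) :
    leviForm (fun x => c * u x) z v = c * leviForm u z v := by
  have hev : fderiv ℝ (fun x => c * u x) =ᶠ[𝓝 z] fun x => c • fderiv ℝ u x := by
    filter_upwards [hu.eventually (by simp)] with x hx
    exact fderiv_const_mul (hx.differentiableAt (by norm_num)) c
  unfold leviForm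
  rw [hev.fderiv_eq, fderiv_fun_const_smul hu.differentiableAt_fderiv_two]
  simp only [smul_apply, smul_eq_mul]
  ring

lemma leviForm_sub {u u' : E → ℝ} {z : E} (hu : ContDiffAt ℝ 2 u z) (hu' : ContDiffAt ℝ 2 u' z)
    (v : E) : leviForm (fun x => u x - u' x) z v = leviForm u z v - leviForm u' z v := by
  have := leviForm_add hu (contDiffAt_const.mul hu' : ContDiffAt ℝ 2 (fun x => (-1) * u' x) z) v
  rw [leviForm_const_mul hu'] at this
  simpa [sub_eq_add_neg] using this

lemma leviForm_const (c : ℝ) (z v : E) : leviForm (fun _ : E => c) z v = 0 := by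
  have : fderiv ℝ (fun _ : E => c) = fun _ => 0 := by ext1 x; simp
  simp [leviForm, this]

lemma leviForm_real_comp {u : E → ℝ} {g : ℝ → ℝ} {z : E} (hu : ContDiffAt ℝ 2 u z)
    (hg : ContDiffAt ℝ 2 g (u z)) (v : E) :
    leviForm (fun x => g (u x)) z v =
      deriv g (u z) * leviForm u z v + deriv (deriv g) (u z) * dbarSq u z v := by
  have h := fun w => fderiv_fderiv_comp hg hu w w
  have h2 : ∀ s t : ℝ, fderiv ℝ (fderiv ℝ g) (u z) s t = s * t * deriv (deriv g) (u z) := by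
    intro s t
    have h3 : fderiv ℝ g = fun x => ContinuousLinearMap.toSpanSingleton ℝ (deriv g x) := by
      ext x; simp
    have h4 : DifferentiableAt ℝ (deriv g) (u z) :=
      hg.differentiableAt_fderiv_two.clm_apply (differentiableAt_const (1 : ℝ))
    have h5 : HasFDerivAt (fderiv ℝ g) ((ContinuousLinearMap.toSpanSingletonCLE (𝕜 := ℝ) (E := ℝ)
        : ℝ →L[ℝ] ℝ →L[ℝ] ℝ).comp (fderiv ℝ (deriv g) (u z))) (u z) := by
      rw [h3]
      exact (ContinuousLinearMap.toSpanSingletonCLE (𝕜 := ℝ) (E := ℝ)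
        : ℝ →L[ℝ] ℝ →L[ℝ] ℝ).hasFDerivAt.comp (u z) h4.hasFDerivAt
    rw [h5.fderiv]
    change (ContinuousLinearMap.toSpanSingleton ℝ (fderiv ℝ (deriv g) (u z) s)) t = _
    simp
    ring
  have h6 : ∀ s : ℝ, fderiv ℝ g (u z) s = s * deriv g (u z) := fun s => by simp
  unfold leviForm dbarSq
  change (fderiv ℝ (fderiv ℝ (g ∘ u)) z v v + fderiv ℝ (fderiv ℝ (g ∘ u)) z _ _) / 4 = _
  rw [h, h, h2, h2, h6, h6]
  ring

lemma dbarSq_real_comp {u : E → ℝ} {g : ℝ → ℝ} {z : E} (hu : DifferentiableAt ℝ u z)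
    (hg : DifferentiableAt ℝ g (u z)) (v : E) :
    dbarSq (fun x => g (u x)) z v = deriv g (u z) ^ 2 * dbarSq u z v := by
  unfold dbarSq
  have : fderiv ℝ (fun x => g (u x)) z = (fderiv ℝ g (u z)).comp (fderiv ℝ u z) :=
    fderiv_comp z hg hu
  rw [this]
  simp
  ring

lemma leviForm_log {u : E → ℝ} {z : E} (hu : ContDiffAt ℝ 2 u z) (h0 : u z ≠ 0) (v : E) :
    leviForm (fun x => Real.log (u x)) z v =
      leviForm u z v / u z - dbarSq u z v / u z ^ 2 := by
  rw [leviForm_real_comp hu (Real.contDiffAt_log.2 h0)]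
  have h1 : deriv (deriv Real.log) (u z) = -(u z ^ 2)⁻¹ := by
    have : deriv Real.log = fun x => x⁻¹ := by ext1 x; simp
    rw [this, deriv_inv]
  rw [h1, Real.deriv_log]
  ring

/-- Otherwise the second derivative test along a line makes the point a local maximum of the
restriction to it as well, so that the restriction is locally constant. -/
lemma leviForm_nonneg_of_isLocalMin {u : E → ℝ} {z : E} (hu : ContDiffAt ℝ 2 u z)
    (hmin : IsLocalMin u z) (v : E) : 0 ≤ leviForm u z v := by
  suffices h : ∀ w, 0 ≤ fderiv ℝ (fderiv ℝ u) z w w by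
    unfold leviForm; linarith [h v, h (Complex.I • v)]
  intro w
  by_contra! hneg
  set l : ℝ → E := fun t => z + t • w with hl
  have hl0 : l 0 = z := by simp [hl]
  have hlc : Continuous l := by fun_prop
  have hld : ∀ t, HasDerivAt l w t := fun t => by
    simpa only [one_smul, id] using ((hasDerivAt_id t).smul_const w).const_add z
  have hlim : Filter.Tendsto l (𝓝 0) (𝓝 z) := by simpa [hl0] using hlc.tendsto 0
  have hd1 : deriv (u ∘ l) =ᶠ[𝓝 0] fun t => fderiv ℝ u (l t) w := by
    filter_upwards [hlim.eventually (hu.eventually (by simp))] with t ht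
    exact ((ht.differentiableAt (by norm_num)).hasFDerivAt.comp_hasDerivAt t (hld t)).deriv
  have hd2 : deriv (deriv (u ∘ l)) 0 = fderiv ℝ (fderiv ℝ u) z w w := by
    rw [hd1.deriv_eq]
    have h1 : HasFDerivAt (fderiv ℝ u) (fderiv ℝ (fderiv ℝ u) z) (l 0) := by
      rw [hl0]; exact hu.differentiableAt_fderiv_two.hasFDerivAt
    have h2 := (h1.comp_hasDerivAt 0 (hld 0)).clm_apply (hasDerivAt_const (0 : ℝ) w)
    simpa using h2.deriv
  have hmin' : IsLocalMin (u ∘ l) 0 := by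
    have : ∀ᶠ t in 𝓝 (0 : ℝ), u z ≤ u (l t) := hlim.eventually hmin
    simpa [IsLocalMin, IsMinFilter, hl0] using this
  have hcont : ContinuousAt (u ∘ l) 0 := by
    refine ContinuousAt.comp ?_ hlc.continuousAt
    rw [hl0]; exact hu.continuousAt
  have hmax : IsLocalMax (u ∘ l) 0 :=
    isLocalMax_of_deriv_deriv_neg (by rw [hd2]; exact hneg) hmin'.deriv_eq_zero hcont
  have hconst : u ∘ l =ᶠ[𝓝 0] fun _ => (u ∘ l) 0 := by
    filter_upwards [hmin', hmax] with t h1 h2 using le_antisymm h2 h1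
  have : deriv (deriv (u ∘ l)) 0 = 0 := by
    rw [hconst.deriv.deriv_eq]; simp
  linarith

lemma dbarSq_eq_zero_of_isLocalExtr {u : E → ℝ} {z : E} (h : IsLocalExtr u z) (v : E) :
    dbarSq u z v = 0 := by
  unfold dbarSq; rw [h.fderiv_eq_zero]; simp

variable [IsScalarTower ℝ ℂ E] [IsScalarTower ℝ ℂ F]

/-- The second real derivative of a holomorphic map is complex bilinear. -/
lemma fderiv_fderiv_I_smul {f : E → F} {z : E} (hf : ContDiffAt ℂ 2 f z) (v : E) :
    fderiv ℝ (fderiv ℝ f) z (Complex.I • v) (Complex.I • v) = -fderiv ℝ (fderiv ℝ f) z v v := by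
  have hev : fderiv ℝ f =ᶠ[𝓝 z] fun x =>
      ContinuousLinearMap.restrictScalarsL ℂ E F ℝ ℝ (fderiv ℂ f x) := by
    filter_upwards [hf.eventually (by simp)] with x hx
    exact ((hx.differentiableAt (by norm_num)).hasFDerivAt.restrictScalars ℝ).fderiv
  have h2 : DifferentiableAt ℂ (fderiv ℂ f) z :=
    (hf.fderiv_right (m := 1) (by norm_num)).differentiableAt (by norm_num)
  have h3 : HasFDerivAt (fun x => ContinuousLinearMap.restrictScalarsL ℂ E F ℝ ℝ (fderiv ℂ f x))
      ((ContinuousLinearMap.restrictScalarsL ℂ E F ℝ ℝ).comp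
        ((fderiv ℂ (fderiv ℂ f) z).restrictScalars ℝ)) z :=
    (ContinuousLinearMap.restrictScalarsL ℂ E F ℝ ℝ).hasFDerivAt.comp z
      (h2.hasFDerivAt.restrictScalars ℝ)
  rw [hev.fderiv_eq, h3.fderiv]
  simp [smul_smul]

lemma leviForm_comp_holomorphic {u : F → ℝ} {f : E → F} {z : E} (hf : ContDiffAt ℂ 2 f z)
    (hu : ContDiffAt ℝ 2 u (f z)) (v : E) :
    leviForm (fun x => u (f x)) z v = leviForm u (f z) (fderiv ℂ f z v) := by
  have h := fun w => fderiv_fderiv_comp hu (hf.restrict_scalars ℝ) w w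
  have hd : fderiv ℝ f z = (fderiv ℂ f z).restrictScalars ℝ :=
    ((hf.differentiableAt (by norm_num)).hasFDerivAt.restrictScalars ℝ).fderiv
  unfold leviForm
  change (fderiv ℝ (fderiv ℝ (u ∘ f)) z v v + fderiv ℝ (fderiv ℝ (u ∘ f)) z _ _) / 4 = _
  rw [h, h, fderiv_fderiv_I_smul hf, hd]
  simp only [ContinuousLinearMap.coe_restrictScalars', map_smul, map_neg]
  ring

lemma dbarSq_comp_holomorphic {u : F → ℝ} {f : E → F} {z : E} (hf : DifferentiableAt ℂ f z)
    (hu : DifferentiableAt ℝ u (f z)) (v : E) :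
    dbarSq (fun x => u (f x)) z v = dbarSq u (f z) (fderiv ℂ f z v) := by
  have hd : fderiv ℝ f z = (fderiv ℂ f z).restrictScalars ℝ :=
    (hf.hasFDerivAt.restrictScalars ℝ).fderiv
  have : fderiv ℝ (fun x => u (f x)) z = (fderiv ℝ u (f z)).comp (fderiv ℝ f z) :=
    fderiv_comp z hu (hf.restrictScalars ℝ)
  unfold dbarSq
  rw [this, hd]
  simp

end LeviForm

section MetricMatrix

variable {ι : Type*} [Fintype ι] [DecidableEq ι]

/-- The matrix `(∂²u/∂z_i ∂z̄_j)` in terms of the second real derivative `B` of `u`. -/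
lemma metricMatrix_apply {u : (ι → ℂ) → ℝ} {z : ι → ℂ} (hu : ContDiffAt ℝ 2 u z) (i j : ι) :
    metricMatrix u z i j =
      ((fderiv ℝ (fderiv ℝ u) z (Pi.single i 1) (Pi.single j 1) : ℂ) +
        fderiv ℝ (fderiv ℝ u) z (Pi.single i Complex.I) (Pi.single j Complex.I) +
        Complex.I * (fderiv ℝ (fderiv ℝ u) z (Pi.single i 1) (Pi.single j Complex.I) -
          fderiv ℝ (fderiv ℝ u) z (Pi.single i Complex.I) (Pi.single j 1))) / 4 := by
  have hev : (wirtingerBar j fun x => (u x : ℂ)) =ᶠ[𝓝 z] fun x =>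
      ((fderiv ℝ u x (Pi.single j 1) : ℂ) + Complex.I * fderiv ℝ u x (Pi.single j Complex.I)) / 2 := by
    filter_upwards [hu.eventually (by simp)] with x hx
    have h : HasFDerivAt (fun x => (u x : ℂ)) (Complex.ofRealCLM.comp (fderiv ℝ u x)) x :=
      Complex.ofRealCLM.hasFDerivAt.comp x (hx.differentiableAt (by norm_num)).hasFDerivAt
    simp only [wirtingerBar, h.fderiv]
    simp
  have h2 := hu.differentiableAt_fderiv_two.hasFDerivAt
  have h3 : ∀ w : ι → ℂ, HasFDerivAt (fun x => (fderiv ℝ u x w : ℂ))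
      (Complex.ofRealCLM.comp ((fderiv ℝ (fderiv ℝ u) z).flip w)) z := fun w => by
    refine Complex.ofRealCLM.hasFDerivAt.comp z ?_
    simpa using h2.clm_apply (hasFDerivAt_const w z)
  have h4 := ((h3 (Pi.single j 1)).add ((h3 (Pi.single j Complex.I)).const_mul Complex.I)).mul_const
    ((2 : ℂ)⁻¹)
  have h5 : fderiv ℝ (wirtingerBar j fun x => (u x : ℂ)) z = _ :=
    hev.fderiv_eq.trans (HasFDerivAt.fderiv (h4.congr_of_eventuallyEq
      (.of_forall fun x => by simp [div_eq_mul_inv])))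
  simp only [metricMatrix, Matrix.of_apply, wirtinger, h5]
  simp
  ring_nf
  simp
  ring

lemma sum_mul_metricMatrix_mul_conj {u : (ι → ℂ) → ℝ} {z : ι → ℂ} (hu : ContDiffAt ℝ 2 u z)
    (v : ι → ℂ) :
    ∑ i, ∑ j, v i * metricMatrix u z i j * conj (v j) = (leviForm u z v : ℂ) := by
  set B := fderiv ℝ (fderiv ℝ u) z with hB
  -- the sesquilinear form with the matrix `metricMatrix u z`
  let H : (ι → ℂ) →ₗ[ℂ] (ι → ℂ) →ₛₗ[starRingEnd ℂ] ℂ := LinearMap.mk₂'ₛₗ (RingHom.id ℂ)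
    (starRingEnd ℂ) (fun x y => ((B x y : ℂ) + B (Complex.I • x) (Complex.I • y) +
      Complex.I * (B x (Complex.I • y) - B (Complex.I • x) y)) / 4)
    (fun x x' y => by simp only [map_add, smul_add, add_apply]; push_cast; ring)
    (fun c x y => by
      have hc : c • x = c.re • x + c.im • (Complex.I • x) := by
        conv_lhs => rw [← Complex.re_add_im c]
        rw [add_smul, mul_smul]; simp
      have hc' : Complex.I • c • x = c.re • (Complex.I • x) - c.im • x := by
        rw [hc, smul_add, smul_comm _ c.re, smul_comm _ c.im, smul_smul Complex.I]
        simp [sub_eq_add_neg]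
      rw [hc', hc]
      simp only [map_add, map_sub, map_smul, add_apply, sub_apply, smul_apply, smul_eq_mul,
        RingHom.id_apply]
      conv_rhs => rw [← Complex.re_add_im c]
      push_cast
      linear_combination (-(c.im : ℂ) * (B x (Complex.I • y) - B (Complex.I • x) y) / 4) *
        Complex.I_sq)
    (fun x y y' => by simp only [map_add, smul_add]; push_cast; ring)
    (fun c x y => by
      have hc : c • y = c.re • y + c.im • (Complex.I • y) := by
        conv_lhs => rw [← Complex.re_add_im c]
        rw [add_smul, mul_smul]; simp
      have hc' : Complex.I • c • y = c.re • (Complex.I • y) - c.im • y := by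
        rw [hc, smul_add, smul_comm _ c.re, smul_comm _ c.im, smul_smul Complex.I]
        simp [sub_eq_add_neg]
      have hcc : (starRingEnd ℂ) c = c.re - c.im * Complex.I := by
        apply Complex.ext <;> simp
      rw [hc', hc, hcc]
      simp only [map_add, map_sub, map_smul, smul_eq_mul]
      push_cast
      linear_combination ((c.im : ℂ) * (B x (Complex.I • y) - B (Complex.I • x) y) / 4) *
        Complex.I_sq)
  have hsingle : ∀ k : ι, Complex.I • (Pi.single k 1 : ι → ℂ) = Pi.single k Complex.I := fun k => by
    rw [← Pi.single_smul']; simp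
  have hT : ∀ i j, metricMatrix u z i j = H (Pi.single i 1) (Pi.single j 1) := fun i j => by
    rw [metricMatrix_apply hu]
    simp only [H, LinearMap.mk₂'ₛₗ_apply, hsingle, hB]
  have hv : v = ∑ i, v i • (Pi.single i 1 : ι → ℂ) := by
    simpa using pi_eq_sum_univ' v
  have hsum : ∑ i, ∑ j, v i * metricMatrix u z i j * conj (v j) = H v v := by
    conv_rhs => rw [hv]
    simp only [map_sum, LinearMap.sum_apply, map_smul, LinearMap.smul_apply,
      LinearMap.map_smulₛₗ, hT, smul_eq_mul, Finset.mul_sum]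
    rw [Finset.sum_comm]
    refine Finset.sum_congr rfl fun i _ => Finset.sum_congr rfl fun j _ => ?_
    ring
  have hsymm : IsSymmSndFDerivAt ℝ u z := hu.isSymmSndFDerivAt (by simp)
  rw [hsum]
  simp only [H, LinearMap.mk₂'ₛₗ_apply, leviForm]
  rw [hB, hsymm (Complex.I • v) v]
  push_cast
  ring

lemma metricLength_eq_sqrt {u : (ι → ℂ) → ℝ} {z : ι → ℂ} (hu : ContDiffAt ℝ 2 u z)
    (v : ι → ℂ) : metricLength u z v = Real.sqrt (leviForm u z v) := by
  rw [metricLength, sum_mul_metricMatrix_mul_conj hu, Complex.ofReal_re]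

lemma metricMatrix_isHermitian {u : (ι → ℂ) → ℝ} {z : ι → ℂ} (hu : ContDiffAt ℝ 2 u z) :
    (metricMatrix u z).IsHermitian := by
  have hsymm : IsSymmSndFDerivAt ℝ u z := hu.isSymmSndFDerivAt (by simp)
  ext i j
  rw [Matrix.conjTranspose_apply, metricMatrix_apply hu, metricMatrix_apply hu,
    hsymm (Pi.single i 1) (Pi.single j 1), hsymm (Pi.single i Complex.I) (Pi.single j Complex.I),
    hsymm (Pi.single i 1) (Pi.single j Complex.I), hsymm (Pi.single i Complex.I) (Pi.single j 1)]
  simp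
  ring

lemma metricMatrix_posDef_of_leviForm_pos {u : (ι → ℂ) → ℝ} {z : ι → ℂ}
    (hu : ContDiffAt ℝ 2 u z) (h : ∀ v, v ≠ 0 → 0 < leviForm u z v) :
    (metricMatrix u z).PosDef := by
  refine Matrix.PosDef.of_dotProduct_mulVec_pos (metricMatrix_isHermitian hu) fun x hx => ?_
  have hx' : star x ≠ 0 := star_ne_zero.2 hx
  have key := sum_mul_metricMatrix_mul_conj hu (star x)
  have : star x ⬝ᵥ (metricMatrix u z).mulVec x = (leviForm u z (star x) : ℂ) := by
    rw [← key]
    simp [dotProduct, Matrix.mulVec, Finset.mul_sum, mul_assoc]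
  rw [this]
  exact_mod_cast h _ hx'

end MetricMatrix

section LogNorm

variable {E H : Type*} [NormedAddCommGroup E] [NormedSpace ℂ E] [NormedSpace ℝ E]
  [IsScalarTower ℝ ℂ E] [NormedAddCommGroup H] [InnerProductSpace ℂ H]

lemma contDiff_norm_sq_complex {n : ℕ∞ω} : ContDiff ℝ n fun x : H => ‖x‖ ^ 2 :=
  let _ := InnerProductSpace.rclikeToReal ℂ H
  contDiff_norm_sq ℝ

lemma fderiv_norm_sq_complex (x y : H) :
    fderiv ℝ (fun x : H => ‖x‖ ^ 2) x y = 2 * (inner ℂ x y).re := by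
  let _ := InnerProductSpace.rclikeToReal ℂ H
  have := (hasStrictFDerivAt_norm_sq (F := H) x).hasFDerivAt.fderiv
  rw [this]
  simp [real_inner_eq_re_inner ℂ]

lemma fderiv_fderiv_norm_sq_complex (x y w : H) :
    fderiv ℝ (fderiv ℝ fun x : H => ‖x‖ ^ 2) x y w = 2 * (inner ℂ y w).re := by
  let _ := InnerProductSpace.rclikeToReal ℂ H
  have : fderiv ℝ (fun x : H => ‖x‖ ^ 2) = fun x => (2 : ℝ) • innerSL ℝ x := by
    ext1 x
    rw [(hasStrictFDerivAt_norm_sq (F := H) x).hasFDerivAt.fderiv]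
    exact (ofNat_smul_eq_nsmul ℝ 2 _).symm
  rw [this, fderiv_fun_const_smul (innerSL ℝ).differentiableAt, (innerSL ℝ).fderiv]
  rfl

variable [CompleteSpace H]

lemma contDiff_norm_sq_dual {n : ℕ∞ω} : ContDiff ℝ n fun φ : StrongDual ℂ H => ‖φ‖ ^ 2 := by
  set σ := (InnerProductSpace.toDual ℂ H).symm with hσ
  let σ' : StrongDual ℂ H →L[ℝ] H :=
    { toFun := σ, map_add' := map_add σ, map_smul' := fun c x => by
        change σ ((c : ℂ) • x) = (c : ℂ) • σ x
        rw [LinearIsometryEquiv.map_smulₛₗ]; simp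
      cont := σ.continuous }
  have : (fun φ : StrongDual ℂ H => ‖φ‖ ^ 2) = fun φ => ‖σ' φ‖ ^ 2 := by
    ext1 φ; change _ = ‖σ φ‖ ^ 2; rw [LinearIsometryEquiv.norm_map]
  rw [this]
  exact contDiff_norm_sq_complex.comp σ'.contDiff

/-- For a holomorphic map `e` into the dual of a Hilbert space, `‖e‖²` has Levi form `‖de(v)‖²`,
and `‖e‖² · leviForm (log ‖e‖²)` is the squared distance of `de(v)` to the line through `e`. -/
lemma leviForm_log_norm_sq {e : E → StrongDual ℂ H} {z : E} (he : ContDiffAt ℂ 2 e z)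
    (hne : e z ≠ 0) (v : E) :
    (∀ c : ℂ, leviForm (fun x => Real.log (‖e x‖ ^ 2)) z v * ‖e z‖ ^ 2 ≤
      ‖fderiv ℂ e z v - c • e z‖ ^ 2) ∧
    ∃ c : ℂ, leviForm (fun x => Real.log (‖e x‖ ^ 2)) z v * ‖e z‖ ^ 2 =
      ‖fderiv ℂ e z v - c • e z‖ ^ 2 := by
  -- The Riesz representation turns `e` into an antiholomorphic map `ψ` into `H`, whose second
  -- derivative drops out of the Levi form of `‖ψ‖²`.
  set σ := (InnerProductSpace.toDual ℂ H).symm with hσ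
  let σ' : StrongDual ℂ H →L[ℝ] H :=
    { toFun := σ, map_add' := map_add σ, map_smul' := fun c x => by
        change σ ((c : ℂ) • x) = (c : ℂ) • σ x
        rw [LinearIsometryEquiv.map_smulₛₗ]; simp
      cont := σ.continuous }
  set ψ : E → H := fun x => σ' (e x) with hψ
  have heR : ContDiffAt ℝ 2 e z := he.restrict_scalars ℝ
  have hψc : ContDiffAt ℝ 2 ψ z := σ'.contDiff.contDiffAt.comp z heR
  have hnorm : ∀ x, ‖e x‖ ^ 2 = ‖ψ x‖ ^ 2 := fun x => by
    rw [hψ]; change _ = ‖σ (e x)‖ ^ 2; rw [LinearIsometryEquiv.norm_map]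
  have hd : fderiv ℝ e z = (fderiv ℂ e z).restrictScalars ℝ :=
    ((he.differentiableAt (by norm_num)).hasFDerivAt.restrictScalars ℝ).fderiv
  have hψd : ∀ w, fderiv ℝ ψ z w = σ (fderiv ℂ e z w) := fun w => by
    have : fderiv ℝ ψ z = σ'.comp (fderiv ℝ e z) :=
      (σ'.hasFDerivAt.comp z (heR.differentiableAt (by norm_num)).hasFDerivAt).fderiv
    rw [this, hd]; rfl
  have hψI : fderiv ℝ ψ z (Complex.I • v) = -(Complex.I • fderiv ℝ ψ z v) := by
    rw [hψd, hψd, map_smul, LinearIsometryEquiv.map_smulₛₗ]; simp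
  have hψ2 : fderiv ℝ (fderiv ℝ ψ) z (Complex.I • v) (Complex.I • v) =
      -fderiv ℝ (fderiv ℝ ψ) z v v := by
    have h := fun w => fderiv_fderiv_comp (σ'.contDiff.contDiffAt (n := 2) (x := e z)) heR w w
    change fderiv ℝ (fderiv ℝ (σ' ∘ e)) z _ _ = -fderiv ℝ (fderiv ℝ (σ' ∘ e)) z _ _
    rw [h, h, fderiv_fderiv_clm, fderiv_fderiv_I_smul he]
    simp
  set u : E → ℝ := fun x => ‖ψ x‖ ^ 2 with hu
  have hq : ContDiffAt ℝ 2 (fun x : H => ‖x‖ ^ 2) (ψ z) :=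
    contDiff_norm_sq_complex.contDiffAt
  have huc : ContDiffAt ℝ 2 u z := hq.comp z hψc
  have hu1 : ∀ w, fderiv ℝ u z w = 2 * (inner ℂ (ψ z) (fderiv ℝ ψ z w)).re := fun w => by
    have : fderiv ℝ u z = (fderiv ℝ (fun x : H => ‖x‖ ^ 2) (ψ z)).comp (fderiv ℝ ψ z) :=
      fderiv_comp z (hq.differentiableAt (by norm_num)) (hψc.differentiableAt (by norm_num))
    rw [this, ContinuousLinearMap.comp_apply, fderiv_norm_sq_complex]
  set x := ψ z with hx
  set y := fderiv ℝ ψ z v with hy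
  have hlevi : leviForm u z v = ‖y‖ ^ 2 := by
    have h := fun w => fderiv_fderiv_comp (f := ψ) hq hψc w w
    unfold leviForm
    change (fderiv ℝ (fderiv ℝ ((fun x : H => ‖x‖ ^ 2) ∘ ψ)) z v v +
      fderiv ℝ (fderiv ℝ ((fun x : H => ‖x‖ ^ 2) ∘ ψ)) z _ _) / 4 = _
    rw [h, h, hψ2, hψI, fderiv_fderiv_norm_sq_complex, fderiv_fderiv_norm_sq_complex, map_neg]
    have h1 : (inner ℂ y y).re = ‖y‖ ^ 2 := by
      rw [inner_self_eq_norm_sq_to_K]; norm_cast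
    have h2 : inner ℂ (-(Complex.I • y)) (-(Complex.I • y)) = inner ℂ y y := by
      rw [inner_neg_neg, inner_smul_left, inner_smul_right, ← mul_assoc]; simp
    rw [h2, h1]
    ring
  have hdbar : dbarSq u z v = ‖inner ℂ x y‖ ^ 2 := by
    unfold dbarSq
    rw [hu1, hu1, hψI, inner_neg_right, inner_smul_right, ← Complex.normSq_eq_norm_sq,
      Complex.normSq_apply]
    simp
    ring
  have hx0 : x ≠ 0 := by
    rw [hx, hψ]; change σ (e z) ≠ 0
    simpa using hne
  have hxn : ‖x‖ ^ 2 ≠ 0 := by simpa using hx0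
  have hL : leviForm (fun x => Real.log (‖e x‖ ^ 2)) z v * ‖e z‖ ^ 2 =
      ‖y‖ ^ 2 - ‖inner ℂ x y‖ ^ 2 / ‖x‖ ^ 2 := by
    simp only [hnorm]
    rw [show (fun x => Real.log (‖ψ x‖ ^ 2)) = fun x => Real.log (u x) from rfl,
      leviForm_log huc hxn, hlevi, hdbar]
    change (_ / ‖x‖ ^ 2 - _ / (‖x‖ ^ 2) ^ 2) * ‖x‖ ^ 2 = _
    field_simp
  have hdist : ∀ c : ℂ, ‖fderiv ℂ e z v - c • e z‖ ^ 2 = ‖y - conj c • x‖ ^ 2 := fun c => by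
    rw [← LinearIsometryEquiv.norm_map σ, map_sub, LinearIsometryEquiv.map_smulₛₗ, hy, hψd]
    rfl
  -- completing the square
  have hsq : ∀ c : ℂ, ‖y - c • x‖ ^ 2 =
      ‖y‖ ^ 2 - ‖inner ℂ x y‖ ^ 2 / ‖x‖ ^ 2 + ‖x‖ ^ 2 * ‖c - inner ℂ x y / (‖x‖ ^ 2 : ℝ)‖ ^ 2 := by
    intro c
    rw [@norm_sub_sq ℂ, inner_smul_right, norm_smul, mul_pow]
    rw [← inner_conj_symm y x]
    set a := inner ℂ x y
    simp only [← Complex.normSq_eq_norm_sq, Complex.normSq_apply, RCLike.re_eq_complex_re]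
    simp [Complex.div_ofReal_re, Complex.div_ofReal_im, -Complex.ofReal_pow]
    field_simp
    ring
  refine ⟨fun c => ?_, conj (inner ℂ x y / (‖x‖ ^ 2 : ℝ)), ?_⟩
  · rw [hL, hdist, hsq]
    have : 0 ≤ ‖x‖ ^ 2 * ‖conj c - inner ℂ x y / (‖x‖ ^ 2 : ℝ)‖ ^ 2 := by positivity
    linarith
  · rw [hL, hdist, hsq, Complex.conj_conj]; simp

/-- The logarithm of the modulus of a holomorphic function is pluriharmonic. -/
lemma leviForm_log_norm_sq_eq_zero {g : E → ℂ} {z : E} (hg : ContDiffAt ℂ 2 g z) (h0 : g z ≠ 0)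
    (v : E) : leviForm (fun x => Real.log (‖g x‖ ^ 2)) z v = 0 := by
  let T : ℂ →L[ℂ] StrongDual ℂ ℂ := ContinuousLinearMap.mul ℂ ℂ
  have hT : ∀ a, ‖T a‖ = ‖a‖ := fun a => by simp [T]
  have hTg : ContDiffAt ℂ 2 (fun x => T (g x)) z := T.contDiff.contDiffAt.comp z hg
  have hT0 : T (g z) ≠ 0 := by rw [← norm_ne_zero_iff, hT]; simpa using h0
  have hd : fderiv ℂ (fun x => T (g x)) z v = T (fderiv ℂ g z v) := by
    have : fderiv ℂ (fun x => T (g x)) z = T.comp (fderiv ℂ g z) :=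
      (T.hasFDerivAt.comp z (hg.differentiableAt (by norm_num)).hasFDerivAt).fderiv
    rw [this]; rfl
  obtain ⟨h1, c, h2⟩ := leviForm_log_norm_sq hTg hT0 v
  have h3 := h1 (fderiv ℂ g z v / g z)
  rw [hd, ← map_smul, smul_eq_mul, div_mul_cancel₀ _ h0, sub_self] at h3
  simp only [hT] at h2 h3
  have h4 : 0 < ‖g z‖ ^ 2 := by positivity
  have h5 : 0 ≤ leviForm (fun x => Real.log (‖g x‖ ^ 2)) z v * ‖g z‖ ^ 2 := by
    rw [h2]; positivity
  rw [norm_zero] at h3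
  nlinarith

end LogNorm


/-! ### The Bergman space and its evaluation functionals -/

section BergmanSpace

open MeasureTheory Set Filter

variable {ι : Type*} [Fintype ι]

/-- The subspace of `L²(D)` of the classes with a holomorphic representative. -/
def bergmanSubmodule (D : Set (ι → ℂ)) : Submodule ℂ (Lp ℂ 2 (volume.restrict D)) where
  carrier := {f | ∃ g : (ι → ℂ) → ℂ, DifferentiableOn ℂ g D ∧ f =ᵐ[volume.restrict D] g}
  zero_mem' := ⟨0, differentiableOn_const _, Lp.coeFn_zero _ _ _⟩
  add_mem' := by
    rintro f f' ⟨g, hg, hfg⟩ ⟨g', hg', hfg'⟩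
    exact ⟨g + g', hg.add hg', (Lp.coeFn_add f f').trans (hfg.add hfg')⟩
  smul_mem' := by
    rintro c f ⟨g, hg, hfg⟩
    exact ⟨c • g, hg.const_smul c, (Lp.coeFn_smul c f).trans (hfg.const_smul c)⟩

/-- The Bergman space `A²(D)`, as a space of classes of functions. -/
def BergmanSpace (D : Set (ι → ℂ)) : Type _ := bergmanSubmodule D

noncomputable instance (D : Set (ι → ℂ)) : NormedAddCommGroup (BergmanSpace D) :=
  (bergmanSubmodule D).normedAddCommGroup

noncomputable instance (D : Set (ι → ℂ)) : InnerProductSpace ℂ (BergmanSpace D) :=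
  (bergmanSubmodule D).innerProductSpace

noncomputable instance (D : Set (ι → ℂ)) : Inner ℂ (BergmanSpace D) :=
  InnerProductSpace.toInner

/-- The underlying class in `L²(D)`. -/
def BergmanSpace.toL2 {D : Set (ι → ℂ)} (f : BergmanSpace D) : Lp ℂ 2 (volume.restrict D) :=
  Subtype.val f

/-- The holomorphic representative of an element of the Bergman space; it is unique on an open
set `D`. -/
noncomputable def holoRep {D : Set (ι → ℂ)} (f : BergmanSpace D) : (ι → ℂ) → ℂ :=
  (Subtype.property f).choose

variable {D : Set (ι → ℂ)}

lemma differentiableOn_holoRep (f : BergmanSpace D) : DifferentiableOn ℂ (holoRep f) D :=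
  (Subtype.property f).choose_spec.1

lemma coeFn_ae_eq_holoRep (f : BergmanSpace D) :
    f.toL2 =ᵐ[volume.restrict D] holoRep f :=
  (Subtype.property f).choose_spec.2

lemma eqOn_holoRep (hD : IsOpen D) {f : BergmanSpace D} {g : (ι → ℂ) → ℂ}
    (hg : DifferentiableOn ℂ g D)
    (h : f.toL2 =ᵐ[volume.restrict D] g) : EqOn (holoRep f) g D :=
  Measure.eqOn_open_of_ae_eq ((coeFn_ae_eq_holoRep f).symm.trans h) hD
    (differentiableOn_holoRep f).continuousOn hg.continuousOn

lemma holoRep_add (hD : IsOpen D) (f g : BergmanSpace D) :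
    EqOn (holoRep (f + g)) (holoRep f + holoRep g) D :=
  eqOn_holoRep hD ((differentiableOn_holoRep f).add (differentiableOn_holoRep g))
    ((Lp.coeFn_add _ _).trans ((coeFn_ae_eq_holoRep f).add (coeFn_ae_eq_holoRep g)))

lemma holoRep_smul (hD : IsOpen D) (c : ℂ) (f : BergmanSpace D) :
    EqOn (holoRep (c • f)) (c • holoRep f) D :=
  eqOn_holoRep hD ((differentiableOn_holoRep f).const_smul c)
    ((Lp.coeFn_smul _ _).trans ((coeFn_ae_eq_holoRep f).const_smul c))

lemma memBergmanSpace_holoRep (f : BergmanSpace D) : MemBergmanSpace (holoRep f) D :=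
  ⟨differentiableOn_holoRep f, (Lp.memLp f.toL2).ae_eq
    (coeFn_ae_eq_holoRep f)⟩

lemma toReal_eLpNorm_holoRep (f : BergmanSpace D) :
    (eLpNorm (holoRep f) 2 (volume.restrict D)).toReal = ‖f‖ := by
  rw [← eLpNorm_congr_ae (coeFn_ae_eq_holoRep f)]; rfl

/-- The class of a square integrable holomorphic function. -/
noncomputable def MemBergmanSpace.toSpace {g : (ι → ℂ) → ℂ} (hg : MemBergmanSpace g D) :
    BergmanSpace D :=
  ⟨hg.2.toLp g, g, hg.1, hg.2.coeFn_toLp⟩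

lemma holoRep_toSpace (hD : IsOpen D) {g : (ι → ℂ) → ℂ} (hg : MemBergmanSpace g D) :
    EqOn (holoRep hg.toSpace) g D :=
  eqOn_holoRep hD hg.1 hg.2.coeFn_toLp

lemma norm_toSpace {g : (ι → ℂ) → ℂ} (hg : MemBergmanSpace g D) :
    ‖hg.toSpace‖ = (eLpNorm g 2 (volume.restrict D)).toReal :=
  Lp.norm_toLp g hg.2

lemma exists_forall_norm_holoRep_le (hD : IsOpen D) {z : ι → ℂ} (hz : z ∈ D) :
    ∃ r > 0, Metric.ball z r ⊆ D ∧ ∃ C, 0 ≤ C ∧ ∀ f : BergmanSpace D, ∀ x ∈ Metric.ball z r,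
      ‖holoRep f x‖ ≤ C * ‖f‖ := by
  obtain ⟨ε, hε, hsub⟩ := Metric.isOpen_iff.1 hD z hz
  obtain ⟨C, hC, h⟩ := exists_forall_norm_le_eLpNorm hD (z := z) (r := ε / 4) (by positivity)
    ((Metric.closedBall_subset_ball (by linarith)).trans hsub)
  refine ⟨ε / 4, by positivity, (Metric.ball_subset_ball (by linarith)).trans hsub, C, hC,
    fun f x hx => ?_⟩
  rw [← toReal_eLpNorm_holoRep]
  exact h _ (differentiableOn_holoRep f) (memBergmanSpace_holoRep f).2 x
    (Metric.ball_subset_closedBall hx)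

lemma exists_evaluation (hD : IsOpen D) {z : ι → ℂ} (hz : z ∈ D) :
    ∃ L : StrongDual ℂ (BergmanSpace D), ∀ f, L f = holoRep f z := by
  obtain ⟨r, hr, -, C, -, hC⟩ := exists_forall_norm_holoRep_le hD hz
  exact ⟨LinearMap.mkContinuous
    { toFun := fun f => holoRep f z
      map_add' := fun f g => holoRep_add hD f g hz
      map_smul' := fun c f => holoRep_smul hD c f hz } C
    fun f => hC f z (Metric.mem_ball_self hr), fun f => rfl⟩

open Classical in
/-- The evaluation functional `f ↦ f z` on the Bergman space of an open set `D` at `z ∈ D`. -/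
noncomputable def bergmanEval (D : Set (ι → ℂ)) (z : ι → ℂ) : StrongDual ℂ (BergmanSpace D) :=
  if h : ∃ L : StrongDual ℂ (BergmanSpace D), ∀ f, L f = holoRep f z then h.choose else 0

lemma bergmanEval_apply (hD : IsOpen D) {z : ι → ℂ} (hz : z ∈ D) (f : BergmanSpace D) :
    bergmanEval D z f = holoRep f z := by
  have h := exists_evaluation hD hz
  rw [bergmanEval, dif_pos h]
  exact h.choose_spec f

lemma fderiv_holoRep_add (hD : IsOpen D) {z : ι → ℂ} (hz : z ∈ D) (f g : BergmanSpace D) :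
    fderiv ℂ (holoRep (f + g)) z = fderiv ℂ (holoRep f) z + fderiv ℂ (holoRep g) z := by
  rw [((holoRep_add hD f g).eventuallyEq_of_mem (hD.mem_nhds hz)).fderiv_eq]
  exact fderiv_add ((differentiableOn_holoRep f).differentiableAt (hD.mem_nhds hz))
    ((differentiableOn_holoRep g).differentiableAt (hD.mem_nhds hz))

lemma fderiv_holoRep_smul (hD : IsOpen D) {z : ι → ℂ} (hz : z ∈ D) (c : ℂ)
    (f : BergmanSpace D) : fderiv ℂ (holoRep (c • f)) z = c • fderiv ℂ (holoRep f) z := by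
  rw [((holoRep_smul hD c f).eventuallyEq_of_mem (hD.mem_nhds hz)).fderiv_eq]
  exact fderiv_const_smul ((differentiableOn_holoRep f).differentiableAt (hD.mem_nhds hz)) c

/-- The evaluation functionals depend holomorphically on the point, in the norm of the dual. -/
lemma exists_hasFDerivAt_bergmanEval (hD : IsOpen D) {z : ι → ℂ} (hz : z ∈ D) :
    ∃ L : (ι → ℂ) →L[ℂ] StrongDual ℂ (BergmanSpace D), HasFDerivAt (bergmanEval D) L z ∧
      ∀ v f, L v f = fderiv ℂ (holoRep f) z v := by
  obtain ⟨r, hr, hsub, C, hC0, hC⟩ := exists_forall_norm_holoRep_le hD hz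
  have hd : ∀ f : BergmanSpace D, DifferentiableOn ℂ (holoRep f) (Metric.ball z r) := fun f =>
    (differentiableOn_holoRep f).mono hsub
  let L₀ : (ι → ℂ) →ₗ[ℂ] BergmanSpace D →ₗ[ℂ] ℂ := LinearMap.mk₂ ℂ
    (fun v f => fderiv ℂ (holoRep f) z v) (fun v w f => (fderiv ℂ (holoRep f) z).map_add v w)
    (fun c v f => (fderiv ℂ (holoRep f) z).map_smul c v) (fun v f g => by rw [fderiv_holoRep_add hD hz]; rfl)
    (fun c v f => by rw [fderiv_holoRep_smul hD hz]; rfl)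
  let L : (ι → ℂ) →L[ℂ] StrongDual ℂ (BergmanSpace D) := L₀.mkContinuous₂ (2 * C / r)
    fun v f => by
      have h := norm_fderiv_le_of_norm_le hr (hd f) (hC f)
      calc ‖fderiv ℂ (holoRep f) z v‖ ≤ 2 * (C * ‖f‖) / r * ‖v‖ :=
            ((fderiv ℂ (holoRep f) z).le_opNorm v).trans (by gcongr)
        _ = 2 * C / r * ‖v‖ * ‖f‖ := by ring
  refine ⟨L, ?_, fun v f => rfl⟩
  refine HasFDerivAt.of_isLittleO ?_
  -- the second order Cauchy estimate, uniformly on the unit ball of the Bergman space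
  have hO : (fun x => bergmanEval D x - bergmanEval D z - L (x - z)) =O[𝓝 z]
      fun x => ‖x - z‖ ^ 2 := by
    refine Asymptotics.IsBigO.of_bound (4 * C / r ^ 2) ?_
    filter_upwards [Metric.ball_mem_nhds z hr] with x hx
    refine ContinuousLinearMap.opNorm_le_bound _ (by positivity) fun f => ?_
    have h := norm_sub_sub_fderiv_le hr (hd f) (hC f) hx
    have he : (bergmanEval D x - bergmanEval D z - L (x - z)) f =
        holoRep f x - holoRep f z - fderiv ℂ (holoRep f) z (x - z) := by
      rw [← bergmanEval_apply hD (hsub hx), ← bergmanEval_apply hD hz]; rfl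
    rw [he]
    refine h.trans (le_of_eq ?_)
    rw [norm_pow, norm_norm]
    ring
  refine hO.trans_isLittleO ?_
  have h1 : (fun x : ι → ℂ => ‖x - z‖) =o[𝓝 z] fun _ => (1 : ℝ) := by
    rw [Asymptotics.isLittleO_one_iff]
    have : ContinuousAt (fun x : ι → ℂ => ‖x - z‖) z := by fun_prop
    simpa [ContinuousAt] using this
  have h2 := h1.mul_isBigO (Asymptotics.isBigO_refl (fun x : ι → ℂ => ‖x - z‖) (𝓝 z))
  simp only [one_mul] at h2
  refine Asymptotics.IsLittleO.of_norm_right ?_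
  simpa [pow_two] using h2

lemma differentiableOn_bergmanEval (hD : IsOpen D) : DifferentiableOn ℂ (bergmanEval D) D :=
  fun _ hz => (exists_hasFDerivAt_bergmanEval hD hz).choose_spec.1.differentiableAt
    |>.differentiableWithinAt

lemma fderiv_bergmanEval_apply (hD : IsOpen D) {z : ι → ℂ} (hz : z ∈ D) (v : ι → ℂ)
    (f : BergmanSpace D) :
    fderiv ℂ (bergmanEval D) z v f = fderiv ℂ (holoRep f) z v := by
  obtain ⟨L, hL, h⟩ := exists_hasFDerivAt_bergmanEval hD hz
  rw [hL.fderiv, h]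

lemma contDiffAt_bergmanEval (hD : IsOpen D) {z : ι → ℂ} (hz : z ∈ D) :
    ContDiffAt ℂ ∞ (bergmanEval D) z :=
  (contDiffOn_complex hD (differentiableOn_bergmanEval hD)).contDiffAt (hD.mem_nhds hz)

/-- The Bergman space is closed in `L²`. The limit of a Cauchy sequence `f_n` is holomorphic, since
it is `z ↦ Φ (ev z)` for the limit `Φ` of the `f_n` in the bidual and the holomorphic map `ev` of
evaluation functionals. -/
lemma isClosed_bergmanSubmodule (hD : IsOpen D) :
    IsClosed (bergmanSubmodule D : Set (Lp ℂ 2 (volume.restrict D))) := by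
  refine isClosed_of_closure_subset fun f hf => ?_
  obtain ⟨s, hs, hlim⟩ := mem_closure_iff_seq_limit.1 hf
  let s' : ℕ → BergmanSpace D := fun n => ⟨s n, hs n⟩
  have hcauchy : CauchySeq s' := by
    have := hlim.cauchySeq
    rw [Metric.cauchySeq_iff] at this ⊢
    exact this
  set J := NormedSpace.inclusionInDoubleDualLi ℂ (E := BergmanSpace D)
  obtain ⟨Φ, hΦ⟩ := cauchySeq_tendsto_of_complete (J.isometry.uniformContinuous.comp_cauchySeq hcauchy)
  have hpt : ∀ z ∈ D, Tendsto (fun n => holoRep (s' n) z) atTop (𝓝 (Φ (bergmanEval D z))) := by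
    intro z hz
    have h1 : Tendsto (fun n => J (s' n) (bergmanEval D z)) atTop (𝓝 (Φ (bergmanEval D z))) :=
      ((continuous_eval_const (bergmanEval D z)).tendsto Φ).comp hΦ
    refine h1.congr fun n => ?_
    rw [← bergmanEval_apply hD hz]; rfl
  refine ⟨fun z => Φ (bergmanEval D z),
    Φ.differentiable.comp_differentiableOn (differentiableOn_bergmanEval hD), ?_⟩
  obtain ⟨ns, hmono, hae⟩ := (tendstoInMeasure_of_tendsto_Lp hlim).exists_seq_tendsto_ae
  have hrep : ∀ᵐ x ∂volume.restrict D, ∀ n, s n x = holoRep (s' n) x :=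
    ae_all_iff.2 fun n => coeFn_ae_eq_holoRep (s' n)
  filter_upwards [hae, hrep, ae_restrict_mem hD.measurableSet] with x h1 h2 hx
  refine tendsto_nhds_unique h1 ?_
  simp only [h2]
  exact (hpt x hx).comp hmono.tendsto_atTop

lemma completeSpace_bergmanSpace (hD : IsOpen D) : CompleteSpace (BergmanSpace D) :=
  (isClosed_bergmanSubmodule hD).completeSpace_coe

/-! ### The Bergman kernel and the Bergman metric -/

lemma inner_toSpace_eq (hD : IsOpen D) {g : (ι → ℂ) → ℂ} (hg : MemBergmanSpace g D)
    (f : BergmanSpace D) :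
    inner ℂ hg.toSpace f = ∫ z in D, holoRep f z * conj (g z) := by
  change inner ℂ hg.toSpace.toL2 f.toL2 = _
  rw [L2.inner_def]
  refine integral_congr_ae ?_
  filter_upwards [coeFn_ae_eq_holoRep f, coeFn_ae_eq_holoRep hg.toSpace,
    ae_restrict_mem hD.measurableSet] with x h1 h2 hx
  rw [h1, h2, holoRep_toSpace hD hg hx]
  simp

lemma exists_isBergmanKernel (hD : IsOpen D) : ∃ k, IsBergmanKernel k D := by
  have := completeSpace_bergmanSpace hD
  refine ⟨fun z w => holoRep ((InnerProductSpace.toDual ℂ (BergmanSpace D)).symm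
    (bergmanEval D w)) z, fun w hw => ⟨memBergmanSpace_holoRep _, fun f hf => ?_⟩⟩
  set κ := (InnerProductSpace.toDual ℂ (BergmanSpace D)).symm (bergmanEval D w) with hκ
  have h1 : inner ℂ κ hf.toSpace = f w := by
    rw [hκ, InnerProductSpace.toDual_symm_apply, bergmanEval_apply hD hw, holoRep_toSpace hD hf hw]
  rw [← h1]
  change inner ℂ κ.toL2 hf.toSpace.toL2 = _
  rw [L2.inner_def]
  refine integral_congr_ae ?_
  filter_upwards [coeFn_ae_eq_holoRep κ, coeFn_ae_eq_holoRep hf.toSpace,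
    ae_restrict_mem hD.measurableSet] with x h1 h2 hx
  rw [h1, h2, holoRep_toSpace hD hf hx, RCLike.inner_apply]

lemma IsBergmanKernel.re_self_eq {k : (ι → ℂ) → (ι → ℂ) → ℂ} (hk : IsBergmanKernel k D)
    (hD : IsOpen D) {z : ι → ℂ} (hz : z ∈ D) : (k z z).re = ‖bergmanEval D z‖ ^ 2 := by
  have := completeSpace_bergmanSpace hD
  obtain ⟨hm, hrep⟩ := hk z hz
  have hdual : bergmanEval D z = InnerProductSpace.toDual ℂ (BergmanSpace D) hm.toSpace := by
    ext f
    rw [InnerProductSpace.toDual_apply_apply, inner_toSpace_eq hD hm, bergmanEval_apply hD hz]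
    exact hrep _ (memBergmanSpace_holoRep f)
  have h1 : k z z = inner ℂ hm.toSpace hm.toSpace := by
    rw [← InnerProductSpace.toDual_apply_apply (𝕜 := ℂ), ← hdual, bergmanEval_apply hD hz,
      holoRep_toSpace hD hm hz]
  rw [hdual, LinearIsometryEquiv.norm_map, h1, inner_self_eq_norm_sq_to_K]
  norm_cast

/-- The potential of the Bergman metric: `log k(z, z) = log ‖ev z‖²` for the Bergman kernel `k`. -/
noncomputable def bergmanLog (D : Set (ι → ℂ)) (z : ι → ℂ) : ℝ :=
  Real.log (‖bergmanEval D z‖ ^ 2)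

lemma IsBergmanKernel.eqOn_bergmanLog {k : (ι → ℂ) → (ι → ℂ) → ℂ} (hk : IsBergmanKernel k D)
    (hD : IsOpen D) : EqOn (bergmanPotential k) (bergmanLog D) D := fun z hz => by
  rw [bergmanPotential, hk.re_self_eq hD hz, bergmanLog]

lemma memBergmanSpace_of_bounded (hD : IsOpen D) (hb : Bornology.IsBounded D)
    {g : (ι → ℂ) → ℂ} (hg : Differentiable ℂ g) : MemBergmanSpace g D := by
  obtain ⟨C, hC⟩ := (hb.isCompact_closure.image hg.continuous).isBounded.exists_norm_le
  have : IsFiniteMeasure (volume.restrict D) := ⟨by simpa using hb.measure_lt_top⟩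
  refine ⟨hg.differentiableOn, MemLp.of_bound hg.continuous.aestronglyMeasurable C ?_⟩
  filter_upwards [ae_restrict_mem hD.measurableSet] with x hx
  exact hC _ (mem_image_of_mem g (subset_closure hx))

lemma bergmanEval_ne_zero (hD : IsOpen D) (hb : Bornology.IsBounded D) {z : ι → ℂ} (hz : z ∈ D) :
    bergmanEval D z ≠ 0 := by
  intro h
  have hm := memBergmanSpace_of_bounded hD hb (differentiable_const (1 : ℂ))
  have := bergmanEval_apply hD hz hm.toSpace
  rw [h, holoRep_toSpace hD hm hz] at this
  simp at this

lemma contDiffAt_bergmanLog (hD : IsOpen D) (hb : Bornology.IsBounded D) {z : ι → ℂ}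
    (hz : z ∈ D) : ContDiffAt ℝ ∞ (bergmanLog D) z := by
  have := completeSpace_bergmanSpace hD
  have h := bergmanEval_ne_zero hD hb hz
  exact ((contDiff_norm_sq_dual.contDiffAt).comp z
    ((contDiffAt_bergmanEval hD hz).restrict_scalars ℝ)).log (pow_ne_zero 2 (norm_ne_zero_iff.2 h))

lemma leviForm_bergmanLog (hD : IsOpen D) (hb : Bornology.IsBounded D) {z : ι → ℂ}
    (hz : z ∈ D) (v : ι → ℂ) :
    (∀ c : ℂ, leviForm (bergmanLog D) z v * ‖bergmanEval D z‖ ^ 2 ≤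
      ‖fderiv ℂ (bergmanEval D) z v - c • bergmanEval D z‖ ^ 2) ∧
    ∃ c : ℂ, leviForm (bergmanLog D) z v * ‖bergmanEval D z‖ ^ 2 =
      ‖fderiv ℂ (bergmanEval D) z v - c • bergmanEval D z‖ ^ 2 := by
  have := completeSpace_bergmanSpace hD
  exact leviForm_log_norm_sq ((contDiffAt_bergmanEval hD hz).of_le (by norm_cast))
    (bergmanEval_ne_zero hD hb hz) v

/-- Constants and coordinate functions separate points and directions of a bounded domain. -/
lemma leviForm_bergmanLog_pos (hD : IsOpen D) (hb : Bornology.IsBounded D) {z : ι → ℂ}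
    (hz : z ∈ D) {v : ι → ℂ} (hv : v ≠ 0) : 0 < leviForm (bergmanLog D) z v := by
  obtain ⟨-, c, hc⟩ := leviForm_bergmanLog hD hb hz v
  have hK : 0 < ‖bergmanEval D z‖ ^ 2 := by
    have := bergmanEval_ne_zero hD hb hz
    positivity
  suffices h : fderiv ℂ (bergmanEval D) z v - c • bergmanEval D z ≠ 0 by
    have : 0 < ‖fderiv ℂ (bergmanEval D) z v - c • bergmanEval D z‖ ^ 2 := by positivity
    rw [← hc] at this
    exact pos_of_mul_pos_left this hK.le
  intro h0
  have key : ∀ g : (ι → ℂ) → ℂ, Differentiable ℂ g → fderiv ℂ g z v = c * g z := by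
    intro g hg
    have hm := memBergmanSpace_of_bounded hD hb hg
    have h1 := DFunLike.congr_fun h0 hm.toSpace
    have h2 := fderiv_bergmanEval_apply hD hz v hm.toSpace
    rw [((holoRep_toSpace hD hm).eventuallyEq_of_mem (hD.mem_nhds hz)).fderiv_eq] at h2
    have h3 := bergmanEval_apply hD hz hm.toSpace
    rw [holoRep_toSpace hD hm hz] at h3
    rw [← h2, ← h3]
    exact sub_eq_zero.1 h1
  have hc0 : c = 0 := by simpa using (key (fun _ => 1) (differentiable_const _)).symm
  apply hv
  ext i
  have h4 := key (ContinuousLinearMap.proj (R := ℂ) (φ := fun _ : ι => ℂ) i)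
    (ContinuousLinearMap.differentiable _)
  rw [ContinuousLinearMap.fderiv, hc0] at h4
  simpa using h4

end BergmanSpace

section Transformation

open MeasureTheory Set

variable {ι : Type*} [Fintype ι]

lemma abs_det_restrictScalars (L : (ι → ℂ) →L[ℂ] (ι → ℂ)) :
    |(L.restrictScalars ℝ).det| = ‖L.det‖ ^ 2 := by
  have h : (L.restrictScalars ℝ).det = Algebra.norm ℝ L.det :=
    LinearMap.det_restrictScalars (R := ℝ) (S := ℂ) (f := (L : (ι → ℂ) →ₗ[ℂ] (ι → ℂ)))
  rw [h, Algebra.norm_complex_apply, Complex.normSq_eq_norm_sq, abs_of_nonneg (by positivity)]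

/-- The transformation law of Bergman spaces: `g ↦ (g ∘ f) det f'` maps `A²(D₂)` contractively to
`A²(D₁)` for an injective holomorphic map `f : D₁ → D₂`. -/
lemma exists_bergmanSpace_comp {D₁ D₂ : Set (ι → ℂ)} (h₁ : IsOpen D₁)
    {f : (ι → ℂ) → ι → ℂ} (hf : DifferentiableOn ℂ f D₁) (hm : MapsTo f D₁ D₂)
    (hi : InjOn f D₁) (g : BergmanSpace D₂) :
    ∃ g' : BergmanSpace D₁, ‖g'‖ ≤ ‖g‖ ∧
      EqOn (holoRep g') (fun z => (fderiv ℂ f z).det * holoRep g (f z)) D₁ := by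
  have hdet : DifferentiableOn ℂ (fun z => (fderiv ℂ f z).det) D₁ := by
    classical
    have : (fun z => (fderiv ℂ f z).det) = fun z =>
        Matrix.det (Matrix.of fun i j => fderiv ℂ f z (Pi.single j 1) i) := by
      ext1 z
      rw [ContinuousLinearMap.det, ← LinearMap.det_toMatrix']
      congr 1
    rw [this]
    exact differentiableOn_matrix_det fun i j =>
      differentiableOn_pi.1 (differentiableOn_fderiv_apply_complex h₁ hf (Pi.single j 1)) i
  set q : (ι → ℂ) → ℂ := fun z => (fderiv ℂ f z).det * holoRep g (f z) with hq
  have hqd : DifferentiableOn ℂ q D₁ := hdet.mul ((differentiableOn_holoRep g).comp hf hm)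
  have hnorm : eLpNorm q 2 (volume.restrict D₁) ≤ eLpNorm (holoRep g) 2 (volume.restrict D₂) := by
    rw [eLpNorm_eq_lintegral_rpow_enorm_toReal (by norm_num) (by norm_num),
      eLpNorm_eq_lintegral_rpow_enorm_toReal (by norm_num) (by norm_num)]
    refine ENNReal.rpow_le_rpow ?_ (by positivity)
    have hcv := lintegral_image_eq_lintegral_abs_det_fderiv_mul volume h₁.measurableSet
      (fun x hx => ((hf.differentiableAt (h₁.mem_nhds hx)).hasFDerivAt.restrictScalars
        ℝ).hasFDerivWithinAt) hi (fun w => ‖holoRep g w‖ₑ ^ (2 : ℝ≥0∞).toReal)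
    calc ∫⁻ x in D₁, ‖q x‖ₑ ^ (2 : ℝ≥0∞).toReal
        = ∫⁻ x in f '' D₁, ‖holoRep g x‖ₑ ^ (2 : ℝ≥0∞).toReal := by
          rw [hcv]
          refine lintegral_congr fun x => ?_
          rw [abs_det_restrictScalars, hq]
          simp only [enorm_mul, ENNReal.toReal_ofNat, ENNReal.rpow_ofNat, mul_pow]
          rw [ENNReal.ofReal_pow (norm_nonneg _), ofReal_norm]
      _ ≤ ∫⁻ x in D₂, ‖holoRep g x‖ₑ ^ (2 : ℝ≥0∞).toReal :=
          lintegral_mono_set hm.image_subset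
  have hmem : MemBergmanSpace q D₁ := ⟨hqd,
    (hqd.continuousOn.aestronglyMeasurable h₁.measurableSet),
    hnorm.trans_lt (memBergmanSpace_holoRep g).2.2⟩
  refine ⟨hmem.toSpace, ?_, holoRep_toSpace h₁ hmem⟩
  rw [norm_toSpace, ← toReal_eLpNorm_holoRep]
  exact ENNReal.toReal_mono (memBergmanSpace_holoRep g).2.2.ne hnorm

lemma det_mul_norm_bergmanEval_le {D₁ D₂ : Set (ι → ℂ)} (h₁ : IsOpen D₁) (h₂ : IsOpen D₂)
    {f : (ι → ℂ) → ι → ℂ} (hf : DifferentiableOn ℂ f D₁) (hm : MapsTo f D₁ D₂)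
    (hi : InjOn f D₁) {z : ι → ℂ} (hz : z ∈ D₁) :
    ‖(fderiv ℂ f z).det‖ * ‖bergmanEval D₂ (f z)‖ ≤ ‖bergmanEval D₁ z‖ := by
  rw [← norm_smul]
  refine ContinuousLinearMap.opNorm_le_bound _ (norm_nonneg _) fun g => ?_
  obtain ⟨g', hg', he⟩ := exists_bergmanSpace_comp h₁ hf hm hi g
  have : ((fderiv ℂ f z).det • bergmanEval D₂ (f z)) g = bergmanEval D₁ z g' := by
    rw [bergmanEval_apply h₁ hz, he hz, smul_apply, bergmanEval_apply h₂ (hm hz), smul_eq_mul]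
  rw [this]
  exact ((bergmanEval D₁ z).le_opNorm g').trans (by gcongr)

/-- Monotonicity of the extremal quantity `k(z, z) · ω_B(z; v)²` under injective holomorphic
maps. -/
lemma det_mul_leviForm_bergmanLog_le {D₁ D₂ : Set (ι → ℂ)} (h₁ : IsOpen D₁) (h₂ : IsOpen D₂)
    (hb₁ : Bornology.IsBounded D₁) (hb₂ : Bornology.IsBounded D₂)
    {f : (ι → ℂ) → ι → ℂ} (hf : DifferentiableOn ℂ f D₁) (hm : MapsTo f D₁ D₂)
    (hi : InjOn f D₁) {z : ι → ℂ} (hz : z ∈ D₁) (hJ : (fderiv ℂ f z).det ≠ 0) (v : ι → ℂ) :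
    ‖(fderiv ℂ f z).det‖ ^ 2 * (leviForm (bergmanLog D₂) (f z) (fderiv ℂ f z v) *
      ‖bergmanEval D₂ (f z)‖ ^ 2) ≤ leviForm (bergmanLog D₁) z v * ‖bergmanEval D₁ z‖ ^ 2 := by
  obtain ⟨-, c, hc⟩ := leviForm_bergmanLog h₁ hb₁ hz v
  set J := fun z => (fderiv ℂ f z).det with hJdef
  have hfz := hf.differentiableAt (h₁.mem_nhds hz)
  -- `J` is the image of the constant function `1` in `A²(D₁)`
  have hJd : DifferentiableAt ℂ J z := by
    have hm1 := memBergmanSpace_of_bounded h₂ hb₂ (differentiable_const (1 : ℂ))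
    obtain ⟨g', -, he⟩ := exists_bergmanSpace_comp h₁ hf hm hi hm1.toSpace
    have : J =ᶠ[𝓝 z] holoRep g' := by
      filter_upwards [h₁.mem_nhds hz] with x hx
      rw [he hx]
      simp only [holoRep_toSpace h₂ hm1 (hm hx), hJdef, mul_one]
    exact ((differentiableOn_holoRep g').differentiableAt (h₁.mem_nhds hz)).congr_of_eventuallyEq
      this
  -- With this `c'` the functional `J (ev'(f z; f' v) - c' ev(f z))` on `A²(D₂)` is
  -- `ev'(z; v) - c ev(z)` composed with `g ↦ (g ∘ f) J`: the choice absorbs the derivative of `J`.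
  set c' := (c * J z - fderiv ℂ J z v) / J z with hc'
  have h := (leviForm_bergmanLog h₂ hb₂ (hm hz) (fderiv ℂ f z v)).1 c'
  rw [hc]
  calc _ ≤ ‖J z‖ ^ 2 * ‖fderiv ℂ (bergmanEval D₂) (f z) (fderiv ℂ f z v) -
        c' • bergmanEval D₂ (f z)‖ ^ 2 := by gcongr
    _ = ‖J z • (fderiv ℂ (bergmanEval D₂) (f z) (fderiv ℂ f z v) -
        c' • bergmanEval D₂ (f z))‖ ^ 2 := by rw [norm_smul, mul_pow]
    _ ≤ _ := by
      gcongr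
      refine ContinuousLinearMap.opNorm_le_bound _ (norm_nonneg _) fun g => ?_
      obtain ⟨g', hg', he⟩ := exists_bergmanSpace_comp h₁ hf hm hi g
      have hgd := (differentiableOn_holoRep g).differentiableAt (h₂.mem_nhds (hm hz))
      have hder : fderiv ℂ (holoRep g') z v =
          J z * fderiv ℂ (holoRep g) (f z) (fderiv ℂ f z v) +
            fderiv ℂ J z v * holoRep g (f z) := by
        have hcomp := hgd.hasFDerivAt.comp z hfz.hasFDerivAt
        have := hJd.hasFDerivAt.mul hcomp
        rw [(he.eventuallyEq_of_mem (h₁.mem_nhds hz)).fderiv_eq]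
        have h5 : fderiv ℂ (fun z => (fderiv ℂ f z).det * holoRep g (f z)) z = _ := this.fderiv
        rw [h5]
        simp [mul_comm]
      have : (J z • (fderiv ℂ (bergmanEval D₂) (f z) (fderiv ℂ f z v) -
          c' • bergmanEval D₂ (f z))) g =
          (fderiv ℂ (bergmanEval D₁) z v - c • bergmanEval D₁ z) g' := by
        simp only [smul_apply, sub_apply, smul_eq_mul]
        rw [fderiv_bergmanEval_apply h₂ (hm hz), fderiv_bergmanEval_apply h₁ hz,
          bergmanEval_apply h₁ hz, bergmanEval_apply h₂ (hm hz), he hz, hder, hc']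
        change J z ≠ 0 at hJ
        change _ = _ - c * (J z * _)
        field_simp
        ring
      rw [this]
      exact (ContinuousLinearMap.le_opNorm _ g').trans (by gcongr)

end Transformation


/-! ### Homogeneous domains with a transforming norm function -/

section Automorphism

open Set

variable {ι : Type*} [Fintype ι]

lemma IsHolomorphicAutomorphism.exists_inverse {f : (ι → ℂ) → ι → ℂ} {D : Set (ι → ℂ)}
    (hf : IsHolomorphicAutomorphism f D) (hD : IsOpen D) :
    ∃ g, IsHolomorphicAutomorphism g D ∧ (∀ z ∈ D, g (f z) = z) ∧
      ∀ z ∈ D, (fderiv ℂ g (f z)).comp (fderiv ℂ f z) = ContinuousLinearMap.id ℂ _ := by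
  obtain ⟨hfd, hfm, g, hgd, hgm, hl, hr⟩ := hf
  refine ⟨g, ⟨hgd, hgm, f, hfd, hfm, hr, hl⟩, fun z hz => hl hz, fun z hz => ?_⟩
  have h1 := ((hgd.differentiableAt (hD.mem_nhds (hfm hz))).hasFDerivAt.comp z
    (hfd.differentiableAt (hD.mem_nhds hz)).hasFDerivAt)
  have h2 : g ∘ f =ᶠ[𝓝 z] id := by
    filter_upwards [hD.mem_nhds hz] with x hx using hl hx
  rw [← h1.fderiv, h2.fderiv_eq, fderiv_id]

lemma IsHolomorphicAutomorphism.fderiv_ne_zero {f : (ι → ℂ) → ι → ℂ} {D : Set (ι → ℂ)}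
    (hf : IsHolomorphicAutomorphism f D) (hD : IsOpen D) {z : ι → ℂ} (hz : z ∈ D) {v : ι → ℂ}
    (hv : v ≠ 0) : fderiv ℂ f z v ≠ 0 := by
  obtain ⟨g, -, -, h⟩ := hf.exists_inverse hD
  intro h0
  have := DFunLike.congr_fun (h z hz) v
  simp [h0] at this
  exact hv this.symm

/-- Invariance of the Bergman metric under holomorphic automorphisms. -/
lemma IsHolomorphicAutomorphism.leviForm_bergmanLog {f : (ι → ℂ) → ι → ℂ} {D : Set (ι → ℂ)}
    (hf : IsHolomorphicAutomorphism f D) (hD : IsOpen D) (hb : Bornology.IsBounded D)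
    {z : ι → ℂ} (hz : z ∈ D) (v : ι → ℂ) :
    leviForm (bergmanLog D) (f z) (fderiv ℂ f z v) = leviForm (bergmanLog D) z v := by
  obtain ⟨g, hg, hgf, hcomp⟩ := hf.exists_inverse hD
  have hinj : ∀ {f : (ι → ℂ) → ι → ℂ}, IsHolomorphicAutomorphism f D → InjOn f D := by
    rintro f ⟨-, -, g, -, -, hl, -⟩
    exact hl.injOn
  have hfz := hf.2.1 hz
  have hdet : (fderiv ℂ g (f z)).det * (fderiv ℂ f z).det = 1 := by
    have := congrArg ContinuousLinearMap.det (hcomp z hz)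
    simpa [ContinuousLinearMap.det] using this
  have hdet' : ‖(fderiv ℂ g (f z)).det‖ * ‖(fderiv ℂ f z).det‖ = 1 := by
    rw [← norm_mul, hdet, norm_one]
  have hJf : (fderiv ℂ f z).det ≠ 0 := right_ne_zero_of_mul_eq_one hdet
  have hJg : (fderiv ℂ g (f z)).det ≠ 0 := left_ne_zero_of_mul_eq_one hdet
  have k1 := det_mul_norm_bergmanEval_le hD hD hf.1 hf.2.1 (hinj hf) hz
  have k2 := det_mul_norm_bergmanEval_le hD hD hg.1 hg.2.1 (hinj hg) hfz
  have l1 := det_mul_leviForm_bergmanLog_le hD hD hb hb hf.1 hf.2.1 (hinj hf) hz hJf v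
  have l2 := det_mul_leviForm_bergmanLog_le hD hD hb hb hg.1 hg.2.1 (hinj hg) hfz hJg
    (fderiv ℂ f z v)
  rw [hgf z hz] at k2 l2
  have hv : fderiv ℂ g (f z) (fderiv ℂ f z v) = v := DFunLike.congr_fun (hcomp z hz) v
  rw [hv] at l2
  have hK : 0 < ‖bergmanEval D z‖ := norm_pos_iff.2 (bergmanEval_ne_zero hD hb hz)
  set a := ‖(fderiv ℂ g (f z)).det‖ with ha
  set b := ‖(fderiv ℂ f z).det‖ with hb'
  have hb0 : 0 < b := norm_pos_iff.2 hJf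
  have ha0 : 0 < a := norm_pos_iff.2 hJg
  set k := ‖bergmanEval D z‖ with hk
  set k' := ‖bergmanEval D (f z)‖ with hk'
  have keq : b * k' = k := by
    refine le_antisymm k1 ?_
    calc k = b * (a * k) := by rw [← mul_assoc, mul_comm b a, hdet', one_mul]
      _ ≤ b * k' := by gcongr
  set L := leviForm (bergmanLog D) z v
  set L' := leviForm (bergmanLog D) (f z) (fderiv ℂ f z v)
  have e1 : L' * k ^ 2 ≤ L * k ^ 2 := by
    calc L' * k ^ 2 = b ^ 2 * (L' * k' ^ 2) := by rw [← keq]; ring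
      _ ≤ _ := l1
  have e2 : L * k ^ 2 ≤ L' * k ^ 2 := by
    calc L * k ^ 2 = b ^ 2 * (a ^ 2 * (L * k ^ 2)) := by
          rw [← mul_assoc, ← mul_pow, mul_comm b a, hdet', one_pow, one_mul]
      _ ≤ b ^ 2 * (L' * k' ^ 2) := by gcongr
      _ = _ := by rw [← keq]; ring
  have hk2 : 0 < k ^ 2 := by positivity
  exact le_antisymm (le_of_mul_le_mul_right e1 hk2) (le_of_mul_le_mul_right e2 hk2)

end Automorphism

section QuadraticForms

variable {E : Type*} [NormedAddCommGroup E] [NormedSpace ℂ E] [NormedSpace ℝ E]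

lemma continuous_leviForm (u : E → ℝ) (z : E) : Continuous (leviForm u z) := by
  unfold leviForm
  fun_prop

variable [IsScalarTower ℝ ℂ E]

lemma leviForm_real_smul (u : E → ℝ) (z : E) (t : ℝ) (v : E) :
    leviForm u z (t • v) = t ^ 2 * leviForm u z v := by
  have : Complex.I • t • v = t • Complex.I • v := by
    rw [← smul_one_smul ℂ t v, ← smul_one_smul ℂ t (Complex.I • v), smul_smul, smul_smul, mul_comm]
  unfold leviForm
  rw [this]
  simp only [map_smul, smul_apply, smul_eq_mul]
  ring

/-- Two positive definite quadratic forms on a finite dimensional space are comparable. -/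
lemma exists_forall_le_of_pos {E : Type*} [NormedAddCommGroup E] [NormedSpace ℝ E]
    [FiniteDimensional ℝ E] {q₁ q₂ : E → ℝ} (h₁ : Continuous q₁)
    (h₂ : Continuous q₂) (hs₁ : ∀ (t : ℝ) v, q₁ (t • v) = t ^ 2 * q₁ v)
    (hs₂ : ∀ (t : ℝ) v, q₂ (t • v) = t ^ 2 * q₂ v) (hp₂ : ∀ v, v ≠ 0 → 0 < q₂ v) :
    ∃ C > 0, ∀ v, q₁ v ≤ C * q₂ v := by
  have hcomp : IsCompact (Metric.sphere (0 : E) 1) := by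
    have := FiniteDimensional.proper ℝ E
    exact isCompact_sphere 0 1
  have hne : ∀ v ∈ Metric.sphere (0 : E) 1, q₂ v ≠ 0 := fun v hv =>
    (hp₂ v (by intro h; simp [h] at hv)).ne'
  obtain ⟨C, hC⟩ := (hcomp.image_of_continuousOn
    (h₁.continuousOn.div h₂.continuousOn hne)).isBounded.exists_norm_le
  refine ⟨|C| + 1, by positivity, fun v => ?_⟩
  rcases eq_or_ne v 0 with rfl | hv
  · have e1 := hs₁ 0 0
    have e2 := hs₂ 0 0
    simp at e1 e2
    simp [e1, e2]
  have hn : 0 < ‖v‖ := norm_pos_iff.2 hv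
  set w := ‖v‖⁻¹ • v with hw
  have hws : w ∈ Metric.sphere (0 : E) 1 := by
    rw [mem_sphere_zero_iff_norm, hw, norm_smul]
    simp [hn.ne']
  have hvw : v = ‖v‖ • w := by rw [hw, smul_smul, mul_inv_cancel₀ hn.ne', one_smul]
  have hq : 0 < q₂ w := hp₂ w (by intro h; simp [h] at hws)
  have h3 : q₁ w / q₂ w ≤ |C| + 1 := by
    have := hC _ (Set.mem_image_of_mem _ hws)
    rw [Real.norm_eq_abs, Pi.div_apply] at this
    linarith [le_abs_self (q₁ w / q₂ w), le_abs_self C]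
  rw [div_le_iff₀ hq] at h3
  rw [hvw, hs₁, hs₂]
  nlinarith [mul_le_mul_of_nonneg_left h3 (sq_nonneg ‖v‖)]

end QuadraticForms

section NormSq

variable {ι : Type*} [Fintype ι]

/-- `|z|² = ∑ |z_i|²`. -/
noncomputable def coordNormSq (z : ι → ℂ) : ℝ := ∑ i, ‖z i‖ ^ 2

lemma coordNormSq_eq (z : ι → ℂ) : coordNormSq z = ‖WithLp.toLp 2 z‖ ^ 2 := by
  rw [EuclideanSpace.norm_sq_eq]; rfl

lemma coordNormSq_nonneg (z : ι → ℂ) : 0 ≤ coordNormSq z :=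
  Finset.sum_nonneg fun _ _ => by positivity

lemma coordNormSq_pos {z : ι → ℂ} (hz : z ≠ 0) : 0 < coordNormSq z := by
  rw [coordNormSq_eq]
  have : WithLp.toLp 2 z ≠ 0 := by simpa using hz
  positivity

lemma coordNormSq_zero : coordNormSq (0 : ι → ℂ) = 0 := by simp [coordNormSq]

lemma norm_sq_le_coordNormSq (z : ι → ℂ) : ‖z‖ ^ 2 ≤ coordNormSq z := by
  rw [← Real.sqrt_le_sqrt_iff (coordNormSq_nonneg z), Real.sqrt_sq (norm_nonneg z)]
  refine (pi_norm_le_iff_of_nonneg (Real.sqrt_nonneg _)).2 fun i => ?_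
  refine Real.le_sqrt_of_sq_le ?_
  exact Finset.single_le_sum (f := fun i => ‖z i‖ ^ 2) (fun _ _ => by positivity)
    (Finset.mem_univ i)

lemma coordNormSq_smul (t : ℝ) (z : ι → ℂ) : coordNormSq (t • z) = t ^ 2 * coordNormSq z := by
  simp [coordNormSq, Finset.mul_sum, mul_pow]

/-- `ℂ^ι` with its Euclidean norm, as a complex linear map. -/
noncomputable def toEuclidean₂ : (ι → ℂ) →L[ℂ] EuclideanSpace ℂ ι :=
  (EuclideanSpace.equiv ι ℂ).symm.toContinuousLinearMap

lemma coordNormSq_eq_comp :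
    (coordNormSq : (ι → ℂ) → ℝ) = fun z => ‖toEuclidean₂ z‖ ^ 2 := by
  ext z; exact coordNormSq_eq z

lemma contDiff_coordNormSq {n : ℕ∞ω} : ContDiff ℝ n (coordNormSq : (ι → ℂ) → ℝ) := by
  rw [coordNormSq_eq_comp]
  exact contDiff_norm_sq_complex.comp (toEuclidean₂ (ι := ι) |>.restrictScalars ℝ).contDiff

lemma leviForm_coordNormSq (z v : ι → ℂ) : leviForm coordNormSq z v = coordNormSq v := by
  have hu : leviForm coordNormSq z v = leviForm (fun x : EuclideanSpace ℂ ι => ‖x‖ ^ 2)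
      (toEuclidean₂ z) (toEuclidean₂ v) := by
    rw [coordNormSq_eq_comp]
    have := leviForm_comp_holomorphic (u := fun x : EuclideanSpace ℂ ι => ‖x‖ ^ 2)
      (f := toEuclidean₂ (ι := ι)) (z := z) (toEuclidean₂ (ι := ι)).contDiff.contDiffAt
      contDiff_norm_sq_complex.contDiffAt v
    rwa [ContinuousLinearMap.fderiv] at this
  rw [hu, coordNormSq_eq_comp]
  unfold leviForm
  rw [fderiv_fderiv_norm_sq_complex, fderiv_fderiv_norm_sq_complex, inner_smul_left,
    inner_smul_right, ← mul_assoc]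
  simp [← Complex.ofReal_pow]
  ring

lemma dbarSq_coordNormSq (z v : ι → ℂ) :
    dbarSq coordNormSq z v = ‖∑ i, conj (z i) * v i‖ ^ 2 := by
  rw [coordNormSq_eq_comp, dbarSq_comp_holomorphic (u := fun x => ‖x‖ ^ 2)
    toEuclidean₂.differentiableAt
    ((contDiff_norm_sq_complex (n := 1)).differentiable (by norm_num) _),
    ContinuousLinearMap.fderiv]
  unfold dbarSq
  rw [fderiv_norm_sq_complex, fderiv_norm_sq_complex, inner_smul_right]
  have h1 : inner ℂ (toEuclidean₂ z) (toEuclidean₂ v) = ∑ i, conj (z i) * v i := by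
    rw [PiLp.inner_apply]
    simp [toEuclidean₂, mul_comm]
  rw [h1, ← Complex.normSq_eq_norm_sq, Complex.normSq_apply]
  simp
  ring

end NormSq

section Datum

open Set Bornology

/-- A domain `R ∋ 0` with a kernel-like function `h`, holomorphic in the first variable and
hermitian, such that for every `z₀ ∈ R` there are automorphisms `φ ∈ Φ z₀` of `R` with `φ z₀ = 0`,
under all of which `h` transforms by `h(φz, φw) h(z, z₀) h(z₀, w) = h(z, w) h(z₀, z₀)`; moreover
`h(z, z)` defines the boundary of `R` and is squeezed between `1 - C|z|²` and `1 - c|z|²`. -/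
structure IsHomogeneousDatum {κ : Type*} [Fintype κ] (R : Set (κ → ℂ))
    (h : (κ → ℂ) → (κ → ℂ) → ℂ) (Φ : (κ → ℂ) → Set ((κ → ℂ) → κ → ℂ)) : Prop where
  isOpen : IsOpen R
  smul_mem : ∀ z ∈ R, ∀ t : ℝ, 0 ≤ t → t ≤ 1 → t • z ∈ R
  differentiable : ∀ w, Differentiable ℂ fun z => h z w
  contDiff : ContDiff ℝ ∞ fun z => (h z z).re
  conj_symm : ∀ z w, conj (h z w) = h w z
  apply_zero : ∀ z, h z 0 = 1
  ne_zero : ∀ z ∈ R, ∀ w ∈ R, h z w ≠ 0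
  pos : ∀ z ∈ R, 0 < (h z z).re
  upper : ∃ c > 0, ∀ z ∈ R, (h z z).re ≤ 1 - c * coordNormSq z
  lower : ∃ C > 0, ∀ z, C * coordNormSq z < 1 → z ∈ R ∧ 1 - C * coordNormSq z ≤ (h z z).re
  mem_of_mem_closure : ∀ z ∈ closure R, 0 < (h z z).re → z ∈ R
  bounded : ∃ M, ∀ z ∈ R, ∀ w ∈ R, ‖h z w‖ ≤ M
  nonempty : ∀ z₀ ∈ R, (Φ z₀).Nonempty
  automorphism : ∀ z₀ ∈ R, ∀ φ ∈ Φ z₀, IsHolomorphicAutomorphism φ R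
  map_self : ∀ z₀ ∈ R, ∀ φ ∈ Φ z₀, φ z₀ = 0
  transform : ∀ z₀ ∈ R, ∀ φ ∈ Φ z₀, ∀ z ∈ R, ∀ w ∈ R,
    h (φ z) (φ w) * (h z z₀ * h z₀ w) = h z w * h z₀ z₀

namespace IsHomogeneousDatum

variable {κ : Type*} [Fintype κ] {R : Set (κ → ℂ)} {h : (κ → ℂ) → (κ → ℂ) → ℂ}
  {Φ : (κ → ℂ) → Set ((κ → ℂ) → κ → ℂ)} (H : IsHomogeneousDatum R h Φ)

include H

lemma zero_mem : (0 : κ → ℂ) ∈ R := by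
  obtain ⟨C, -, hC⟩ := H.lower
  exact (hC 0 (by simp [coordNormSq_zero])).1

lemma zero_apply (w : κ → ℂ) : h 0 w = 1 := by
  rw [← H.conj_symm, H.apply_zero, map_one]

lemma ofReal_re_self (z : κ → ℂ) : ((h z z).re : ℂ) = h z z :=
  Complex.conj_eq_iff_re.1 (H.conj_symm z z)

lemma isBounded : IsBounded R := by
  obtain ⟨c, hc, hup⟩ := H.upper
  refine (isBounded_iff_forall_norm_le).2 ⟨1 / c + 1, fun z hz => ?_⟩
  have h1 := hup z hz
  have h2 := H.pos z hz
  have h3 := norm_sq_le_coordNormSq z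
  have h4 : ‖z‖ ^ 2 ≤ 1 / c := by
    rw [le_div_iff₀ hc]; nlinarith
  nlinarith [sq_nonneg (‖z‖ - 1), norm_nonneg z, (by positivity : 0 < 1 / c)]

lemma re_transform {z₀ : κ → ℂ} (hz₀ : z₀ ∈ R) {φ : (κ → ℂ) → κ → ℂ} (hφ : φ ∈ Φ z₀)
    {z : κ → ℂ} (hz : z ∈ R) :
    (h (φ z) (φ z)).re * ‖h z z₀‖ ^ 2 = (h z z).re * (h z₀ z₀).re := by
  have h1 := H.transform z₀ hz₀ φ hφ z hz z hz
  rw [← H.conj_symm z z₀, Complex.mul_conj, ← H.ofReal_re_self (φ z), ← H.ofReal_re_self z,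
    ← H.ofReal_re_self z₀, Complex.normSq_eq_norm_sq] at h1
  exact_mod_cast h1

lemma log_transform {z₀ : κ → ℂ} (hz₀ : z₀ ∈ R) {φ : (κ → ℂ) → κ → ℂ} (hφ : φ ∈ Φ z₀)
    {z : κ → ℂ} (hz : z ∈ R) :
    Real.log (h (φ z) (φ z)).re =
      Real.log (h z z).re + Real.log (h z₀ z₀).re - Real.log (‖h z z₀‖ ^ 2) := by
  have h1 := congrArg Real.log (H.re_transform hz₀ hφ hz)
  have hφz := (H.automorphism z₀ hz₀ φ hφ).2.1 hz
  have h2 : ‖h z z₀‖ ^ 2 ≠ 0 := by simpa using H.ne_zero z hz z₀ hz₀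
  rw [Real.log_mul (H.pos _ hφz).ne' h2, Real.log_mul (H.pos z hz).ne' (H.pos z₀ hz₀).ne'] at h1
  linarith

lemma contDiffAt_log {z : κ → ℂ} (hz : z ∈ R) :
    ContDiffAt ℝ ∞ (fun z => Real.log (h z z).re) z :=
  H.contDiff.contDiffAt.log (H.pos z hz).ne'

lemma contDiffAt_apply (w z : κ → ℂ) : ContDiffAt ℂ ∞ (fun z => h z w) z :=
  (contDiffOn_complex isOpen_univ (H.differentiable w).differentiableOn).contDiffAt
    Filter.univ_mem

lemma contDiffAt_log_norm_sq {w z : κ → ℂ} (hw : w ∈ R) (hz : z ∈ R) :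
    ContDiffAt ℝ ∞ (fun z => Real.log (‖h z w‖ ^ 2)) z := by
  refine ContDiffAt.log ?_ (by simpa using H.ne_zero z hz w hw)
  exact (contDiff_norm_sq_complex (H := ℂ)).contDiffAt.comp z
    ((H.contDiffAt_apply w z).restrict_scalars ℝ)

lemma leviForm_log_norm_sq_eq_zero {w z : κ → ℂ} (hw : w ∈ R) (hz : z ∈ R) (v : κ → ℂ) :
    leviForm (fun z => Real.log (‖h z w‖ ^ 2)) z v = 0 :=
  _root_.leviForm_log_norm_sq_eq_zero ((H.contDiffAt_apply w z).of_le (by norm_cast))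
    (H.ne_zero z hz w hw) v

lemma leviForm_log_invariant {z₀ : κ → ℂ} (hz₀ : z₀ ∈ R) {φ : (κ → ℂ) → κ → ℂ}
    (hφ : φ ∈ Φ z₀) {z : κ → ℂ} (hz : z ∈ R) (v : κ → ℂ) :
    leviForm (fun z => Real.log (h z z).re) (φ z) (fderiv ℂ φ z v) =
      leviForm (fun z => Real.log (h z z).re) z v := by
  have haut := H.automorphism z₀ hz₀ φ hφ
  have hφd : ContDiffAt ℂ ∞ φ z :=
    (contDiffOn_complex H.isOpen haut.1).contDiffAt (H.isOpen.mem_nhds hz)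
  have h2 : (2 : ℕ∞ω) ≤ ((⊤ : ℕ∞) : ℕ∞ω) := by norm_cast
  have hev : (fun z => Real.log (h (φ z) (φ z)).re) =ᶠ[𝓝 z] fun z =>
      (Real.log (h z z).re + Real.log (h z₀ z₀).re) - Real.log (‖h z z₀‖ ^ 2) := by
    filter_upwards [H.isOpen.mem_nhds hz] with x hx using H.log_transform hz₀ hφ hx
  have hc1 := (H.contDiffAt_log hz).of_le h2
  rw [← leviForm_comp_holomorphic (u := fun z => Real.log (h z z).re) (hφd.of_le h2)
    ((H.contDiffAt_log (haut.2.1 hz)).of_le h2), hev.leviForm_eq,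
    leviForm_sub (hc1.add contDiffAt_const) ((H.contDiffAt_log_norm_sq hz₀ hz).of_le h2),
    leviForm_add hc1 contDiffAt_const, leviForm_const, H.leviForm_log_norm_sq_eq_zero hz₀ hz]
  ring

lemma eventually_upper : ∃ c > 0, ∀ᶠ z in 𝓝 (0 : κ → ℂ), (h z z).re ≤ 1 - c * coordNormSq z := by
  obtain ⟨c, hc, hup⟩ := H.upper
  exact ⟨c, hc, by filter_upwards [H.isOpen.mem_nhds H.zero_mem] with z hz using hup z hz⟩

lemma eventually_lower : ∃ C > 0, ∀ᶠ z in 𝓝 (0 : κ → ℂ), 1 - C * coordNormSq z ≤ (h z z).re := by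
  obtain ⟨C, hC, hlow⟩ := H.lower
  refine ⟨C, hC, ?_⟩
  have h0 : Filter.Tendsto (fun z : κ → ℂ => C * coordNormSq z) (𝓝 0) (𝓝 0) := by
    have := (continuous_const.mul (contDiff_coordNormSq (ι := κ) (n := 0)).continuous).tendsto
      (f := fun z : κ → ℂ => C * coordNormSq z) 0
    simpa [coordNormSq_zero] using this
  filter_upwards [h0.eventually_lt_const one_pos] with z hz
  exact (hlow z hz).2

lemma isLocalMax_zero : IsLocalMax (fun z => (h z z).re) 0 := by
  obtain ⟨c, hc, hup⟩ := H.eventually_upper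
  filter_upwards [hup] with z hz
  rw [H.apply_zero]
  simp only [Complex.one_re]
  nlinarith [coordNormSq_nonneg z]

/-- The Levi form of `-h(z, z)` at the origin is positive definite. -/
lemma exists_leviForm_zero_bounds : ∃ c > 0, ∃ C > 0, ∀ v,
    c * coordNormSq v ≤ -leviForm (fun z => (h z z).re) 0 v ∧
      -leviForm (fun z => (h z z).re) 0 v ≤ C * coordNormSq v := by
  obtain ⟨c, hc, hup⟩ := H.eventually_upper
  obtain ⟨C, hC, hlow⟩ := H.eventually_lower
  have hh : ContDiffAt ℝ 2 (fun z => (h z z).re) 0 :=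
    (H.contDiff.of_le (by norm_cast)).contDiffAt
  have hq : ∀ a : ℝ, ContDiffAt ℝ 2 (fun z : κ → ℂ => a * coordNormSq z) 0 := fun a =>
    (contDiff_const.mul contDiff_coordNormSq).contDiffAt
  have hlev : ∀ (a : ℝ) (v : κ → ℂ), leviForm (fun z => (h z z).re + a * coordNormSq z) 0 v =
      leviForm (fun z => (h z z).re) 0 v + a * coordNormSq v := fun a v => by
    rw [leviForm_add hh (hq a), leviForm_const_mul contDiff_coordNormSq.contDiffAt,
      leviForm_coordNormSq]
  refine ⟨c, hc, C, hC, fun v => ⟨?_, ?_⟩⟩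
  · have := leviForm_nonneg_of_isLocalMin (u := fun z => -1 * ((h z z).re + c * coordNormSq z))
      (z := 0) (contDiffAt_const.mul (hh.add (hq c))) (by
        filter_upwards [hup] with z hz
        simp [H.apply_zero, coordNormSq_zero]
        linarith) v
    rw [leviForm_const_mul (hh.add (hq c)), hlev] at this
    linarith
  · have := leviForm_nonneg_of_isLocalMin (u := fun z => (h z z).re + C * coordNormSq z)
      (z := 0) (hh.add (hq C)) (by
        filter_upwards [hlow] with z hz
        simp [H.apply_zero, coordNormSq_zero]
        linarith) v
    rw [hlev] at this
    linarith

lemma leviForm_log_zero (v : κ → ℂ) : leviForm (fun z => Real.log (h z z).re) 0 v =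
    leviForm (fun z => (h z z).re) 0 v := by
  rw [leviForm_log (u := fun z => (h z z).re) (H.contDiff.of_le (by norm_cast)).contDiffAt
    (by simp [H.apply_zero]), dbarSq_eq_zero_of_isLocalExtr (Or.inr H.isLocalMax_zero)]
  simp [H.apply_zero]

/-- On a homogeneous domain the Bergman metric and the metric with potential `-log h(z, z)` are
equivalent: both are invariant, and any two positive definite forms at the origin are comparable. -/
lemma exists_leviForm_bergmanLog_bounds : ∃ a > 0, ∃ b > 0, ∀ z ∈ R, ∀ v,
    leviForm (bergmanLog R) z v ≤ a * -leviForm (fun z => Real.log (h z z).re) z v ∧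
      -leviForm (fun z => Real.log (h z z).re) z v ≤ b * leviForm (bergmanLog R) z v := by
  obtain ⟨c, hc, C, hC, hb⟩ := H.exists_leviForm_zero_bounds
  have hpos : ∀ v : κ → ℂ, v ≠ 0 → 0 < -leviForm (fun z => Real.log (h z z).re) 0 v := by
    intro v hv
    rw [H.leviForm_log_zero]
    have := coordNormSq_pos hv
    exact lt_of_lt_of_le (by positivity) (hb v).1
  have hs : ∀ (t : ℝ) (v : κ → ℂ), -leviForm (fun z => Real.log (h z z).re) 0 (t • v) =
      t ^ 2 * -leviForm (fun z => Real.log (h z z).re) 0 v := fun t v => by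
    rw [leviForm_real_smul]; ring
  obtain ⟨a, ha, h1⟩ := exists_forall_le_of_pos (continuous_leviForm (bergmanLog R) 0)
    (continuous_leviForm (fun z => Real.log (h z z).re) 0).neg
    (leviForm_real_smul _ _) hs hpos
  obtain ⟨b, hb, h2⟩ := exists_forall_le_of_pos
    (continuous_leviForm (fun z => Real.log (h z z).re) 0).neg
    (continuous_leviForm (bergmanLog R) 0) hs
    (leviForm_real_smul _ _) fun v hv => leviForm_bergmanLog_pos H.isOpen H.isBounded H.zero_mem hv
  refine ⟨a, ha, b, hb, fun z hz v => ?_⟩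
  obtain ⟨φ, hφ⟩ := H.nonempty z hz
  have e1 := (H.automorphism z hz φ hφ).leviForm_bergmanLog H.isOpen H.isBounded hz v
  have e2 := H.leviForm_log_invariant hz hφ hz v
  rw [H.map_self z hz φ hφ] at e1 e2
  rw [← e1, ← e2]
  exact ⟨h1 _, h2 _⟩

end IsHomogeneousDatum

end Datum


/-! ### Logarithms of the norm function and automorphisms of Hartogs domains -/

section HartogsAutomorphism

open Set Bornology

lemma IsHolomorphicAutomorphism.congr {ι : Type*} [Fintype ι] {f g : (ι → ℂ) → ι → ℂ}
    {D : Set (ι → ℂ)} (hf : IsHolomorphicAutomorphism f D) (hfg : EqOn g f D) :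
    IsHolomorphicAutomorphism g D := by
  obtain ⟨hd, hm, k, hkd, hkm, hl, hr⟩ := hf
  refine ⟨hd.congr hfg, fun z hz => by rw [hfg hz]; exact hm hz, k, hkd, hkm, fun z hz => ?_,
    fun z hz => ?_⟩
  · rw [hfg hz]; exact hl hz
  · rw [hfg (hkm hz)]; exact hr hz

variable {κ : Type*} {N : ℕ}

/-- The projection `(Z, W) ↦ Z`. -/
noncomputable def baseProj (κ : Type*) (N : ℕ) : (κ ⊕ Fin N → ℂ) →L[ℂ] (κ → ℂ) :=
  ContinuousLinearMap.pi fun i => ContinuousLinearMap.proj (Sum.inl i)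

/-- The projection `(Z, W) ↦ W`. -/
noncomputable def fiberProj (κ : Type*) (N : ℕ) : (κ ⊕ Fin N → ℂ) →L[ℂ] (Fin N → ℂ) :=
  ContinuousLinearMap.pi fun i => ContinuousLinearMap.proj (Sum.inr i)

lemma baseProj_apply (z : κ ⊕ Fin N → ℂ) : baseProj κ N z = z ∘ Sum.inl := rfl

lemma fiberNormSq_eq (z : κ ⊕ Fin N → ℂ) : fiberNormSq z = coordNormSq (fiberProj κ N z) := rfl

lemma fiberNormSq_nonneg (z : κ ⊕ Fin N → ℂ) : 0 ≤ fiberNormSq z := coordNormSq_nonneg _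

lemma continuous_fiberNormSq : Continuous (fiberNormSq : (κ ⊕ Fin N → ℂ) → ℝ) :=
  (contDiff_coordNormSq (n := 0)).continuous.comp (fiberProj κ N).continuous

/-- The bundle map `(Z, W) ↦ (φ(Z), W a(Z))`. -/
def hartogsLift (φ : (κ → ℂ) → κ → ℂ) (a : (κ → ℂ) → ℂ) (z : κ ⊕ Fin N → ℂ) : κ ⊕ Fin N → ℂ :=
  Sum.elim (φ (z ∘ Sum.inl)) fun k => z (Sum.inr k) * a (z ∘ Sum.inl)

lemma hartogsLift_inl (φ : (κ → ℂ) → κ → ℂ) (a : (κ → ℂ) → ℂ) (z : κ ⊕ Fin N → ℂ) :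
    hartogsLift φ a z ∘ Sum.inl = φ (z ∘ Sum.inl) := rfl

lemma fiberNormSq_hartogsLift (φ : (κ → ℂ) → κ → ℂ) (a : (κ → ℂ) → ℂ) (z : κ ⊕ Fin N → ℂ) :
    fiberNormSq (hartogsLift φ a z) = ‖a (z ∘ Sum.inl)‖ ^ 2 * fiberNormSq z := by
  simp [fiberNormSq, hartogsLift, Finset.mul_sum, mul_pow, mul_comm]

lemma hartogsX_hartogsLift {h : (κ → ℂ) → (κ → ℂ) → ℂ} {K : ℝ} {φ : (κ → ℂ) → κ → ℂ}
    {a : (κ → ℂ) → ℂ} {z : κ ⊕ Fin N → ℂ}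
    (hz : ‖a (z ∘ Sum.inl)‖ ^ 2 *
      (h (φ (z ∘ Sum.inl)) (φ (z ∘ Sum.inl))).re ^ (-(1 / K)) =
        (h (z ∘ Sum.inl) (z ∘ Sum.inl)).re ^ (-(1 / K))) :
    hartogsX h K (hartogsLift φ a z) = hartogsX h K z := by
  rw [hartogsX, hartogsX, hartogsLift_inl, fiberNormSq_hartogsLift, ← hz]
  ring

lemma hartogsX_nonneg {h : (κ → ℂ) → (κ → ℂ) → ℂ} (K : ℝ) {z : κ ⊕ Fin N → ℂ}
    (hz : 0 < (h (z ∘ Sum.inl) (z ∘ Sum.inl)).re) : 0 ≤ hartogsX h K z :=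
  mul_nonneg (fiberNormSq_nonneg z) (Real.rpow_nonneg hz.le _)

namespace IsHomogeneousDatum

variable [Fintype κ] {R : Set (κ → ℂ)} {h : (κ → ℂ) → (κ → ℂ) → ℂ}
  {Φ : (κ → ℂ) → Set ((κ → ℂ) → κ → ℂ)} (H : IsHomogeneousDatum R h Φ)

include H

lemma transform_zero {z₀ : κ → ℂ} (hz₀ : z₀ ∈ R) {φ : (κ → ℂ) → κ → ℂ} (hφ : φ ∈ Φ z₀)
    {z : κ → ℂ} (hz : z ∈ R) : h (φ z) (φ 0) * h z z₀ = h z₀ z₀ := by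
  simpa [H.apply_zero] using H.transform z₀ hz₀ φ hφ z hz 0 H.zero_mem

lemma exists_le_norm {z₀ : κ → ℂ} (hz₀ : z₀ ∈ R) : ∃ δ > 0, ∀ z ∈ R, δ ≤ ‖h z z₀‖ := by
  obtain ⟨M, hM⟩ := H.bounded
  obtain ⟨φ, hφ⟩ := H.nonempty z₀ hz₀
  have hm := (H.automorphism z₀ hz₀ φ hφ).2.1
  have hM0 : 0 < M := by
    have := hM 0 H.zero_mem 0 H.zero_mem
    rw [H.apply_zero, norm_one] at this
    linarith
  refine ⟨(h z₀ z₀).re / M, div_pos (H.pos z₀ hz₀) hM0, fun z hz => ?_⟩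
  have h1 := congrArg norm (H.transform_zero hz₀ hφ hz)
  rw [norm_mul] at h1
  rw [div_le_iff₀ hM0]
  calc (h z₀ z₀).re ≤ ‖h z₀ z₀‖ := Complex.re_le_norm _
    _ = _ := h1.symm
    _ ≤ M * ‖h z z₀‖ := by gcongr; exact hM _ (hm hz) _ (hm H.zero_mem)
    _ = _ := mul_comm _ _

/-- `h(·, z₀)` has a holomorphic logarithm on `R`. As `|h(·, z₀)|` is bounded below, the segment
from `0` to `z` can be cut into a number `n` of pieces independent of `z`, along each of which the
principal branch applies to the quotient of the values at the end points. -/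
lemma exists_holomorphic_log {z₀ : κ → ℂ} (hz₀ : z₀ ∈ R) :
    ∃ L : (κ → ℂ) → ℂ, DifferentiableOn ℂ L R ∧ ∀ z ∈ R, Complex.exp (L z) = h z z₀ := by
  obtain ⟨δ, hδ, hle⟩ := H.exists_le_norm hz₀
  obtain ⟨M, hM⟩ := H.isBounded.exists_norm_le
  have hM0 : 0 ≤ M := (norm_nonneg _).trans (hM 0 H.zero_mem)
  have huc := (isCompact_closedBall (0 : κ → ℂ) M).uniformContinuousOn_of_continuous
    (H.differentiable z₀).continuous.continuousOn
  obtain ⟨η, hη, huc⟩ := Metric.uniformContinuousOn_iff.1 huc δ hδ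
  obtain ⟨n, hn⟩ := exists_nat_gt (M / η)
  have hn0 : (0 : ℝ) < n := lt_of_le_of_lt (by positivity) hn
  set q : ℕ → (κ → ℂ) → ℂ := fun j z => h (((j : ℝ) / n) • z) z₀ with hq
  have hmem : ∀ j ≤ n, ∀ z ∈ R, ((j : ℝ) / n) • z ∈ R := fun j hj z hz =>
    H.smul_mem z hz _ (by positivity) (by rw [div_le_one hn0]; exact_mod_cast hj)
  have hne : ∀ j ≤ n, ∀ z ∈ R, q j z ≠ 0 := fun j hj z hz =>
    H.ne_zero _ (hmem j hj z hz) _ hz₀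
  have hslit : ∀ j < n, ∀ z ∈ R, q (j + 1) z / q j z ∈ Complex.slitPlane := by
    intro j hj z hz
    have m1 := hmem j hj.le z hz
    have m2 := hmem (j + 1) hj z hz
    have h1 : dist (h ((((j + 1 : ℕ) : ℝ) / n) • z) z₀) (h (((j : ℝ) / n) • z) z₀) < δ := by
      refine huc _ (by simpa using hM _ m2) _ (by simpa using hM _ m1) ?_
      rw [dist_eq_norm, ← sub_smul, norm_smul]
      have : ((j + 1 : ℕ) : ℝ) / n - (j : ℝ) / n = 1 / n := by push_cast; ring
      rw [this, Real.norm_of_nonneg (by positivity)]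
      rw [div_lt_iff₀ hη] at hn
      rw [one_div, inv_mul_lt_iff₀ hn0]
      exact (hM z hz).trans_lt hn
    rw [dist_eq_norm] at h1
    have h2 : ‖(q (j + 1) z - q j z) / q j z‖ < 1 := by
      rw [norm_div, div_lt_one (norm_pos_iff.2 (hne j hj.le z hz))]
      exact h1.trans_le (hle _ m1)
    have := Complex.mem_slitPlane_of_norm_lt_one h2
    rwa [sub_div, div_self (hne j hj.le z hz), add_sub_cancel] at this
  have hqd : ∀ j, Differentiable ℂ (q j) := fun j =>
    (H.differentiable z₀).comp (by fun_prop : Differentiable ℂ fun z : κ → ℂ => ((j : ℝ) / n) • z)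
  refine ⟨fun z => ∑ j ∈ Finset.range n, Complex.log (q (j + 1) z / q j z), ?_, fun z hz => ?_⟩
  · refine DifferentiableOn.fun_sum fun j hj => ?_
    have hj := Finset.mem_range.1 hj
    refine DifferentiableOn.clog ?_ fun z hz => hslit j hj z hz
    simp only [div_eq_mul_inv]
    exact (hqd _).differentiableOn.mul
      ((hqd _).differentiableOn.inv fun z hz => hne j hj.le z hz)
  · have hprod : ∀ m ≤ n, ∏ j ∈ Finset.range m, q (j + 1) z / q j z = q m z := by
      intro m
      induction m with
      | zero => intro _; simp [hq, H.zero_apply]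
      | succ m ih =>
        intro hm
        rw [Finset.prod_range_succ, ih (by omega), mul_div_cancel₀ _ (hne m (by omega) z hz)]
    rw [Complex.exp_sum]
    have : ∀ j ∈ Finset.range n, Complex.exp (Complex.log (q (j + 1) z / q j z)) =
        q (j + 1) z / q j z := fun j hj => by
      have hj := Finset.mem_range.1 hj
      exact Complex.exp_log (div_ne_zero (hne _ hj z hz) (hne _ hj.le z hz))
    rw [Finset.prod_congr rfl this, hprod n le_rfl]
    simp [hq, hn0.ne']

variable {K : ℝ}

/-- Every point of the Hartogs domain is moved to a point `(0, W)`. -/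
lemma exists_mem_hartogsAut {z : κ ⊕ Fin N → ℂ} (hz : z ∈ hartogsDomain R h N K) :
    ∃ f ∈ hartogsAut R h Φ N K, f z ∘ Sum.inl = 0 := by
  obtain ⟨φ, hφ⟩ := H.nonempty _ hz.1
  obtain ⟨L, hL, hexp⟩ := H.exists_holomorphic_log hz.1
  refine ⟨hartogsLift φ fun Z => (((h (z ∘ Sum.inl) (z ∘ Sum.inl)).re ^ (1 / (2 * K)) : ℝ) : ℂ) *
    Complex.exp (-(L Z / K)), ⟨z ∘ Sum.inl, hz.1, φ, hφ, L, hL, hexp, fun x hx => ⟨rfl, fun k => ?_⟩⟩,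
    H.map_self _ hz.1 φ hφ⟩
  rw [mul_assoc]; rfl

variable (hK : 0 < K)
include hK

lemma mem_hartogsDomain_iff {z : κ ⊕ Fin N → ℂ} :
    z ∈ hartogsDomain R h N K ↔ z ∘ Sum.inl ∈ R ∧ hartogsX h K z < 1 := by
  refine and_congr_right fun hz => ?_
  have hr := H.pos _ hz
  rw [hartogsX, Real.rpow_neg hr.le, ← div_eq_mul_inv, div_lt_one (Real.rpow_pos_of_pos hr _),
    one_div, Real.lt_rpow_inv_iff_of_pos (fiberNormSq_nonneg z) hr.le hK]

lemma isOpen_hartogsDomain : IsOpen (hartogsDomain R h N K) := by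
  have h1 : Continuous fun z : κ ⊕ Fin N → ℂ => fiberNormSq z ^ K :=
    continuous_fiberNormSq.rpow_const fun _ => Or.inr hK.le
  have h2 : Continuous fun z : κ ⊕ Fin N → ℂ => (h (z ∘ Sum.inl) (z ∘ Sum.inl)).re :=
    H.contDiff.continuous.comp (baseProj κ N).continuous
  exact (H.isOpen.preimage (baseProj κ N).continuous).inter (isOpen_lt h1 h2)

lemma fiberNormSq_lt_one {z : κ ⊕ Fin N → ℂ} (hz : z ∈ hartogsDomain R h N K) :
    fiberNormSq z < 1 := by
  obtain ⟨c, hc, hup⟩ := H.upper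
  have h1 := hz.2.trans_le (hup _ hz.1)
  by_contra! h2
  have := Real.one_le_rpow h2 hK.le
  nlinarith [coordNormSq_nonneg (z ∘ Sum.inl)]

lemma isBounded_hartogsDomain : IsBounded (hartogsDomain R h N K) := by
  obtain ⟨M, hM⟩ := H.isBounded.exists_norm_le
  refine isBounded_iff_forall_norm_le.2 ⟨max M 1, fun z hz => ?_⟩
  refine (pi_norm_le_iff_of_nonneg (le_max_of_le_right zero_le_one)).2 ?_
  rintro (i | k)
  · exact (norm_le_pi_norm (z ∘ Sum.inl) i).trans ((hM _ hz.1).trans (le_max_left _ _))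
  · refine le_trans ?_ (le_max_right _ _)
    have h1 := norm_sq_le_coordNormSq (fiberProj κ N z)
    have h2 := H.fiberNormSq_lt_one hK hz
    rw [fiberNormSq_eq] at h2
    have h3 := norm_le_pi_norm (fiberProj κ N z) k
    have h4 : ‖fiberProj κ N z‖ ≤ 1 := by nlinarith [norm_nonneg (fiberProj κ N z)]
    exact h3.trans h4

/-- A bundle map over an automorphism of `R` that preserves `X` is an automorphism of the Hartogs
domain. -/
lemma isHolomorphicAutomorphism_hartogsLift {φ : (κ → ℂ) → κ → ℂ} {a : (κ → ℂ) → ℂ}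
    (hφ : IsHolomorphicAutomorphism φ R) (ha : DifferentiableOn ℂ a R) (ha0 : ∀ Z ∈ R, a Z ≠ 0)
    (hX : ∀ Z ∈ R, ‖a Z‖ ^ 2 * (h (φ Z) (φ Z)).re ^ (-(1 / K)) = (h Z Z).re ^ (-(1 / K))) :
    IsHolomorphicAutomorphism (hartogsLift φ a) (hartogsDomain R h N K) := by
  have hdiff : ∀ {φ : (κ → ℂ) → κ → ℂ} {a : (κ → ℂ) → ℂ}, DifferentiableOn ℂ φ R →
      DifferentiableOn ℂ a R →
      DifferentiableOn ℂ (hartogsLift φ a) (hartogsDomain R h N K) := by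
    intro φ a hφ ha
    have hm : MapsTo (baseProj κ N) (hartogsDomain R h N K) R := fun z hz => hz.1
    refine differentiableOn_pi.2 ?_
    rintro (i | k)
    · exact (differentiableOn_pi.1 hφ i).comp (baseProj κ N).differentiableOn hm
    · have h1 : DifferentiableOn ℂ (fun z : κ ⊕ Fin N → ℂ => z (Sum.inr k))
          (hartogsDomain R h N K) := by fun_prop
      exact h1.mul (ha.comp (baseProj κ N).differentiableOn hm)
  have hmaps : ∀ {φ : (κ → ℂ) → κ → ℂ} {a : (κ → ℂ) → ℂ}, MapsTo φ R R →
      (∀ Z ∈ R, ‖a Z‖ ^ 2 * (h (φ Z) (φ Z)).re ^ (-(1 / K)) = (h Z Z).re ^ (-(1 / K))) →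
      MapsTo (hartogsLift φ a) (hartogsDomain R h N K) (hartogsDomain R h N K) := by
    intro φ a hφ hX z hz
    rw [H.mem_hartogsDomain_iff hK] at hz ⊢
    exact ⟨hφ hz.1, by rw [hartogsX_hartogsLift (hX _ hz.1)]; exact hz.2⟩
  obtain ⟨hφd, hφm, ψ, hψd, hψm, hl, hr⟩ := hφ
  refine ⟨hdiff hφd ha, hmaps hφm hX, hartogsLift ψ fun Z => (a (ψ Z))⁻¹, ?_, ?_, ?_, ?_⟩
  · exact hdiff hψd ((ha.comp hψd hψm).inv fun Z hZ => ha0 _ (hψm hZ))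
  · refine hmaps hψm fun Z hZ => ?_
    have h1 := hX _ (hψm hZ)
    rw [hr hZ] at h1
    have h2 : ‖a (ψ Z)‖ ≠ 0 := norm_ne_zero_iff.2 (ha0 _ (hψm hZ))
    rw [norm_inv, ← h1]
    field_simp
  · intro z hz
    funext i
    rcases i with i | k
    · exact congrFun (hl hz.1) i
    · have := ha0 _ hz.1
      simp only [hartogsLift, Sum.elim_inr]
      have e : ψ (Sum.elim (φ (z ∘ Sum.inl)) (fun k => z (Sum.inr k) * a (z ∘ Sum.inl)) ∘ Sum.inl) =
        z ∘ Sum.inl := hl hz.1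
      rw [e, mul_assoc, mul_inv_cancel₀ this, mul_one]
  · intro z hz
    funext i
    rcases i with i | k
    · exact congrFun (hr hz.1) i
    · have := ha0 _ (hψm hz.1)
      simp only [hartogsLift, Sum.elim_inr]
      have e : Sum.elim (ψ (z ∘ Sum.inl)) (fun k => z (Sum.inr k) * (a (ψ (z ∘ Sum.inl)))⁻¹) ∘
        Sum.inl = ψ (z ∘ Sum.inl) := rfl
      rw [e, mul_assoc, inv_mul_cancel₀ this, mul_one]

/-- The maps in `hartogsAut` are bundle maps that preserve `X`. -/
lemma exists_eqOn_hartogsLift {f : (κ ⊕ Fin N → ℂ) → κ ⊕ Fin N → ℂ}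
    (hf : f ∈ hartogsAut R h Φ N K) : ∃ z₀ ∈ R, ∃ φ ∈ Φ z₀, ∃ a : (κ → ℂ) → ℂ,
      DifferentiableOn ℂ a R ∧ (∀ Z ∈ R, a Z ≠ 0) ∧
      (∀ Z ∈ R, ‖a Z‖ ^ 2 * (h (φ Z) (φ Z)).re ^ (-(1 / K)) = (h Z Z).re ^ (-(1 / K))) ∧
      EqOn f (hartogsLift φ a) (hartogsDomain R h N K) := by
  obtain ⟨z₀, hz₀, φ, hφ, L, hL, hexp, hf⟩ := hf
  have h0 := H.pos z₀ hz₀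
  refine ⟨z₀, hz₀, φ, hφ, fun Z => (((h z₀ z₀).re ^ (1 / (2 * K)) : ℝ) : ℂ) *
    Complex.exp (-(L Z / K)), ?_, fun Z hZ => ?_, fun Z hZ => ?_, fun z hz => ?_⟩
  · simp only [div_eq_mul_inv]
    exact ((hL.mul_const _).neg.cexp).const_mul _
  · refine mul_ne_zero ?_ (Complex.exp_ne_zero _)
    exact_mod_cast (Real.rpow_pos_of_pos h0 _).ne'
  · have hr := H.pos Z hZ
    have hr' := H.pos _ ((H.automorphism z₀ hz₀ φ hφ).2.1 hZ)
    have hn : 0 < ‖h Z z₀‖ := norm_pos_iff.2 (H.ne_zero Z hZ z₀ hz₀)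
    have e1 : ‖Complex.exp (-(L Z / K))‖ = ‖h Z z₀‖ ^ (-(1 / K)) := by
      rw [← hexp Z hZ, Complex.norm_exp, Complex.norm_exp, ← Real.exp_mul]
      congr 1
      rw [Complex.neg_re, Complex.div_ofReal_re]
      ring
    have e2 : ∀ x : ℝ, 0 < x → (x ^ (-(1 / K))) ^ 2 = (x ^ 2) ^ (-(1 / K)) := fun x hx => by
      rw [← Real.rpow_natCast, ← Real.rpow_natCast, ← Real.rpow_mul hx.le, ← Real.rpow_mul hx.le,
        mul_comm]
    have e3 : ((h z₀ z₀).re ^ (1 / (2 * K))) ^ 2 * (h z₀ z₀).re ^ (-(1 / K)) = 1 := by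
      rw [← Real.rpow_natCast, ← Real.rpow_mul h0.le, ← Real.rpow_add h0]
      rw [show 1 / (2 * K) * ((2 : ℕ) : ℝ) + -(1 / K) = 0 by field_simp; ring, Real.rpow_zero]
    have e4 := congrArg (fun x : ℝ => x ^ (-(1 / K))) (H.re_transform hz₀ hφ hZ)
    rw [Real.mul_rpow hr'.le (by positivity), Real.mul_rpow hr.le h0.le, ← e2 _ hn] at e4
    rw [norm_mul, e1, Complex.norm_real, Real.norm_of_nonneg (Real.rpow_nonneg h0.le _), mul_pow]
    calc _ = ((h z₀ z₀).re ^ (1 / (2 * K))) ^ 2 * ((h (φ Z) (φ Z)).re ^ (-(1 / K)) *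
          (‖h Z z₀‖ ^ (-(1 / K))) ^ 2) := by ring
      _ = (h Z Z).re ^ (-(1 / K)) * (((h z₀ z₀).re ^ (1 / (2 * K))) ^ 2 *
          (h z₀ z₀).re ^ (-(1 / K))) := by rw [e4]; ring
      _ = _ := by rw [e3, mul_one]
  · obtain ⟨h1, h2⟩ := hf z hz
    funext i
    rcases i with i | k
    · exact congrFun h1 i
    · rw [h2 k, mul_assoc]; rfl

lemma isHolomorphicAutomorphism_of_mem_hartogsAut {f : (κ ⊕ Fin N → ℂ) → κ ⊕ Fin N → ℂ}
    (hf : f ∈ hartogsAut R h Φ N K) : IsHolomorphicAutomorphism f (hartogsDomain R h N K) := by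
  obtain ⟨z₀, hz₀, φ, hφ, a, ha, ha0, hX, he⟩ := H.exists_eqOn_hartogsLift hK hf
  exact (H.isHolomorphicAutomorphism_hartogsLift hK (H.automorphism z₀ hz₀ φ hφ) ha ha0 hX).congr he

lemma hartogsX_of_mem_hartogsAut {f : (κ ⊕ Fin N → ℂ) → κ ⊕ Fin N → ℂ}
    (hf : f ∈ hartogsAut R h Φ N K) {z : κ ⊕ Fin N → ℂ} (hz : z ∈ hartogsDomain R h N K) :
    hartogsX h K (f z) = hartogsX h K z := by
  obtain ⟨z₀, hz₀, φ, hφ, a, ha, ha0, hX, he⟩ := H.exists_eqOn_hartogsLift hK hf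
  rw [he hz, hartogsX_hartogsLift (hX _ hz.1)]

end IsHomogeneousDatum

end HartogsAutomorphism


/-! ### The potential of a Hartogs domain and its Levi form -/

section HartogsPotential

open Set Bornology

section Composition

variable {E F : Type*} [NormedAddCommGroup E] [NormedSpace ℂ E] [NormedSpace ℝ E]
  [IsScalarTower ℝ ℂ E] [NormedAddCommGroup F] [NormedSpace ℂ F] [NormedSpace ℝ F]
  [IsScalarTower ℝ ℂ F]

lemma leviForm_comp_clm (A : E →L[ℂ] F) {u : F → ℝ} {z : E} (hu : ContDiffAt ℝ 2 u (A z))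
    (v : E) : leviForm (fun x => u (A x)) z v = leviForm u (A z) (A v) := by
  have := leviForm_comp_holomorphic (f := A) (z := z) A.contDiff.contDiffAt hu v
  rwa [ContinuousLinearMap.fderiv] at this

lemma dbarSq_comp_clm (A : E →L[ℂ] F) {u : F → ℝ} {z : E} (hu : DifferentiableAt ℝ u (A z))
    (v : E) : dbarSq (fun x => u (A x)) z v = dbarSq u (A z) (A v) := by
  have := dbarSq_comp_holomorphic (f := A) (z := z) A.differentiableAt hu v
  rwa [ContinuousLinearMap.fderiv] at this

end Composition

section General

variable {E : Type*} [NormedAddCommGroup E] [NormedSpace ℂ E] [NormedSpace ℝ E]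

lemma dbarSq_add_of_fderiv_eq_zero {u w : E → ℝ} {z : E} (hu : DifferentiableAt ℝ u z)
    (hw : DifferentiableAt ℝ w z) (h0 : fderiv ℝ w z = 0) (v : E) :
    dbarSq (fun x => u x + w x) z v = dbarSq u z v := by
  unfold dbarSq
  rw [fderiv_fun_add hu hw, h0, add_zero]

lemma dbarSq_const_mul {u : E → ℝ} {z : E} (hu : DifferentiableAt ℝ u z) (c : ℝ) (v : E) :
    dbarSq (fun x => c * u x) z v = c ^ 2 * dbarSq u z v := by
  unfold dbarSq
  rw [fderiv_const_mul hu]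
  simp only [smul_apply, smul_eq_mul]
  ring

end General

/-- The quadratic form of the metric of the unit ball with potential `-log (1 - |z|²)`. -/
noncomputable def ballForm {ι : Type*} [Fintype ι] (z v : ι → ℂ) : ℝ :=
  coordNormSq v / (1 - coordNormSq z) + ‖∑ i, conj (z i) * v i‖ ^ 2 / (1 - coordNormSq z) ^ 2

lemma leviForm_log_one_sub_coordNormSq {ι : Type*} [Fintype ι] {z : ι → ℂ}
    (hz : coordNormSq z < 1) (v : ι → ℂ) :
    leviForm (fun z => Real.log (1 - coordNormSq z)) z v = -ballForm z v := by
  have hc : ContDiffAt ℝ 2 (coordNormSq : (ι → ℂ) → ℝ) z := contDiff_coordNormSq.contDiffAt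
  have hd : dbarSq (fun z => 1 - coordNormSq z) z v = ‖∑ i, conj (z i) * v i‖ ^ 2 := by
    rw [← dbarSq_coordNormSq]
    unfold dbarSq
    rw [fderiv_const_sub]
    simp
  rw [leviForm_log (contDiffAt_const.sub hc) (by linarith), leviForm_sub contDiffAt_const hc,
    leviForm_const, leviForm_coordNormSq, hd, ballForm]
  ring

variable {κ : Type*} {N : ℕ} [Fintype κ]

lemma coordNormSq_sum (v : κ ⊕ Fin N → ℂ) :
    coordNormSq v = coordNormSq (baseProj κ N v) + coordNormSq (fiberProj κ N v) := by
  simp only [coordNormSq, Fintype.sum_sum_type]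
  rfl

lemma ballForm_of_base_eq_zero {p : κ ⊕ Fin N → ℂ} (hp0 : p ∘ Sum.inl = 0)
    (v : κ ⊕ Fin N → ℂ) : ballForm p v =
    (coordNormSq (baseProj κ N v) + coordNormSq (fiberProj κ N v)) / (1 - fiberNormSq p) +
      ‖∑ k, conj (fiberProj κ N p k) * fiberProj κ N v k‖ ^ 2 / (1 - fiberNormSq p) ^ 2 := by
  have hp' : baseProj κ N p = 0 := hp0
  have h1 : coordNormSq p = fiberNormSq p := by
    rw [coordNormSq_sum, hp', coordNormSq_zero, zero_add, fiberNormSq_eq]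
  have h2 : ∀ i, p (Sum.inl i) = 0 := congrFun hp0
  rw [ballForm, h1, coordNormSq_sum v, Fintype.sum_sum_type]
  simp only [h2, map_zero, zero_mul, Finset.sum_const_zero, zero_add]
  rfl

namespace IsHomogeneousDatum

variable {R : Set (κ → ℂ)} {h : (κ → ℂ) → (κ → ℂ) → ℂ}
  {Φ : (κ → ℂ) → Set ((κ → ℂ) → κ → ℂ)} (H : IsHomogeneousDatum R h Φ)
  {c K l : ℝ}

include H

lemma contDiffAt_log_base {z : κ ⊕ Fin N → ℂ} (hz : z ∘ Sum.inl ∈ R) :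
    ContDiffAt ℝ ∞ (fun z : κ ⊕ Fin N → ℂ => Real.log (h (z ∘ Sum.inl) (z ∘ Sum.inl)).re) z :=
  ContDiffAt.comp (g := fun Z => Real.log (h Z Z).re) (f := baseProj κ N) z (H.contDiffAt_log hz)
    ((baseProj κ N).restrictScalars ℝ).contDiff.contDiffAt

lemma contDiffAt_rpow {Z : κ → ℂ} (hZ : Z ∈ R) (s : ℝ) :
    ContDiffAt ℝ ∞ (fun Z => (h Z Z).re ^ s) Z :=
  H.contDiff.contDiffAt.rpow_const_of_ne (H.pos Z hZ).ne'

lemma contDiffAt_hartogsX (K : ℝ) {z : κ ⊕ Fin N → ℂ} (hz : z ∘ Sum.inl ∈ R) :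
    ContDiffAt ℝ ∞ (hartogsX h K : (κ ⊕ Fin N → ℂ) → ℝ) z := by
  have h1 : ContDiffAt ℝ ∞ (fun z : κ ⊕ Fin N → ℂ =>
      (h (z ∘ Sum.inl) (z ∘ Sum.inl)).re ^ (-(1 / K))) z :=
    ContDiffAt.comp (g := fun Z => (h Z Z).re ^ (-(1 / K))) (f := baseProj κ N) z
      (H.contDiffAt_rpow hz _) ((baseProj κ N).restrictScalars ℝ).contDiff.contDiffAt
  have h2 : ContDiffAt ℝ ∞ (fun z : κ ⊕ Fin N → ℂ => coordNormSq (fiberProj κ N z)) z :=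
    contDiff_coordNormSq.contDiffAt.comp z
      ((fiberProj κ N).restrictScalars ℝ).contDiff.contDiffAt
  exact h2.mul h1

lemma leviForm_log_base_zero {p : κ ⊕ Fin N → ℂ} (hp : p ∘ Sum.inl = 0) (v : κ ⊕ Fin N → ℂ) :
    leviForm (fun z : κ ⊕ Fin N → ℂ => Real.log (h (z ∘ Sum.inl) (z ∘ Sum.inl)).re) p v =
      leviForm (fun Z => (h Z Z).re) 0 (baseProj κ N v) := by
  have hp' : baseProj κ N p = 0 := hp
  rw [← H.leviForm_log_zero, ← hp']
  refine leviForm_comp_clm (u := fun Z => Real.log (h Z Z).re) (baseProj κ N) ?_ v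
  rw [hp']
  exact (H.contDiffAt_log H.zero_mem).of_le (by norm_cast)

lemma fderiv_comp_base_eq_zero {p : κ ⊕ Fin N → ℂ} (hp : p ∘ Sum.inl = 0) {g : ℝ → ℝ}
    (hg : DifferentiableAt ℝ g 1) :
    fderiv ℝ (fun z : κ ⊕ Fin N → ℂ => g (h (z ∘ Sum.inl) (z ∘ Sum.inl)).re) p = 0 := by
  have h1 : HasFDerivAt (fun Z => (h Z Z).re) (0 : (κ → ℂ) →L[ℝ] ℝ) (baseProj κ N p) := by
    rw [baseProj_apply, hp, ← H.isLocalMax_zero.fderiv_eq_zero]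
    exact (H.contDiff.differentiable (by simp) 0).hasFDerivAt
  have h2 := h1.comp p ((baseProj κ N).restrictScalars ℝ).hasFDerivAt
  have h3 : HasDerivAt g (deriv g 1) (((fun Z => (h Z Z).re) ∘ (baseProj κ N)) p) := by
    simp only [Function.comp_apply, baseProj_apply, hp, H.apply_zero, Complex.one_re]
    exact hg.hasDerivAt
  have h4 := (h3.comp_hasFDerivAt p h2).fderiv
  rw [ContinuousLinearMap.zero_comp, smul_zero] at h4
  exact h4

lemma leviForm_rpow_zero (s : ℝ) (v : κ → ℂ) : leviForm (fun Z => (h Z Z).re ^ s) 0 v =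
    s * leviForm (fun Z => (h Z Z).re) 0 v := by
  have h1 : (h 0 0).re = 1 := by simp [H.apply_zero]
  rw [leviForm_real_comp (u := fun Z => (h Z Z).re) (g := fun x => x ^ s)
    (H.contDiff.of_le (by norm_cast)).contDiffAt
    (by rw [h1]; exact contDiffAt_id.rpow_const_of_ne one_ne_zero),
    dbarSq_eq_zero_of_isLocalExtr (Or.inr H.isLocalMax_zero), h1, Real.deriv_rpow_const]
  simp

variable (hK : 0 < K)
include hK

lemma isNhds {z : κ ⊕ Fin N → ℂ} (hz : z ∈ hartogsDomain R h N K) :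
    hartogsDomain R h N K ∈ 𝓝 z := (H.isOpen_hartogsDomain hK).mem_nhds hz

lemma one_sub_hartogsX_pos {z : κ ⊕ Fin N → ℂ} (hz : z ∈ hartogsDomain R h N K) :
    0 < 1 - hartogsX h K z := by
  have := ((H.mem_hartogsDomain_iff hK).1 hz).2
  linarith

lemma contDiffAt_log_one_sub_hartogsX {z : κ ⊕ Fin N → ℂ} (hz : z ∈ hartogsDomain R h N K) :
    ContDiffAt ℝ ∞ (fun z : κ ⊕ Fin N → ℂ => Real.log (1 - hartogsX h K z)) z :=
  (contDiffAt_const.sub (H.contDiffAt_hartogsX K hz.1)).log (H.one_sub_hartogsX_pos hK hz).ne'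

lemma hartogsPotential_eq {z : κ ⊕ Fin N → ℂ} (hz : z ∈ hartogsDomain R h N K) :
    hartogsPotential h c K l z = -l * Real.log (1 - hartogsX h K z) +
      -(c + N / K) * Real.log (h (z ∘ Sum.inl) (z ∘ Sum.inl)).re := by
  have h1 := H.one_sub_hartogsX_pos hK hz
  have h2 := H.pos _ hz.1
  rw [hartogsPotential, hartogsG, Real.log_mul (Real.rpow_pos_of_pos h1 _).ne'
    (Real.rpow_pos_of_pos h2 _).ne', Real.log_rpow h1, Real.log_rpow h2]

lemma hartogsPotential_eventuallyEq {z : κ ⊕ Fin N → ℂ} (hz : z ∈ hartogsDomain R h N K) :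
    hartogsPotential h c K l =ᶠ[𝓝 z] fun z => -l * Real.log (1 - hartogsX h K z) +
      -(c + N / K) * Real.log (h (z ∘ Sum.inl) (z ∘ Sum.inl)).re := by
  filter_upwards [H.isNhds hK hz] with x hx using H.hartogsPotential_eq hK hx

lemma contDiffAt_hartogsPotential {z : κ ⊕ Fin N → ℂ} (hz : z ∈ hartogsDomain R h N K) :
    ContDiffAt ℝ ∞ (hartogsPotential h c K l) z :=
  ((contDiffAt_const.mul (H.contDiffAt_log_one_sub_hartogsX hK hz)).add
    (contDiffAt_const.mul (H.contDiffAt_log_base hz.1))).congr_of_eventuallyEq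
      (H.hartogsPotential_eventuallyEq hK hz)

lemma leviForm_hartogsPotential {z : κ ⊕ Fin N → ℂ} (hz : z ∈ hartogsDomain R h N K)
    (v : κ ⊕ Fin N → ℂ) : leviForm (hartogsPotential h c K l) z v =
      -l * leviForm (fun z => Real.log (1 - hartogsX h K z)) z v +
      -(c + N / K) * leviForm (fun z => Real.log (h (z ∘ Sum.inl) (z ∘ Sum.inl)).re) z v := by
  have h1 := (H.contDiffAt_log_one_sub_hartogsX hK hz).of_le
    (show (2 : ℕ∞ω) ≤ ((⊤ : ℕ∞) : ℕ∞ω) by norm_cast)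
  have h2 := (H.contDiffAt_log_base hz.1).of_le
    (show (2 : ℕ∞ω) ≤ ((⊤ : ℕ∞) : ℕ∞ω) by norm_cast)
  rw [(H.hartogsPotential_eventuallyEq hK hz).leviForm_eq,
    leviForm_add (contDiffAt_const.mul h1) (contDiffAt_const.mul h2),
    leviForm_const_mul h1, leviForm_const_mul h2]

section Invariance

variable {f : (κ ⊕ Fin N → ℂ) → κ ⊕ Fin N → ℂ} (hf : f ∈ hartogsAut R h Φ N K)
  {z : κ ⊕ Fin N → ℂ} (hz : z ∈ hartogsDomain R h N K)
include hf hz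

lemma contDiffAt_of_mem_hartogsAut : ContDiffAt ℂ ∞ f z :=
  (contDiffOn_complex (H.isOpen_hartogsDomain hK)
    (H.isHolomorphicAutomorphism_of_mem_hartogsAut hK hf).1).contDiffAt (H.isNhds hK hz)

lemma log_one_sub_hartogsX_comp : (fun z => Real.log (1 - hartogsX h K (f z))) =ᶠ[𝓝 z]
    fun z => Real.log (1 - hartogsX h K z) := by
  filter_upwards [H.isNhds hK hz] with x hx
  rw [H.hartogsX_of_mem_hartogsAut hK hf hx]

lemma leviForm_log_one_sub_hartogsX_invariant (v : κ ⊕ Fin N → ℂ) :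
    leviForm (fun z => Real.log (1 - hartogsX h K z)) (f z) (fderiv ℂ f z v) =
      leviForm (fun z => Real.log (1 - hartogsX h K z)) z v := by
  have hfz := (H.isHolomorphicAutomorphism_of_mem_hartogsAut hK hf).2.1 hz
  rw [← (H.log_one_sub_hartogsX_comp hK hf hz).leviForm_eq]
  exact (leviForm_comp_holomorphic (u := fun z => Real.log (1 - hartogsX h K z))
    ((H.contDiffAt_of_mem_hartogsAut hK hf hz).of_le (by norm_cast))
    ((H.contDiffAt_log_one_sub_hartogsX hK hfz).of_le (by norm_cast)) v).symm

lemma dbarSq_log_one_sub_hartogsX_invariant (v : κ ⊕ Fin N → ℂ) :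
    dbarSq (fun z => Real.log (1 - hartogsX h K z)) (f z) (fderiv ℂ f z v) =
      dbarSq (fun z => Real.log (1 - hartogsX h K z)) z v := by
  have hfz := (H.isHolomorphicAutomorphism_of_mem_hartogsAut hK hf).2.1 hz
  rw [← (H.log_one_sub_hartogsX_comp hK hf hz).dbarSq_eq]
  exact (dbarSq_comp_holomorphic (u := fun z => Real.log (1 - hartogsX h K z))
    ((H.contDiffAt_of_mem_hartogsAut hK hf hz).differentiableAt (by simp))
    ((H.contDiffAt_log_one_sub_hartogsX hK hfz).differentiableAt (by simp)) v).symm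

lemma leviForm_log_base_invariant (v : κ ⊕ Fin N → ℂ) :
    leviForm (fun z => Real.log (h (z ∘ Sum.inl) (z ∘ Sum.inl)).re) (f z) (fderiv ℂ f z v) =
      leviForm (fun z => Real.log (h (z ∘ Sum.inl) (z ∘ Sum.inl)).re) z v := by
  have h2 : (2 : ℕ∞ω) ≤ ((⊤ : ℕ∞) : ℕ∞ω) := by norm_cast
  have hfz := (H.isHolomorphicAutomorphism_of_mem_hartogsAut hK hf).2.1 hz
  obtain ⟨z₀, hz₀, φ, hφ, a, -, -, -, he⟩ := H.exists_eqOn_hartogsLift hK hf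
  have hev : (fun z => Real.log (h (f z ∘ Sum.inl) (f z ∘ Sum.inl)).re) =ᶠ[𝓝 z] fun z =>
      (Real.log (h (z ∘ Sum.inl) (z ∘ Sum.inl)).re + Real.log (h z₀ z₀).re) -
        Real.log (‖h (baseProj κ N z) z₀‖ ^ 2) := by
    filter_upwards [H.isNhds hK hz] with x hx
    rw [he hx, hartogsLift_inl]
    exact H.log_transform hz₀ hφ hx.1
  have hc1 := (H.contDiffAt_log_base hz.1).of_le h2
  have hc2 := (H.contDiffAt_log_norm_sq hz₀ hz.1).of_le h2
  have hc3 : ContDiffAt ℝ 2 (fun z => Real.log (‖h (baseProj κ N z) z₀‖ ^ 2)) z :=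
    ContDiffAt.comp (g := fun Z => Real.log (‖h Z z₀‖ ^ 2)) (f := baseProj κ N) z hc2
      ((baseProj κ N).restrictScalars ℝ).contDiff.contDiffAt
  have hl := leviForm_comp_clm (u := fun Z => Real.log (‖h Z z₀‖ ^ 2)) (baseProj κ N) hc2 v
  rw [← leviForm_comp_holomorphic
    (u := fun z : κ ⊕ Fin N → ℂ => Real.log (h (z ∘ Sum.inl) (z ∘ Sum.inl)).re)
    ((H.contDiffAt_of_mem_hartogsAut hK hf hz).of_le h2)
    ((H.contDiffAt_log_base hfz.1).of_le h2), hev.leviForm_eq,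
    leviForm_sub (hc1.add contDiffAt_const) hc3,
    leviForm_add hc1 contDiffAt_const, leviForm_const, hl]
  rw [H.leviForm_log_norm_sq_eq_zero hz₀ (show baseProj κ N z ∈ R from hz.1)]
  ring

lemma leviForm_hartogsPotential_invariant (v : κ ⊕ Fin N → ℂ) :
    leviForm (hartogsPotential h c K l) (f z) (fderiv ℂ f z v) =
      leviForm (hartogsPotential h c K l) z v := by
  have hfz := (H.isHolomorphicAutomorphism_of_mem_hartogsAut hK hf).2.1 hz
  rw [H.leviForm_hartogsPotential hK hfz, H.leviForm_hartogsPotential hK hz,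
    H.leviForm_log_one_sub_hartogsX_invariant hK hf hz, H.leviForm_log_base_invariant hK hf hz]

end Invariance

section Center

variable {p : κ ⊕ Fin N → ℂ} (hp : p ∈ hartogsDomain R h N K)
include hp

lemma log_one_sub_hartogsX_eventuallyEq :
    (fun z : κ ⊕ Fin N → ℂ => Real.log (1 - hartogsX h K z)) =ᶠ[𝓝 p] fun z =>
      Real.log (-1 * coordNormSq (fiberProj κ N z) + (h (z ∘ Sum.inl) (z ∘ Sum.inl)).re ^ (1 / K)) +
        -(1 / K) * Real.log (h (z ∘ Sum.inl) (z ∘ Sum.inl)).re := by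
  filter_upwards [H.isNhds hK hp] with z hz
  have h1 := H.one_sub_hartogsX_pos hK hz
  have h2 := H.pos _ hz.1
  have h3 := Real.rpow_pos_of_pos h2 (1 / K)
  have h4 : -1 * coordNormSq (fiberProj κ N z) + (h (z ∘ Sum.inl) (z ∘ Sum.inl)).re ^ (1 / K) =
      (1 - hartogsX h K z) * (h (z ∘ Sum.inl) (z ∘ Sum.inl)).re ^ (1 / K) := by
    rw [hartogsX, Real.rpow_neg h2.le, fiberNormSq_eq]
    field_simp
    ring
  rw [h4, Real.log_mul h1.ne' h3.ne', Real.log_rpow h2]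
  ring

variable (hp0 : p ∘ Sum.inl = 0)
include hp0

/-- At a point `(0, W)`, with `ρ = 1 - |W|²` and with `v` and `w` the components of the tangent
vector, the form of `-log (1 - X)` is `(q(v)/K + |w|²)/ρ + |⟨w, W⟩|²/ρ² - q(v)/K`, where `q` is the
form of `-h(z, z)` at the origin; the differential comes from the fibre only. -/
lemma leviForm_log_one_sub_hartogsX_zero (v : κ ⊕ Fin N → ℂ) :
    leviForm (fun z => Real.log (1 - hartogsX h K z)) p v =
      (1 / K * leviForm (fun Z => (h Z Z).re) 0 (baseProj κ N v) -
        coordNormSq (fiberProj κ N v)) / (1 - fiberNormSq p) -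
      ‖∑ k, conj (fiberProj κ N p k) * fiberProj κ N v k‖ ^ 2 / (1 - fiberNormSq p) ^ 2 -
      1 / K * leviForm (fun Z => (h Z Z).re) 0 (baseProj κ N v) ∧
    dbarSq (fun z => Real.log (1 - hartogsX h K z)) p v =
      ‖∑ k, conj (fiberProj κ N p k) * fiberProj κ N v k‖ ^ 2 / (1 - fiberNormSq p) ^ 2 := by
  have h2 : (2 : ℕ∞ω) ≤ ((⊤ : ℕ∞) : ℕ∞ω) := by norm_cast
  have hρ : 0 < 1 - fiberNormSq p := by linarith [H.fiberNormSq_lt_one hK hp]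
  have hp' : baseProj κ N p = 0 := hp0
  have hF : ContDiffAt ℝ 2 (fun z : κ ⊕ Fin N → ℂ => coordNormSq (fiberProj κ N z)) p :=
    contDiff_coordNormSq.contDiffAt.comp p ((fiberProj κ N).restrictScalars ℝ).contDiff.contDiffAt
  have hF' : ContDiffAt ℝ 2 (fun z : κ ⊕ Fin N → ℂ => -1 * coordNormSq (fiberProj κ N z)) p :=
    contDiffAt_const.mul hF
  have hg0 : ContDiffAt ℝ 2 (fun Z => (h Z Z).re ^ (1 / K)) (baseProj κ N p) :=
    (H.contDiffAt_rpow (show baseProj κ N p ∈ R from hp.1) _).of_le h2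
  have hg : ContDiffAt ℝ 2
      (fun z : κ ⊕ Fin N → ℂ => (h (z ∘ Sum.inl) (z ∘ Sum.inl)).re ^ (1 / K)) p :=
    ContDiffAt.comp (g := fun Z => (h Z Z).re ^ (1 / K)) (f := baseProj κ N) p hg0
      ((baseProj κ N).restrictScalars ℝ).contDiff.contDiffAt
  have hl : ContDiffAt ℝ 2
      (fun z : κ ⊕ Fin N → ℂ => Real.log (h (z ∘ Sum.inl) (z ∘ Sum.inl)).re) p :=
    (H.contDiffAt_log_base hp.1).of_le h2
  have hval : -1 * coordNormSq (fiberProj κ N p) + (h (p ∘ Sum.inl) (p ∘ Sum.inl)).re ^ (1 / K) =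
      1 - fiberNormSq p := by
    rw [hp0, H.apply_zero, fiberNormSq_eq]
    simp
    ring
  have hP := hF'.add hg
  have hPlog := hP.log (by rw [hval]; exact hρ.ne')
  have hdF : dbarSq (fun z : κ ⊕ Fin N → ℂ => -1 * coordNormSq (fiberProj κ N z) +
      (h (z ∘ Sum.inl) (z ∘ Sum.inl)).re ^ (1 / K)) p v =
      ‖∑ k, conj (fiberProj κ N p k) * fiberProj κ N v k‖ ^ 2 := by
    rw [dbarSq_add_of_fderiv_eq_zero (hF'.differentiableAt (by norm_num))
      (hg.differentiableAt (by norm_num))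
      (H.fderiv_comp_base_eq_zero (g := fun x => x ^ (1 / K)) hp0
        (by exact differentiableAt_id.rpow_const (Or.inl one_ne_zero))),
      dbarSq_const_mul (hF.differentiableAt (by norm_num)),
      dbarSq_comp_clm _ (contDiff_coordNormSq.differentiable (n := 1) (by norm_num) _),
      dbarSq_coordNormSq]
    ring
  have hev := H.log_one_sub_hartogsX_eventuallyEq hK hp
  constructor
  · rw [hev.leviForm_eq, leviForm_add hPlog (contDiffAt_const.mul hl), leviForm_const_mul hl,
      H.leviForm_log_base_zero hp0, leviForm_log hP (by rw [hval]; exact hρ.ne'), hdF, hval,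
      leviForm_add hF' hg, leviForm_const_mul hF,
      leviForm_comp_clm _ contDiff_coordNormSq.contDiffAt, leviForm_coordNormSq]
    have := leviForm_comp_clm (u := fun Z => (h Z Z).re ^ (1 / K)) (baseProj κ N) hg0 v
    rw [hp', H.leviForm_rpow_zero] at this
    simp only [baseProj_apply] at this ⊢
    rw [this]
    ring
  · rw [hev.dbarSq_eq, dbarSq_add_of_fderiv_eq_zero (hPlog.differentiableAt (by norm_num))
      ((contDiffAt_const.mul hl).differentiableAt (by norm_num))
      (H.fderiv_comp_base_eq_zero (g := fun x => -(1 / K) * Real.log x) hp0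
        (by exact (Real.differentiableAt_log one_ne_zero).const_mul _)),
      dbarSq_real_comp (g := Real.log) (hP.differentiableAt (by norm_num))
        (Real.differentiableAt_log (by rw [hval]; exact hρ.ne')), hdF, hval, Real.deriv_log]
    field_simp

end Center

end IsHomogeneousDatum

end HartogsPotential


/-! ### Comparison with the Bergman metric -/

section Comparison

open Set Bornology

lemma one_sub_rpow_le {s t : ℝ} (hs : 0 < s) (h0 : 0 ≤ t) (h1 : t ≤ 1) :
    (1 - t) ^ s ≤ 1 - min 1 s * t := by
  rcases le_total 1 s with h | h
  · rw [min_eq_left h, one_mul]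
    exact (Real.rpow_le_rpow_of_exponent_ge' (by linarith) (by linarith) zero_le_one h).trans
      (by rw [Real.rpow_one])
  · rw [min_eq_right h]
    have := rpow_one_add_le_one_add_mul_self (s := -t) (by linarith) (p := s) hs.le h
    rw [← sub_eq_add_neg] at this
    linarith

lemma leviForm_log_ball {ι : Type*} [Fintype ι] {p : ι → ℂ} (hp : coordNormSq p < 1) (v : ι → ℂ) :
    -leviForm (fun z : ι → ℂ => Real.log ((1 : ℂ) - ∑ i, z i * conj (z i)).re) p v =
      ballForm p v := by
  have : (fun z : ι → ℂ => Real.log ((1 : ℂ) - ∑ i, z i * conj (z i)).re) =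
      fun z => Real.log (1 - coordNormSq z) := by
    ext z
    simp [coordNormSq, Complex.mul_conj, Complex.normSq_eq_norm_sq, -Complex.ofReal_pow]
  rw [this, leviForm_log_one_sub_coordNormSq hp, neg_neg]

lemma ballForm_nonneg {ι : Type*} [Fintype ι] {z : ι → ℂ} (hz : coordNormSq z < 1) (v : ι → ℂ) :
    0 ≤ ballForm z v := by
  have h1 : 0 < 1 - coordNormSq z := by linarith
  have h2 := coordNormSq_nonneg v
  unfold ballForm
  positivity

lemma coordNormSq_le_ballForm {ι : Type*} [Fintype ι] {z : ι → ℂ} (hz : coordNormSq z < 1)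
    (v : ι → ℂ) : coordNormSq v ≤ ballForm z v := by
  have h1 : 0 < 1 - coordNormSq z := by linarith
  have h2 := coordNormSq_nonneg v
  have h3 : coordNormSq v ≤ coordNormSq v / (1 - coordNormSq z) := by
    rw [le_div_iff₀ h1]
    nlinarith [coordNormSq_nonneg z]
  unfold ballForm
  have : 0 ≤ ‖∑ i, conj (z i) * v i‖ ^ 2 / (1 - coordNormSq z) ^ 2 := by positivity
  linarith

section Bergman

variable {ι : Type*} [Fintype ι]

/-- Monotonicity of the Bergman metric, made quantitative: if `D₁` and `D₂` are mapped into each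
other by linear maps fixing `p`, the quotient of the two kernels at `p` is controlled by the
determinants. -/
lemma leviForm_bergmanLog_le_of_clm {D₁ D₂ : Set (ι → ℂ)} (h₁ : IsOpen D₁) (h₂ : IsOpen D₂)
    (hb₁ : IsBounded D₁) (hb₂ : IsBounded D₂) {S T : (ι → ℂ) →L[ℂ] ι → ℂ}
    (hS : MapsTo S D₁ D₂) (hT : MapsTo T D₂ D₁) (hSd : S.det ≠ 0) (hTd : T.det ≠ 0)
    (hSi : Function.Injective S) (hTi : Function.Injective T)
    {p : ι → ℂ} (hp₁ : p ∈ D₁) (hp₂ : p ∈ D₂) (hSp : S p = p) (hTp : T p = p) (v : ι → ℂ) :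
    (‖S.det‖ * ‖T.det‖) ^ 2 * leviForm (bergmanLog D₂) p (S v) ≤ leviForm (bergmanLog D₁) p v := by
  have k1 := det_mul_norm_bergmanEval_le h₂ h₁ T.differentiableOn hT hTi.injOn hp₂
  have k2 := det_mul_leviForm_bergmanLog_le h₁ h₂ hb₁ hb₂ S.differentiableOn hS hSi.injOn hp₁
    (by simpa using hSd) v
  rw [ContinuousLinearMap.fderiv, hTp] at k1
  rw [ContinuousLinearMap.fderiv, hSp] at k2
  have hK : 0 < ‖bergmanEval D₁ p‖ := norm_pos_iff.2 (bergmanEval_ne_zero h₁ hb₁ hp₁)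
  have hpos : 0 ≤ leviForm (bergmanLog D₂) p (S v) := by
    rcases eq_or_ne (S v) 0 with h | h
    · rw [h]; simp [leviForm]
    · exact (leviForm_bergmanLog_pos h₂ hb₂ hp₂ h).le
  refine le_of_mul_le_mul_right (le_trans ?_ k2) (by positivity : 0 < ‖bergmanEval D₁ p‖ ^ 2)
  calc _ = ‖S.det‖ ^ 2 * (leviForm (bergmanLog D₂) p (S v) *
        (‖T.det‖ * ‖bergmanEval D₁ p‖) ^ 2) := by ring
    _ ≤ _ := by gcongr

lemma isEquivalentToBergman_of_leviForm [DecidableEq ι] {D : Set (ι → ℂ)} (hD : IsOpen D)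
    (hb : IsBounded D) {u : (ι → ℂ) → ℝ} (hu : ∀ z ∈ D, ContDiffAt ℝ 2 u z) {A B : ℝ} (hA : 0 < A)
    (hB : 0 < B) (h : ∀ z ∈ D, ∀ v, leviForm (bergmanLog D) z v ≤ A * leviForm u z v ∧
      leviForm u z v ≤ B * leviForm (bergmanLog D) z v) : IsEquivalentToBergman u D := by
  refine ⟨exists_isBergmanKernel hD, fun k hk => ?_⟩
  have heq := hk.eqOn_bergmanLog hD
  have hev : ∀ z ∈ D, bergmanPotential k =ᶠ[𝓝 z] bergmanLog D := fun z hz => by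
    filter_upwards [hD.mem_nhds hz] with x hx using heq hx
  have hk2 : ∀ z ∈ D, ContDiffAt ℝ 2 (bergmanPotential k) z := fun z hz =>
    ((contDiffAt_bergmanLog hD hb hz).of_le (by norm_cast)).congr_of_eventuallyEq (hev z hz)
  refine ⟨⟨fun z hz => (((contDiffAt_bergmanLog hD hb hz).congr_of_eventuallyEq
    (hev z hz))).contDiffWithinAt, fun z hz => metricMatrix_posDef_of_leviForm_pos (hk2 z hz)
      fun v hv => ?_⟩, √A, (√B)⁻¹, by positivity, by positivity, fun z hz v => ?_⟩
  · rw [(hev z hz).leviForm_eq]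
    exact leviForm_bergmanLog_pos hD hb hz hv
  · rw [metricLength_eq_sqrt (hk2 z hz), metricLength_eq_sqrt (hu z hz), (hev z hz).leviForm_eq]
    obtain ⟨h1, h2⟩ := h z hz v
    refine ⟨?_, ?_⟩
    · rw [inv_mul_le_iff₀ (by positivity), ← Real.sqrt_mul hB.le]
      exact Real.sqrt_le_sqrt h2
    · rw [← Real.sqrt_mul hA.le]
      exact Real.sqrt_le_sqrt h1

end Bergman

variable {κ : Type*} {N : ℕ}

/-- The map `(Z, W) ↦ (s Z, W)`. -/
noncomputable def scaleBase (κ : Type*) (N : ℕ) (s : ℝ) :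
    (κ ⊕ Fin N → ℂ) →L[ℂ] (κ ⊕ Fin N → ℂ) :=
  ContinuousLinearMap.pi (Sum.elim (fun i => (s : ℂ) • ContinuousLinearMap.proj (Sum.inl i))
    fun k => ContinuousLinearMap.proj (Sum.inr k))

section Scale

variable (s : ℝ) (z : κ ⊕ Fin N → ℂ)

lemma baseProj_scaleBase : baseProj κ N (scaleBase κ N s z) = s • baseProj κ N z := by
  ext i; simp [baseProj, scaleBase]

lemma fiberProj_scaleBase : fiberProj κ N (scaleBase κ N s z) = fiberProj κ N z := rfl

lemma scaleBase_inv (hs : s ≠ 0) : scaleBase κ N s (scaleBase κ N s⁻¹ z) = z := by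
  funext i
  rcases i with i | k
  · have : (s : ℂ) ≠ 0 := by exact_mod_cast hs
    simp [scaleBase, this]
  · rfl

lemma scaleBase_of_base_eq_zero (hz : z ∘ Sum.inl = 0) : scaleBase κ N s z = z := by
  funext i
  rcases i with i | k
  · have : z (Sum.inl i) = 0 := congrFun hz i
    simp [scaleBase, this]
  · rfl

lemma scaleBase_injective {s : ℝ} (hs : s ≠ 0) : Function.Injective (scaleBase κ N s) := by
  have := scaleBase_inv (κ := κ) (N := N) s⁻¹ (hs := inv_ne_zero hs)
  rw [inv_inv] at this
  exact Function.LeftInverse.injective this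

lemma det_scaleBase_ne_zero {s : ℝ} (hs : s ≠ 0) : (scaleBase κ N s).det ≠ 0 := by
  have h1 : (scaleBase κ N s).comp (scaleBase κ N s⁻¹) = ContinuousLinearMap.id ℂ _ := by
    ext z i
    exact congrFun (scaleBase_inv s _ hs) i
  have h2 := congrArg ContinuousLinearMap.det h1
  have h3 : (scaleBase κ N s).det * (scaleBase κ N s⁻¹).det = 1 := by
    simpa [ContinuousLinearMap.det] using h2
  exact left_ne_zero_of_mul_eq_one h3

lemma ballForm_scaleBase_le [Fintype κ] {p : κ ⊕ Fin N → ℂ} (hp0 : p ∘ Sum.inl = 0) (hp : fiberNormSq p < 1)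
    (v : κ ⊕ Fin N → ℂ) : ballForm p (scaleBase κ N s v) ≤ (1 + s ^ 2) * ballForm p v := by
  have hρ : 0 < 1 - fiberNormSq p := by linarith
  rw [ballForm_of_base_eq_zero hp0, ballForm_of_base_eq_zero hp0, baseProj_scaleBase,
    fiberProj_scaleBase, coordNormSq_smul]
  have h1 := coordNormSq_nonneg (baseProj κ N v)
  have h2 := coordNormSq_nonneg (fiberProj κ N v)
  set S := ‖∑ k, conj (fiberProj κ N p k) * fiberProj κ N v k‖ ^ 2 / (1 - fiberNormSq p) ^ 2
  have h3 : 0 ≤ S := by positivity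
  rw [mul_add, mul_div_assoc']
  refine add_le_add ?_ (by nlinarith [sq_nonneg s])
  gcongr
  nlinarith [mul_nonneg (sq_nonneg s) h2]

end Scale

variable [Fintype κ]

namespace IsHomogeneousDatum

variable {R : Set (κ → ℂ)} {h : (κ → ℂ) → (κ → ℂ) → ℂ}
  {Φ : (κ → ℂ) → Set ((κ → ℂ) → κ → ℂ)} (H : IsHomogeneousDatum R h Φ)
  {c K l : ℝ}

include H

/-- Bounded holomorphic functions are Lipschitz for the invariant metric: by homogeneity this is
the Cauchy estimate at the origin. -/
lemma exists_norm_fderiv_sq_le : ∃ C > 0, ∀ (F : (κ → ℂ) → ℂ) (M : ℝ), DifferentiableOn ℂ F R →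
    (∀ z ∈ R, ‖F z‖ ≤ M) → ∀ z ∈ R, ∀ v, ‖fderiv ℂ F z v‖ ^ 2 ≤
      C * M ^ 2 * -leviForm (fun z => Real.log (h z z).re) z v := by
  obtain ⟨c, hc, C, -, hb⟩ := H.exists_leviForm_zero_bounds
  obtain ⟨r, hr, hrR⟩ := Metric.isOpen_iff.1 H.isOpen 0 H.zero_mem
  refine ⟨4 / r ^ 2 / c, by positivity, fun F M hF hM z hz v => ?_⟩
  obtain ⟨φ, hφ⟩ := H.nonempty z hz
  have haut := H.automorphism z hz φ hφ
  obtain ⟨g, hg, hgf, -⟩ := haut.exists_inverse H.isOpen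
  have h0 := H.map_self z hz φ hφ
  have hG : DifferentiableOn ℂ (F ∘ g) R := hF.comp hg.1 hg.2.1
  have hφz := haut.1.differentiableAt (H.isOpen.mem_nhds hz)
  have hcomp : fderiv ℂ F z v = fderiv ℂ (F ∘ g) 0 (fderiv ℂ φ z v) := by
    have h1 : F =ᶠ[𝓝 z] (F ∘ g) ∘ φ := by
      filter_upwards [H.isOpen.mem_nhds hz] with x hx
      simp [hgf x hx]
    rw [h1.fderiv_eq, fderiv_comp z (by
      rw [h0]; exact hG.differentiableAt (H.isOpen.mem_nhds H.zero_mem)) hφz, h0]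
    rfl
  have h1 := norm_fderiv_le_of_norm_le hr (hG.mono hrR) fun x hx => hM _ (hg.2.1 (hrR hx))
  have h2 : ‖fderiv ℂ F z v‖ ≤ 2 * M / r * ‖fderiv ℂ φ z v‖ := by
    rw [hcomp]
    exact ContinuousLinearMap.le_of_opNorm_le _ h1 _
  have h3 := norm_sq_le_coordNormSq (fderiv ℂ φ z v)
  have h4 := (hb (fderiv ℂ φ z v)).1
  rw [← H.leviForm_log_zero, ← h0, H.leviForm_log_invariant hz hφ hz] at h4
  calc ‖fderiv ℂ F z v‖ ^ 2 ≤ (2 * M / r * ‖fderiv ℂ φ z v‖) ^ 2 := by gcongr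
    _ = 4 / r ^ 2 / c * M ^ 2 * (c * ‖fderiv ℂ φ z v‖ ^ 2) := by field_simp; ring
    _ ≤ _ := by
      gcongr
      exact (mul_le_mul_of_nonneg_left h3 hc.le).trans h4

variable (hK : 0 < K) (hl : 0 < l) (hc : 0 < c + N / K)
include hK

lemma coordNormSq_lt_one {p : κ ⊕ Fin N → ℂ} (hp : p ∈ hartogsDomain R h N K)
    (hp0 : p ∘ Sum.inl = 0) : coordNormSq p < 1 := by
  have hp' : baseProj κ N p = 0 := hp0
  have := H.fiberNormSq_lt_one hK hp
  rwa [coordNormSq_sum, hp', coordNormSq_zero, zero_add, ← fiberNormSq_eq]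

/-- Scaling of the base maps the unit ball into the Hartogs domain. -/
lemma exists_scaleBase_mapsTo_hartogsDomain : ∃ s : ℝ, 0 < s ∧
    MapsTo (scaleBase κ N s) {z | coordNormSq z < 1} (hartogsDomain R h N K) := by
  obtain ⟨C, hC, hlow⟩ := H.lower
  set m := min 1 K
  have hm : 0 < m := lt_min one_pos hK
  refine ⟨√(m / C), by positivity, fun z hz => ?_⟩
  change coordNormSq z < 1 at hz
  rw [coordNormSq_sum] at hz
  have h1 := coordNormSq_nonneg (baseProj κ N z)
  have h2 := coordNormSq_nonneg (fiberProj κ N z)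
  set t := coordNormSq (baseProj κ N z) with ht
  have ht1 : t < 1 := by linarith
  have h3 : C * coordNormSq (baseProj κ N (scaleBase κ N √(m / C) z)) = m * t := by
    rw [baseProj_scaleBase, coordNormSq_smul, Real.sq_sqrt (by positivity)]
    field_simp
    rfl
  have hmt : m * t < 1 := by
    have : m ≤ 1 := min_le_left _ _
    nlinarith
  obtain ⟨h4, h5⟩ := hlow (baseProj κ N (scaleBase κ N √(m / C) z)) (by rw [h3]; exact hmt)
  refine ⟨h4, ?_⟩
  rw [h3] at h5
  refine lt_of_lt_of_le ?_ h5
  refine lt_of_lt_of_le ?_ (one_sub_rpow_le hK h1 ht1.le)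
  refine Real.rpow_lt_rpow (fiberNormSq_nonneg _) ?_ hK
  rw [fiberNormSq_eq, fiberProj_scaleBase]
  linarith

/-- Scaling of the base maps the Hartogs domain into the unit ball. -/
lemma exists_scaleBase_mapsTo_ball : ∃ s : ℝ, 0 < s ∧
    MapsTo (scaleBase κ N s) (hartogsDomain R h N K) {z | coordNormSq z < 1} := by
  obtain ⟨b, hb, hup⟩ := H.upper
  set m := min 1 (1 / K)
  have hm : 0 < m := lt_min one_pos (by positivity)
  refine ⟨√(m * b), by positivity, fun z hz => ?_⟩
  have h1 := hup _ hz.1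
  have h2 := H.pos _ hz.1
  have h3 := coordNormSq_nonneg (z ∘ Sum.inl)
  change coordNormSq (scaleBase κ N √(m * b) z) < 1
  rw [coordNormSq_sum, baseProj_scaleBase, fiberProj_scaleBase, coordNormSq_smul,
    Real.sq_sqrt (by positivity), baseProj_apply, ← fiberNormSq_eq]
  have h4 : fiberNormSq z < (h (z ∘ Sum.inl) (z ∘ Sum.inl)).re ^ (1 / K) := by
    rw [one_div, Real.lt_rpow_inv_iff_of_pos (fiberNormSq_nonneg z) h2.le hK]
    exact hz.2
  have h5 : (h (z ∘ Sum.inl) (z ∘ Sum.inl)).re ^ (1 / K) ≤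
      (1 - b * coordNormSq (z ∘ Sum.inl)) ^ (1 / K) :=
    Real.rpow_le_rpow h2.le h1 (by positivity)
  have h6 := one_sub_rpow_le (s := 1 / K) (t := b * coordNormSq (z ∘ Sum.inl)) (by positivity)
    (by positivity) (by linarith)
  linarith [mul_assoc m b (coordNormSq (z ∘ Sum.inl))]

lemma isInvariantMetricOn_hartogsPotential [DecidableEq κ] :
    IsInvariantMetricOn (hartogsPotential h c K l) (hartogsDomain R h N K)
      (hartogsAut R h Φ N K) := by
  intro f hf
  have haut := H.isHolomorphicAutomorphism_of_mem_hartogsAut hK hf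
  refine ⟨haut, fun z hz v => ?_⟩
  rw [metricLength_eq_sqrt ((H.contDiffAt_hartogsPotential hK (haut.2.1 hz)).of_le (by norm_cast)),
    metricLength_eq_sqrt ((H.contDiffAt_hartogsPotential hK hz).of_le (by norm_cast)),
    H.leviForm_hartogsPotential_invariant hK hf hz]

include hl hc

/-- At the points `(0, W)` the metric is comparable with that of the unit ball. -/
lemma exists_ballForm_bounds : ∃ A > 0, ∃ B > 0, ∀ p ∈ hartogsDomain R h N K, p ∘ Sum.inl = 0 →
    ∀ v, leviForm (hartogsPotential h c K l) p v ≤ A * ballForm p v ∧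
      ballForm p v ≤ B * leviForm (hartogsPotential h c K l) p v ∧
      dbarSq (fun z => Real.log (1 - hartogsX h K z)) p v ≤ A * ballForm p v ∧
      -leviForm (fun z => Real.log (h (z ∘ Sum.inl) (z ∘ Sum.inl)).re) p v ≤
        A * ballForm p v := by
  obtain ⟨c₀, hc₀, C₀, hC₀, hb⟩ := H.exists_leviForm_zero_bounds
  set a := c + N / K with ha
  set m := min (l / K) a with hm
  have hm0 : 0 < m := lt_min (by positivity) hc
  set m' := min l (c₀ * m) with hm'
  have hm'0 : 0 < m' := lt_min hl (by positivity)
  have hD : 0 < C₀ * (l / K + a) := by positivity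
  obtain ⟨A, hA, hAl, hAD, hAC, hA1⟩ : ∃ A > 0, l ≤ A ∧ C₀ * (l / K + a) ≤ A ∧ C₀ ≤ A ∧ 1 ≤ A :=
    ⟨l + C₀ * (l / K + a) + C₀ + 1, by positivity, by linarith, by linarith, by linarith,
      by linarith⟩
  refine ⟨A, hA, 1 / m', by positivity,
    fun p hp hp0 v => ?_⟩
  obtain ⟨e1, e2⟩ := H.leviForm_log_one_sub_hartogsX_zero hK hp hp0 v
  have e3 := H.leviForm_log_base_zero hp0 v
  have hρ : 0 < 1 - fiberNormSq p := by linarith [H.fiberNormSq_lt_one hK hp]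
  have hρ1 : 1 - fiberNormSq p ≤ 1 := by linarith [fiberNormSq_nonneg p]
  rw [H.leviForm_hartogsPotential hK hp, e1, e2, e3, ballForm_of_base_eq_zero hp0, ← ha]
  obtain ⟨b1, b2⟩ := hb (baseProj κ N v)
  set q := leviForm (fun Z => (h Z Z).re) 0 (baseProj κ N v) with hq
  have h1 := coordNormSq_nonneg (baseProj κ N v)
  have h2 := coordNormSq_nonneg (fiberProj κ N v)
  set n₁ := coordNormSq (baseProj κ N v)
  set n₂ := coordNormSq (fiberProj κ N v)
  set ρ := 1 - fiberNormSq p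
  set S := ‖∑ k, conj (fiberProj κ N p k) * fiberProj κ N v k‖ ^ 2 / ρ ^ 2
  have hS : 0 ≤ S := by positivity
  have hn₁ : 0 ≤ n₁ / ρ := by positivity
  have hn₂ : 0 ≤ n₂ / ρ := by positivity
  have hn₁' : n₁ ≤ n₁ / ρ := by rw [le_div_iff₀ hρ]; nlinarith
  have hlK : 0 < l / K := by positivity
  have hinv : 1 ≤ 1 / ρ := by rw [le_div_iff₀ hρ]; linarith
  -- the coefficient of the base form lies between `m / ρ` and `(l / K + a) / ρ`
  have hlev : -l * ((1 / K * q - n₂) / ρ - S - 1 / K * q) + -a * q =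
      l * (n₂ / ρ) + l * S + (l / K * (1 / ρ - 1) + a) * -q := by
    field_simp
    ring
  have hq0 : 0 ≤ -q := le_trans (by positivity) b1
  have hco1 : m * (1 / ρ) ≤ l / K * (1 / ρ - 1) + a := by
    have u1 : m ≤ l / K := min_le_left _ _
    have u2 : m ≤ a := min_le_right _ _
    nlinarith
  have hco2 : l / K * (1 / ρ - 1) + a ≤ (l / K + a) * (1 / ρ) := by nlinarith
  have hdiv : (n₁ + n₂) / ρ = n₁ / ρ + n₂ / ρ := add_div _ _ _
  have hAx : 0 ≤ A * (n₁ / ρ) := by positivity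
  have hAy : 0 ≤ A * (n₂ / ρ) := by positivity
  have hAS : 0 ≤ A * S := by positivity
  rw [hlev, hdiv]
  refine ⟨?_, ?_, ?_, ?_⟩
  · have h3 : (l / K * (1 / ρ - 1) + a) * -q ≤ C₀ * (l / K + a) * (n₁ / ρ) := by
      calc _ ≤ ((l / K + a) * (1 / ρ)) * (C₀ * n₁) := by gcongr
        _ = _ := by ring
    linarith [mul_le_mul_of_nonneg_right hAD hn₁, mul_le_mul_of_nonneg_right hAl hn₂,
      mul_le_mul_of_nonneg_right hAl hS]
  · rw [one_div_mul_eq_div, le_div_iff₀ hm'0]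
    have h3 : c₀ * m * (n₁ / ρ) ≤ (l / K * (1 / ρ - 1) + a) * -q := by
      calc _ = (m * (1 / ρ)) * (c₀ * n₁) := by ring
        _ ≤ _ := by
          have : 0 ≤ l / K * (1 / ρ - 1) + a := le_trans (by positivity) hco1
          gcongr
    have u1 : m' ≤ l := min_le_left _ _
    have u2 : m' ≤ c₀ * m := min_le_right _ _
    linarith [mul_le_mul_of_nonneg_right u1 hn₂, mul_le_mul_of_nonneg_right u1 hS,
      mul_le_mul_of_nonneg_right u2 hn₁]
  · linarith [mul_le_mul_of_nonneg_right hA1 hS]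
  · have h3 : -q ≤ C₀ * (n₁ / ρ) := b2.trans (by gcongr)
    linarith [mul_le_mul_of_nonneg_right hAC hn₁]

lemma leviForm_hartogsPotential_pos {z : κ ⊕ Fin N → ℂ} (hz : z ∈ hartogsDomain R h N K)
    {v : κ ⊕ Fin N → ℂ} (hv : v ≠ 0) : 0 < leviForm (hartogsPotential h c K l) z v := by
  obtain ⟨A, -, B, hB, hAB⟩ := H.exists_ballForm_bounds hK hl hc
  obtain ⟨f, hf, hf0⟩ := H.exists_mem_hartogsAut hz
  have haut := H.isHolomorphicAutomorphism_of_mem_hartogsAut hK hf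
  have hfz := haut.2.1 hz
  rw [← H.leviForm_hartogsPotential_invariant hK hf hz]
  have h1 := (hAB _ hfz hf0 (fderiv ℂ f z v)).2.1
  have h2 := coordNormSq_le_ballForm (H.coordNormSq_lt_one hK hfz hf0) (fderiv ℂ f z v)
  have h3 := coordNormSq_pos (haut.fderiv_ne_zero (H.isOpen_hartogsDomain hK) hz hv)
  exact pos_of_mul_pos_right (h3.trans_le (h2.trans h1)) hB.le

lemma isKahlerPotentialOn_hartogsPotential [DecidableEq κ] :
    IsKahlerPotentialOn (hartogsPotential h c K l) (hartogsDomain R h N K) :=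
  ⟨fun _ hz => (H.contDiffAt_hartogsPotential hK hz).contDiffWithinAt, fun _ hz =>
    metricMatrix_posDef_of_leviForm_pos
      ((H.contDiffAt_hartogsPotential hK hz).of_le (by norm_cast))
      fun _ hv => H.leviForm_hartogsPotential_pos hK hl hc hz hv⟩

section Ball

variable {Φ' : (κ ⊕ Fin N → ℂ) → Set ((κ ⊕ Fin N → ℂ) → κ ⊕ Fin N → ℂ)}
  (HB : IsHomogeneousDatum {z : κ ⊕ Fin N → ℂ | coordNormSq z < 1}
    (fun z w => 1 - ∑ i, z i * conj (w i)) Φ')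
include HB

/-- The Bergman metric and the metric with potential `log G` are equivalent: both are invariant,
and at the points `(0, W)` both are comparable with the metric of the unit ball. -/
lemma isEquivalentToBergman_hartogsPotential [DecidableEq κ] :
    IsEquivalentToBergman (hartogsPotential h c K l) (hartogsDomain R h N K) := by
  have hY := H.isOpen_hartogsDomain (N := N) hK
  have hYb := H.isBounded_hartogsDomain (N := N) hK
  obtain ⟨A, hA, B, hB, hAB⟩ := H.exists_ballForm_bounds hK hl hc
  obtain ⟨a, ha, b, hb, hab⟩ := HB.exists_leviForm_bergmanLog_bounds
  obtain ⟨s, hs, hsm⟩ := H.exists_scaleBase_mapsTo_hartogsDomain (N := N) hK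
  obtain ⟨t, ht, htm⟩ := H.exists_scaleBase_mapsTo_ball (N := N) hK
  have hsd := det_scaleBase_ne_zero (κ := κ) (N := N) hs.ne'
  have htd := det_scaleBase_ne_zero (κ := κ) (N := N) ht.ne'
  set J := (‖(scaleBase κ N s).det‖ * ‖(scaleBase κ N t).det‖) ^ 2 with hJ
  have hJ0 : 0 < J := by
    have h1 := norm_pos_iff.2 hsd
    have h2 := norm_pos_iff.2 htd
    positivity
  refine isEquivalentToBergman_of_leviForm hY hYb
    (A := a * (1 + (s⁻¹) ^ 2) * B / J) (B := A * ((1 + (t⁻¹) ^ 2) * b) / J)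
    (fun z hz => (H.contDiffAt_hartogsPotential hK hz).of_le (by norm_cast)) (by positivity)
    (by positivity) fun z hz v => ?_
  obtain ⟨f, hf, hf0⟩ := H.exists_mem_hartogsAut hz
  have haut := H.isHolomorphicAutomorphism_of_mem_hartogsAut hK hf
  have hfz := haut.2.1 hz
  -- both forms may be compared at the point `p = (0, W)` instead
  rw [← H.leviForm_hartogsPotential_invariant hK hf hz, ← haut.leviForm_bergmanLog hY hYb hz]
  set p := f z
  set w := fderiv ℂ f z v
  have hp1 := H.coordNormSq_lt_one hK hfz hf0
  have hF1 := H.fiberNormSq_lt_one hK hfz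
  obtain ⟨b1, b2, -, -⟩ := hAB p hfz hf0 w
  have hsp := scaleBase_of_base_eq_zero s p hf0
  have htp := scaleBase_of_base_eq_zero t p hf0
  have k1 := leviForm_bergmanLog_le_of_clm HB.isOpen hY HB.isBounded hYb hsm htm hsd htd
    (scaleBase_injective hs.ne') (scaleBase_injective ht.ne') hp1 hfz hsp htp
    (scaleBase κ N s⁻¹ w)
  have k2 := leviForm_bergmanLog_le_of_clm hY HB.isOpen hYb HB.isBounded htm hsm htd hsd
    (scaleBase_injective ht.ne') (scaleBase_injective hs.ne') hfz hp1 htp hsp w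
  rw [scaleBase_inv s w hs.ne', ← hJ] at k1
  rw [mul_comm ‖(scaleBase κ N t).det‖, ← hJ] at k2
  have m1 := (hab p hp1 (scaleBase κ N s⁻¹ w)).1
  have m2 := (hab p hp1 (scaleBase κ N t w)).2
  rw [leviForm_log_ball hp1] at m1 m2
  have n1 := ballForm_scaleBase_le s⁻¹ hf0 hF1 w
  have n2 := ballForm_scaleBase_le t⁻¹ hf0 hF1 (scaleBase κ N t w)
  have := scaleBase_inv (κ := κ) (N := N) t⁻¹ w (inv_ne_zero ht.ne')
  rw [inv_inv] at this
  rw [this] at n2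
  constructor
  · rw [div_mul_eq_mul_div, le_div_iff₀ hJ0, mul_comm]
    calc _ ≤ a * ((1 + s⁻¹ ^ 2) * ballForm p w) :=
          k1.trans (m1.trans (mul_le_mul_of_nonneg_left n1 ha.le))
      _ ≤ a * ((1 + s⁻¹ ^ 2) * (B * leviForm (hartogsPotential h c K l) p w)) := by gcongr
      _ = _ := by ring
  · rw [div_mul_eq_mul_div, le_div_iff₀ hJ0]
    calc _ ≤ A * ballForm p w * J := by gcongr
      _ ≤ A * ((1 + t⁻¹ ^ 2) * (b * leviForm (bergmanLog {z | coordNormSq z < 1}) p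
            (scaleBase κ N t w))) * J := by
          gcongr
          exact n2.trans (by gcongr)
      _ = A * ((1 + t⁻¹ ^ 2) * b) * (J * leviForm (bergmanLog {z | coordNormSq z < 1}) p
            (scaleBase κ N t w)) := by ring
      _ ≤ _ := by gcongr

end Ball

end IsHomogeneousDatum

end Comparison


/-! ### Completeness -/

section Completeness

open Set Bornology Filter

section Criterion

variable {ι : Type*} [Fintype ι] [DecidableEq ι] {u : (ι → ℂ) → ℝ} {D : Set (ι → ℂ)}

/-- A function whose differential is bounded by `C` times the metric is `C`-Lipschitz for the
distance of the metric. -/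
lemma enorm_sub_le_mul_metricEDist {F : Type*} [NormedAddCommGroup F] [NormedSpace ℝ F]
    (hD : IsOpen D) {Ψ : (ι → ℂ) → F} (hΨ : ContDiffOn ℝ 1 Ψ D) {C : ℝ} (hC : 0 < C)
    (hle : ∀ z ∈ D, ∀ v, ‖fderiv ℝ Ψ z v‖ ≤ C * metricLength u z v) (z w : ι → ℂ) :
    ‖Ψ w - Ψ z‖ₑ ≤ ENNReal.ofReal C * metricEDist u D z w := by
  have hC0 : ENNReal.ofReal C ≠ 0 := by simpa using hC
  rw [mul_comm, ← ENNReal.div_le_iff_le_mul (Or.inl hC0) (Or.inl ENNReal.ofReal_ne_top)]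
  refine le_iInf fun γ => le_iInf fun hγ => le_iInf fun hm => le_iInf fun h0 => le_iInf fun h1 => ?_
  rw [ENNReal.div_le_iff_le_mul (Or.inl hC0) (Or.inl ENNReal.ofReal_ne_top), mul_comm,
    ← MeasureTheory.lintegral_const_mul' _ _ ENNReal.ofReal_ne_top, ← h0, ← h1]
  refine (enorm_sub_le_lintegral_derivWithin_Icc_of_contDiffOn_Icc (hΨ.comp hγ hm)
    zero_le_one).trans ?_
  refine MeasureTheory.setLIntegral_mono' measurableSet_Icc fun t ht => ?_
  have hγt := ((hγ.differentiableOn (by norm_num)) t ht).hasDerivWithinAt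
  have hΨt := ((hΨ.differentiableOn (by norm_num)).differentiableAt
    (hD.mem_nhds (hm ht))).hasFDerivAt
  have hd := (hΨt.comp_hasDerivWithinAt t hγt).derivWithin
    (uniqueDiffOn_Icc_zero_one t ht)
  rw [hd, ← ENNReal.ofReal_mul hC.le, ← ofReal_norm]
  exact ENNReal.ofReal_le_ofReal (hle _ (hm ht) _)

/-- Locally the distance of a metric is bounded by a multiple of the euclidean distance. -/
lemma exists_metricEDist_le (hD : IsOpen D) (hu : ∀ z ∈ D, ContDiffAt ℝ 2 u z) {z : ι → ℂ}
    (hz : z ∈ D) : ∃ C : ℝ, ∀ᶠ x in 𝓝 z, metricEDist u D x z ≤ ENNReal.ofReal (C * ‖z - x‖) := by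
  have hcont : ContinuousAt (fun x => ‖fderiv ℝ (fderiv ℝ u) x‖) z := by
    have h1 : ContDiffAt ℝ 1 (fderiv ℝ u) z := (hu z hz).fderiv_right (by norm_num)
    have h2 : ContDiffAt ℝ 0 (fderiv ℝ (fderiv ℝ u)) z := h1.fderiv_right (by norm_num)
    exact (continuous_norm (E := (ι → ℂ) →L[ℝ] (ι → ℂ) →L[ℝ] ℝ)).continuousAt.comp h2.continuousAt
  set M := ‖fderiv ℝ (fderiv ℝ u) z‖ + 1 with hM
  have hev := (hcont.eventually_lt_const (show _ < M by simp [hM])).and (hD.mem_nhds hz)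
  obtain ⟨r, hr, hball⟩ := Metric.eventually_nhds_iff_ball.1 hev
  refine ⟨√M, Metric.eventually_nhds_iff_ball.2 ⟨r, hr, fun x hx => ?_⟩⟩
  have hseg : ∀ t ∈ Icc (0 : ℝ) 1, x + t • (z - x) ∈ Metric.ball z r := fun t ht =>
    (convex_ball z r).add_smul_sub_mem hx (Metric.mem_ball_self hr) ht
  have hγ : ContDiff ℝ 1 fun t : ℝ => x + t • (z - x) := by fun_prop
  have hlen : metricEDist u D x z ≤ ∫⁻ t in Icc (0 : ℝ) 1, ENNReal.ofReal
      (metricLength u (x + t • (z - x))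
        (derivWithin (fun t : ℝ => x + t • (z - x)) (Icc 0 1) t)) := by
    unfold metricEDist
    exact iInf_le_of_le (fun t : ℝ => x + t • (z - x)) (iInf_le_of_le hγ.contDiffOn
      (iInf_le_of_le (fun t ht => (hball _ (hseg t ht)).2) (iInf_le_of_le (by simp)
        (iInf_le_of_le (by simp) le_rfl))))
  refine hlen.trans ?_
  have hbound : ∀ t ∈ Icc (0 : ℝ) 1, ENNReal.ofReal (metricLength u (x + t • (z - x))
      (derivWithin (fun t : ℝ => x + t • (z - x)) (Icc 0 1) t)) ≤
      ENNReal.ofReal (√M * ‖z - x‖) := by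
    intro t ht
    have hd : HasDerivAt (fun t : ℝ => x + t • (z - x)) (z - x) t := by
      simpa using ((hasDerivAt_id t).smul_const (z - x)).const_add x
    rw [hd.hasDerivWithinAt.derivWithin (uniqueDiffOn_Icc_zero_one t ht)]
    obtain ⟨h1, h2⟩ := hball _ (hseg t ht)
    refine ENNReal.ofReal_le_ofReal ?_
    rw [metricLength_eq_sqrt (hu _ h2)]
    refine Real.sqrt_le_iff.2 ⟨by positivity, ?_⟩
    rw [mul_pow, Real.sq_sqrt (by positivity)]
    set T := fderiv ℝ (fderiv ℝ u) (x + t • (z - x))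
    have h3 : ∀ w, T w w ≤ M * ‖w‖ ^ 2 := fun w => by
      calc T w w ≤ ‖T w w‖ := le_abs_self _
        _ ≤ ‖T‖ * ‖w‖ * ‖w‖ := T.le_opNorm₂ w w
        _ = ‖T‖ * ‖w‖ ^ 2 := by ring
        _ ≤ _ := by gcongr
    have h4 := h3 (z - x)
    have h5 := h3 (Complex.I • (z - x))
    rw [norm_smul, Complex.norm_I, one_mul] at h5
    have h6 : 0 ≤ M * ‖z - x‖ ^ 2 := by positivity
    unfold leviForm
    linarith
  refine (MeasureTheory.setLIntegral_mono' measurableSet_Icc hbound).trans ?_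
  simp

/-- A metric is complete if it dominates a multiple of the euclidean metric and the differential of
a function whose sublevel sets are closed. -/
lemma isCompleteMetricOn_of_exhaustion (hD : IsOpen D) (hu : ∀ z ∈ D, ContDiffAt ℝ 2 u z)
    {Ψ : (ι → ℂ) → ℝ} (hΨ : ContDiffOn ℝ 1 Ψ D) {C : ℝ} (hC : 0 < C)
    (hle : ∀ z ∈ D, ∀ v, ‖fderiv ℝ Ψ z v‖ ≤ C * metricLength u z v)
    (heu : ∀ z ∈ D, ∀ v, ‖v‖ ≤ C * metricLength u z v)
    (hcl : ∀ M, closure {z ∈ D | Ψ z ≤ M} ⊆ D) : IsCompleteMetricOn u D := by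
  intro s hs hcauchy
  have hlip := enorm_sub_le_mul_metricEDist hD hΨ hC hle
  have hlip' : ∀ z w, ‖w - z‖ₑ ≤ ENNReal.ofReal C * metricEDist u D z w :=
    enorm_sub_le_mul_metricEDist hD contDiffOn_id hC (by simpa using heu)
  obtain ⟨M₀, hM₀⟩ := hcauchy 1 one_pos
  -- `Ψ` is Lipschitz, so the tail of the sequence lies in a sublevel set
  have hbd : ∀ k ≥ M₀, s k ∈ {z ∈ D | Ψ z ≤ Ψ (s M₀) + C} := by
    intro k hk
    refine ⟨hs k, ?_⟩
    have h1 := (hlip (s M₀) (s k)).trans (mul_le_mul_right (hM₀ M₀ le_rfl k hk).le _)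
    rw [mul_one, ← ofReal_norm, ENNReal.ofReal_le_ofReal_iff hC.le] at h1
    linarith [le_abs_self (Ψ (s k) - Ψ (s M₀)), Real.norm_eq_abs (Ψ (s k) - Ψ (s M₀))]
  have hcs : CauchySeq s := by
    refine EMetric.cauchySeq_iff.2 fun ε hε => ?_
    obtain ⟨M, hM⟩ := hcauchy (ε / ENNReal.ofReal C)
      (ENNReal.div_pos hε.ne' ENNReal.ofReal_ne_top)
    refine ⟨M, fun j hj k hk => ?_⟩
    rw [edist_eq_enorm_sub]
    refine (hlip' (s k) (s j)).trans_lt ?_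
    rw [mul_comm]
    exact (ENNReal.lt_div_iff_mul_lt (Or.inl (by simpa using hC))
      (Or.inl ENNReal.ofReal_ne_top)).1 (hM k hk j hj)
  obtain ⟨z, hz⟩ := cauchySeq_tendsto_of_complete hcs
  have hzD : z ∈ D := hcl _ (mem_closure_of_tendsto hz (eventually_atTop.2 ⟨M₀, hbd⟩))
  refine ⟨z, hzD, ?_⟩
  obtain ⟨C', hC'⟩ := exists_metricEDist_le hD hu hzD
  have hlim : Tendsto (fun k => ENNReal.ofReal (C' * ‖z - s k‖)) atTop (𝓝 0) := by
    have h1 : Tendsto (fun k => C' * ‖z - s k‖) atTop (𝓝 (C' * ‖z - z‖)) :=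
      (tendsto_const_nhds.sub hz).norm.const_mul C'
    rw [sub_self, norm_zero, mul_zero] at h1
    simpa using ENNReal.tendsto_ofReal h1
  exact tendsto_of_tendsto_of_tendsto_of_le_of_le' tendsto_const_nhds hlim
    (Eventually.of_forall fun _ => zero_le) (hz.eventually hC')

end Criterion

lemma fderiv_sq_le_dbarSq {E : Type*} [NormedAddCommGroup E] [NormedSpace ℂ E] [NormedSpace ℝ E]
    (u : E → ℝ) (z v : E) : (fderiv ℝ u z v) ^ 2 ≤ 4 * dbarSq u z v := by
  unfold dbarSq
  nlinarith [sq_nonneg (fderiv ℝ u z (Complex.I • v))]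

variable {κ : Type*} {N : ℕ} [Fintype κ]

namespace IsHomogeneousDatum

variable {R : Set (κ → ℂ)} {h : (κ → ℂ) → (κ → ℂ) → ℂ}
  {Φ : (κ → ℂ) → Set ((κ → ℂ) → κ → ℂ)} (H : IsHomogeneousDatum R h Φ)
  {c K l : ℝ}

include H

/-- The differential of `log h(z, z)` is bounded in the invariant metric. For `φ ∈ Φ z₀` and
`Ψ(z) = h(φ z, φ 0) = h(z₀, z₀) / h(z, z₀)` the function
`log h(z, z) + log |Ψ(z)|² = log h(φ z, φ z) + log h(z₀, z₀)` is maximal at `z₀`, where `Ψ` has the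
value `1`; so at `z₀` the differential is that of `-2 Re Ψ`, with `Ψ` bounded independently of
`z₀`. -/
lemma exists_fderiv_log_sq_le : ∃ C > 0, ∀ z ∈ R, ∀ v,
    (fderiv ℝ (fun z => Real.log (h z z).re) z v) ^ 2 ≤
      C * -leviForm (fun z => Real.log (h z z).re) z v := by
  obtain ⟨C, hC, hF⟩ := H.exists_norm_fderiv_sq_le
  obtain ⟨M, hM⟩ := H.bounded
  refine ⟨4 * (C * (M ^ 2 + 1)), by positivity, fun z₀ hz₀ v => ?_⟩
  obtain ⟨φ, hφ⟩ := H.nonempty z₀ hz₀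
  have haut := H.automorphism z₀ hz₀ φ hφ
  set Ψ : (κ → ℂ) → ℂ := fun z => h (φ z) (φ 0) with hΨ
  have hΨd : DifferentiableOn ℂ Ψ R :=
    (H.differentiable (φ 0)).differentiableOn.comp haut.1 (mapsTo_univ _ _)
  have hΨ0 : Ψ z₀ = 1 := by rw [hΨ]; simp only; rw [H.map_self z₀ hz₀ φ hφ, H.zero_apply]
  have hnhds := H.isOpen.mem_nhds hz₀
  have h1 := hF Ψ M hΨd (fun z hz => hM _ (haut.2.1 hz) _ (haut.2.1 H.zero_mem)) z₀ hz₀ v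
  have hΨ' : HasFDerivAt Ψ ((fderiv ℂ Ψ z₀).restrictScalars ℝ) z₀ :=
    (hΨd.differentiableAt hnhds).hasFDerivAt.restrictScalars ℝ
  have hlogΨ := (hΨ'.norm_sq).log (by simp [hΨ0])
  have hlog : HasFDerivAt (fun z => Real.log (h z z).re)
      (fderiv ℝ (fun z => Real.log (h z z).re) z₀) z₀ :=
    ((H.contDiffAt_log hz₀).differentiableAt (by simp)).hasFDerivAt
  have hmax : IsLocalMax (fun z => Real.log (h z z).re + Real.log (‖Ψ z‖ ^ 2)) z₀ := by
    obtain ⟨b, hb, hup⟩ := H.upper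
    have key : ∀ z ∈ R, Real.log (h z z).re + Real.log (‖Ψ z‖ ^ 2) =
        Real.log (h (φ z) (φ z)).re + Real.log (h z₀ z₀).re := fun z hz => by
      have e1 := congrArg norm (H.transform_zero hz₀ hφ hz)
      rw [norm_mul] at e1
      have e2 : ‖h z₀ z₀‖ = (h z₀ z₀).re := by
        rw [← H.ofReal_re_self z₀, Complex.norm_real, Complex.ofReal_re,
          Real.norm_of_nonneg (H.pos _ hz₀).le]
      have e3 : ‖h z z₀‖ ≠ 0 := norm_ne_zero_iff.2 (H.ne_zero z hz z₀ hz₀)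
      have e4 : ‖Ψ z‖ ≠ 0 := left_ne_zero_of_mul (a := ‖Ψ z‖) (b := ‖h z z₀‖)
        (by rw [e1, e2]; exact (H.pos _ hz₀).ne')
      have e5 := congrArg Real.log (e1.trans e2)
      rw [Real.log_mul e4 e3] at e5
      rw [H.log_transform hz₀ hφ hz, Real.log_pow, Real.log_pow, ← e5]
      push_cast
      ring
    filter_upwards [hnhds] with z hz
    rw [key z hz, key z₀ hz₀, H.map_self z₀ hz₀ φ hφ, H.apply_zero]
    have h2 := haut.2.1 hz
    have h3 := hup _ h2
    have h4 := Real.log_nonpos (H.pos _ h2).le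
      (by nlinarith [coordNormSq_nonneg (φ z)])
    simpa using h4
  have hzero := hmax.hasFDerivAt_eq_zero (hlog.add hlogΨ)
  have hv := DFunLike.congr_fun hzero v
  simp only [hΨ0, add_apply, smul_apply, norm_one, one_pow, inv_one, one_smul,
    ContinuousLinearMap.comp_apply, innerSL_apply_apply] at hv
  have hre : |fderiv ℝ (fun z => Real.log (h z z).re) z₀ v| ≤ 2 * ‖fderiv ℂ Ψ z₀ v‖ := by
    have e : fderiv ℝ (fun z => Real.log (h z z).re) z₀ v = -2 * (fderiv ℂ Ψ z₀ v).re := by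
      simp [Complex.inner] at hv
      linarith
    rw [e, abs_mul]
    norm_num
    exact Complex.abs_re_le_norm _
  have hlev : 0 ≤ -leviForm (fun z => Real.log (h z z).re) z₀ v := by
    obtain ⟨a, ha, b, -, hab⟩ := H.exists_leviForm_bergmanLog_bounds
    have := (hab z₀ hz₀ v).1
    rcases eq_or_ne v 0 with rfl | hv0
    · simp [leviForm]
    · have h5 := leviForm_bergmanLog_pos H.isOpen H.isBounded hz₀ hv0
      by_contra! hneg
      nlinarith
  calc _ = |fderiv ℝ (fun z => Real.log (h z z).re) z₀ v| ^ 2 := (sq_abs _).symm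
    _ ≤ (2 * ‖fderiv ℂ Ψ z₀ v‖) ^ 2 := by gcongr
    _ = 4 * ‖fderiv ℂ Ψ z₀ v‖ ^ 2 := by ring
    _ ≤ 4 * (C * M ^ 2 * -leviForm (fun z => Real.log (h z z).re) z₀ v) := by gcongr
    _ ≤ 4 * (C * (M ^ 2 + 1) * -leviForm (fun z => Real.log (h z z).re) z₀ v) := by
      gcongr; linarith
    _ = _ := by ring

variable (hK : 0 < K) (hl : 0 < l) (hc : 0 < c + N / K)
include hK

/-- The function `-log (1 - X) - log h(Z, Z)` has closed sublevel sets. -/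
lemma closure_sublevel_subset (M : ℝ) :
    closure {z ∈ hartogsDomain R h N K | -Real.log (1 - hartogsX h K z) -
      Real.log (h (z ∘ Sum.inl) (z ∘ Sum.inl)).re ≤ M} ⊆ hartogsDomain R h N K := by
  set S := {z ∈ hartogsDomain R h N K | -Real.log (1 - hartogsX h K z) -
      Real.log (h (z ∘ Sum.inl) (z ∘ Sum.inl)).re ≤ M} with hS
  have hsub : ∀ z ∈ S, z ∘ Sum.inl ∈ R ∧ Real.exp (-M) ≤ (h (z ∘ Sum.inl) (z ∘ Sum.inl)).re ∧
      hartogsX h K z ≤ 1 - Real.exp (-M) := by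
    rintro z ⟨hz, hzM⟩
    obtain ⟨b, hb, hup⟩ := H.upper
    have h1 := H.one_sub_hartogsX_pos hK hz
    have h2 := H.pos _ hz.1
    have h3 : Real.log (1 - hartogsX h K z) ≤ 0 :=
      Real.log_nonpos h1.le (by linarith [hartogsX_nonneg K h2])
    have h4 : Real.log (h (z ∘ Sum.inl) (z ∘ Sum.inl)).re ≤ 0 :=
      Real.log_nonpos h2.le (by nlinarith [hup _ hz.1, coordNormSq_nonneg (z ∘ Sum.inl)])
    refine ⟨hz.1, (Real.le_log_iff_exp_le h2).1 (by linarith), ?_⟩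
    have := (Real.le_log_iff_exp_le h1).1 (show -M ≤ _ by linarith)
    linarith
  intro z hz
  have hpos := Real.exp_pos (-M)
  have hcl : z ∘ Sum.inl ∈ closure R :=
    map_mem_closure (f := baseProj κ N) (baseProj κ N).continuous hz fun x hx => (hsub x hx).1
  have hcont : Continuous fun z : κ ⊕ Fin N → ℂ => (h (z ∘ Sum.inl) (z ∘ Sum.inl)).re :=
    H.contDiff.continuous.comp (baseProj κ N).continuous
  have h1 : Real.exp (-M) ≤ (h (z ∘ Sum.inl) (z ∘ Sum.inl)).re :=
    closure_minimal (fun x hx => (hsub x hx).2.1) (isClosed_le continuous_const hcont) hz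
  have hzR := H.mem_of_mem_closure _ hcl (hpos.trans_le h1)
  refine (H.mem_hartogsDomain_iff hK).2 ⟨hzR, ?_⟩
  have h2 : hartogsX h K z ∈ closure (Iic (1 - Real.exp (-M))) :=
    (H.contDiffAt_hartogsX K hzR).continuousAt.continuousWithinAt.mem_closure hz
      fun x hx => (hsub x hx).2.2
  rw [isClosed_Iic.closure_eq] at h2
  exact lt_of_le_of_lt h2 (by linarith)

include hl hc

lemma exists_invariant_bounds : ∃ B > 0, ∀ z ∈ hartogsDomain R h N K, ∀ v,
    dbarSq (fun z => Real.log (1 - hartogsX h K z)) z v ≤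
      B * leviForm (hartogsPotential h c K l) z v ∧
    -leviForm (fun z => Real.log (h (z ∘ Sum.inl) (z ∘ Sum.inl)).re) z v ≤
      B * leviForm (hartogsPotential h c K l) z v := by
  obtain ⟨A, hA, B, hB, hAB⟩ := H.exists_ballForm_bounds hK hl hc
  refine ⟨A * B, by positivity, fun z hz v => ?_⟩
  obtain ⟨f, hf, hf0⟩ := H.exists_mem_hartogsAut hz
  have hfz := (H.isHolomorphicAutomorphism_of_mem_hartogsAut hK hf).2.1 hz
  obtain ⟨-, h2, h3, h4⟩ := hAB _ hfz hf0 (fderiv ℂ f z v)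
  rw [H.dbarSq_log_one_sub_hartogsX_invariant hK hf hz] at h3
  rw [H.leviForm_log_base_invariant hK hf hz] at h4
  rw [H.leviForm_hartogsPotential_invariant hK hf hz] at h2
  have h5 := mul_le_mul_of_nonneg_left h2 hA.le
  rw [← mul_assoc] at h5
  exact ⟨h3.trans h5, h4.trans h5⟩

section Ball

variable {Φ' : (κ ⊕ Fin N → ℂ) → Set ((κ ⊕ Fin N → ℂ) → κ ⊕ Fin N → ℂ)}
  (HB : IsHomogeneousDatum {z : κ ⊕ Fin N → ℂ | coordNormSq z < 1}
    (fun z w => 1 - ∑ i, z i * conj (w i)) Φ')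
include HB

/-- The metric dominates the euclidean metric: the coordinates of the inverse of the map that moves
`z` to `(0, W)` are bounded holomorphic functions, also on the unit ball rescaled into the domain,
and at `(0, W)` the metric is comparable with that of the ball. -/
lemma exists_norm_sq_le_leviForm : ∃ B > 0, ∀ z ∈ hartogsDomain R h N K, ∀ v,
    ‖v‖ ^ 2 ≤ B * leviForm (hartogsPotential h c K l) z v := by
  have hY := H.isOpen_hartogsDomain (N := N) hK
  obtain ⟨A, -, B, hB, hAB⟩ := H.exists_ballForm_bounds hK hl hc
  obtain ⟨s, hs, hsm⟩ := H.exists_scaleBase_mapsTo_hartogsDomain (N := N) hK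
  obtain ⟨C, hC, hF⟩ := HB.exists_norm_fderiv_sq_le
  obtain ⟨M, hM⟩ := (H.isBounded_hartogsDomain (N := N) hK).exists_norm_le
  refine ⟨C * (M ^ 2 + 1) * (1 + (s⁻¹) ^ 2) * B, by positivity, fun z hz v => ?_⟩
  obtain ⟨f, hf, hf0⟩ := H.exists_mem_hartogsAut hz
  have haut := H.isHolomorphicAutomorphism_of_mem_hartogsAut hK hf
  have hfz := haut.2.1 hz
  obtain ⟨g, hg, hgf, hcomp⟩ := haut.exists_inverse hY
  set p := f z with hp
  set w := fderiv ℂ f z v with hw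
  have hp1 := H.coordNormSq_lt_one hK hfz hf0
  have hF1 := H.fiberNormSq_lt_one hK hfz
  have hsp := scaleBase_of_base_eq_zero s p hf0
  have hnn : 0 ≤ ballForm p (scaleBase κ N s⁻¹ w) := ballForm_nonneg hp1 _
  -- Cauchy's estimate on the ball for the coordinates of `g`, where `g` is the inverse of `f`
  have hcoord : ∀ i, ‖v i‖ ^ 2 ≤ C * (M ^ 2 + 1) * ballForm p (scaleBase κ N s⁻¹ w) := by
    intro i
    have hd : DifferentiableOn ℂ (fun x => g (scaleBase κ N s x) i) {z | coordNormSq z < 1} :=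
      (differentiableOn_pi.1 hg.1 i).comp (scaleBase κ N s).differentiableOn hsm
    have h1 := hF (fun x => g (scaleBase κ N s x) i) M hd
      (fun x hx => (norm_le_pi_norm _ i).trans (hM _ (hg.2.1 (hsm hx)))) p hp1
      (scaleBase κ N s⁻¹ w)
    rw [leviForm_log_ball hp1] at h1
    have hgd : HasFDerivAt g (fderiv ℂ g p) (scaleBase κ N s p) := by
      rw [hsp]; exact (hg.1.differentiableAt (hY.mem_nhds hfz)).hasFDerivAt
    have h2 := ((hasFDerivAt_pi'.1 (hgd.comp p (scaleBase κ N s).hasFDerivAt)) i).fderiv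
    have h3 : fderiv ℂ (fun x => g (scaleBase κ N s x) i) p (scaleBase κ N s⁻¹ w) = v i := by
      have e1 := DFunLike.congr_fun h2 (scaleBase κ N s⁻¹ w)
      refine e1.trans ?_
      have e2 : fderiv ℂ g p (scaleBase κ N s (scaleBase κ N s⁻¹ w)) = v := by
        rw [scaleBase_inv s w hs.ne']
        exact DFunLike.congr_fun (hcomp z hz) v
      exact congrFun e2 i
    rw [h3] at h1
    refine h1.trans ?_
    gcongr
    linarith
  have hv : ‖v‖ ^ 2 ≤ C * (M ^ 2 + 1) * ballForm p (scaleBase κ N s⁻¹ w) := by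
    refine (Real.le_sqrt (norm_nonneg _) (by positivity)).1 ?_
    exact (pi_norm_le_iff_of_nonneg (Real.sqrt_nonneg _)).2 fun i =>
      Real.le_sqrt_of_sq_le (hcoord i)
  have h4 := ballForm_scaleBase_le s⁻¹ hf0 hF1 w
  have h5 := (hAB p hfz hf0 w).2.1
  rw [hw, hp, H.leviForm_hartogsPotential_invariant hK hf hz, ← hw, ← hp] at h5
  calc ‖v‖ ^ 2 ≤ C * (M ^ 2 + 1) * ((1 + s⁻¹ ^ 2) *
        (B * leviForm (hartogsPotential h c K l) z v)) := by
        refine hv.trans ?_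
        gcongr
        exact h4.trans (by gcongr)
    _ = _ := by ring

lemma isCompleteMetricOn_hartogsPotential [DecidableEq κ] :
    IsCompleteMetricOn (hartogsPotential h c K l) (hartogsDomain R h N K) := by
  have hY := H.isOpen_hartogsDomain (N := N) hK
  have hu : ∀ z ∈ hartogsDomain R h N K, ContDiffAt ℝ 2 (hartogsPotential h c K l) z :=
    fun z hz => (H.contDiffAt_hartogsPotential hK hz).of_le (by norm_cast)
  obtain ⟨B₁, hB₁, hb₁⟩ := H.exists_invariant_bounds (N := N) hK hl hc
  obtain ⟨B₂, hB₂, hb₂⟩ := H.exists_norm_sq_le_leviForm hK hl hc HB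
  obtain ⟨B₃, hB₃, hb₃⟩ := H.exists_fderiv_log_sq_le
  have hX : ∀ z ∈ hartogsDomain R h N K, ContDiffAt ℝ ∞
      (fun z : κ ⊕ Fin N → ℂ => Real.log (1 - hartogsX h K z)) z := fun z hz =>
    H.contDiffAt_log_one_sub_hartogsX hK hz
  have hL : ∀ z ∈ hartogsDomain R h N K, ContDiffAt ℝ ∞
      (fun z : κ ⊕ Fin N → ℂ => Real.log (h (z ∘ Sum.inl) (z ∘ Sum.inl)).re) z := fun z hz =>
    H.contDiffAt_log_base hz.1
  have hnn : ∀ z ∈ hartogsDomain R h N K, ∀ v, 0 ≤ leviForm (hartogsPotential h c K l) z v :=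
    fun z hz v => nonneg_of_mul_nonneg_right ((sq_nonneg _).trans (hb₂ z hz v)) hB₂
  have hsqrt : ∀ {x y C : ℝ}, 0 ≤ C → x ^ 2 ≤ C * y → |x| ≤ √C * √y := fun hC hxy => by
    rw [← Real.sqrt_mul hC]
    exact Real.abs_le_sqrt hxy
  -- the three summands of the constant belong to the two summands of `Ψ` and to the euclidean metric
  refine isCompleteMetricOn_of_exhaustion hY hu (C := √(4 * B₁) + √(B₃ * B₁) + √B₂)
    (Ψ := fun z => -Real.log (1 - hartogsX h K z) - Real.log (h (z ∘ Sum.inl) (z ∘ Sum.inl)).re)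
    (fun z hz => (((hX z hz).neg.sub (hL z hz)).of_le (by norm_cast)).contDiffWithinAt)
    (by positivity) (fun z hz v => ?_) (fun z hz v => ?_) (H.closure_sublevel_subset hK)
  · rw [metricLength_eq_sqrt (hu z hz), fderiv_fun_sub ((hX z hz).neg.differentiableAt (by simp))
      ((hL z hz).differentiableAt (by simp)), fderiv_fun_neg]
    have h1 : |fderiv ℝ (fun z => Real.log (1 - hartogsX h K z)) z v| ≤
        √(4 * B₁) * √(leviForm (hartogsPotential h c K l) z v) := by
      refine hsqrt (by positivity) ((fderiv_sq_le_dbarSq _ z v).trans ?_)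
      linarith [(hb₁ z hz v).1]
    have h2 : |fderiv ℝ (fun z => Real.log (h (z ∘ Sum.inl) (z ∘ Sum.inl)).re) z v| ≤
        √(B₃ * B₁) * √(leviForm (hartogsPotential h c K l) z v) := by
      refine hsqrt (by positivity) ?_
      have e1 := hb₃ _ hz.1 (baseProj κ N v)
      have hlz := H.contDiffAt_log hz.1
      have e2 := leviForm_comp_clm (u := fun Z => Real.log (h Z Z).re) (baseProj κ N)
        (z := z) (hlz.of_le (by norm_cast)) v
      have hlz' : HasFDerivAt (fun Z => Real.log (h Z Z).re)
        (fderiv ℝ (fun Z => Real.log (h Z Z).re) (z ∘ Sum.inl)) (baseProj κ N z) :=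
        (hlz.differentiableAt (by simp)).hasFDerivAt
      have e3 := DFunLike.congr_fun
        (hlz'.comp z ((baseProj κ N).restrictScalars ℝ).hasFDerivAt).fderiv v
      have e4 : fderiv ℝ (fun z => Real.log (h (z ∘ Sum.inl) (z ∘ Sum.inl)).re) z v =
        fderiv ℝ (fun Z => Real.log (h Z Z).re) (z ∘ Sum.inl) (baseProj κ N v) := e3
      have e5 : -leviForm (fun Z => Real.log (h Z Z).re) (z ∘ Sum.inl) (baseProj κ N v) ≤
          B₁ * leviForm (hartogsPotential h c K l) z v := by
        refine le_trans (le_of_eq ?_) (hb₁ z hz v).2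
        rw [← baseProj_apply, ← e2]
        rfl
      rw [e4, mul_assoc]
      exact e1.trans (by gcongr)
    calc _ = |-fderiv ℝ (fun z => Real.log (1 - hartogsX h K z)) z v -
          fderiv ℝ (fun z => Real.log (h (z ∘ Sum.inl) (z ∘ Sum.inl)).re) z v| := rfl
      _ ≤ _ := (abs_sub _ _).trans (by rw [abs_neg])
      _ ≤ √(4 * B₁) * √(leviForm (hartogsPotential h c K l) z v) +
          √(B₃ * B₁) * √(leviForm (hartogsPotential h c K l) z v) := add_le_add h1 h2
      _ ≤ _ := by
        rw [add_mul, add_mul]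
        have : 0 ≤ √B₂ * √(leviForm (hartogsPotential h c K l) z v) := by positivity
        linarith
  · rw [metricLength_eq_sqrt (hu z hz)]
    have h1 := hsqrt hB₂.le (hb₂ z hz v)
    rw [abs_norm] at h1
    rw [add_mul]
    have : 0 ≤ (√(4 * B₁) + √(B₃ * B₁)) * √(leviForm (hartogsPotential h c K l) z v) := by
      positivity
    linarith

end Ball

end IsHomogeneousDatum

end Completeness


/-! ### Fractional linear maps of matrices -/

section MatrixMobius

open Set Matrix

variable {𝕜 : Type*} [RCLike 𝕜] {m n : Type*} [Fintype m] [DecidableEq m] [Fintype n] [DecidableEq n]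

/-- `A (Z - Z₀) (1 - Z₀ᴴ Z)⁻¹ D⁻¹`, for matrices over `ℝ` or `ℂ` with arbitrary index types. -/
noncomputable def mobius (Z₀ : Matrix m n 𝕜) (A : Matrix m m 𝕜) (D : Matrix n n 𝕜)
    (Z : Matrix m n 𝕜) : Matrix m n 𝕜 :=
  A * (Z - Z₀) * (1 - Z₀ᴴ * Z)⁻¹ * D⁻¹

omit [DecidableEq m] in
lemma mobius_self (Z₀ : Matrix m n 𝕜) (A : Matrix m m 𝕜) (D : Matrix n n 𝕜) :
    mobius Z₀ A D Z₀ = 0 := by simp [mobius]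

omit [DecidableEq m] in
lemma mobius_zero (Z₀ : Matrix m n 𝕜) (A : Matrix m m 𝕜) (D : Matrix n n 𝕜) :
    mobius Z₀ A D 0 = -(A * Z₀ * D⁻¹) := by simp [mobius]

lemma posDef_one_sub_conjTranspose_mul {Z : Matrix m n 𝕜} (h : (1 - Z * Zᴴ).PosDef) :
    (1 - Zᴴ * Z).PosDef := by
  have hE := h.inv
  set E := (1 - Z * Zᴴ)⁻¹ with hEdef
  have h1 : (1 - Z * Zᴴ) * E = 1 := mul_nonsing_inv _ ((isUnit_iff_isUnit_det _).1 h.isUnit)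
  have h2 : E = 1 + Z * Zᴴ * E := by
    rw [Matrix.sub_mul, Matrix.one_mul] at h1
    rw [← h1, sub_add_cancel]
  have h3 : (1 - Zᴴ * Z) * (1 + Zᴴ * E * Z) = 1 := by
    have : Zᴴ * E * Z = Zᴴ * Z + Zᴴ * Z * (Zᴴ * E * Z) := by
      conv_lhs => rw [h2]
      simp only [Matrix.mul_add, Matrix.add_mul, Matrix.mul_one, Matrix.mul_assoc]
    rw [Matrix.sub_mul, Matrix.one_mul, Matrix.mul_add, Matrix.mul_one, ← this]
    simp
  have h4 : (1 + Zᴴ * E * Z).PosDef :=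
    PosDef.one.add_posSemidef (hE.posSemidef.conjTranspose_mul_mul_same Z)
  rw [← Matrix.inv_eq_left_inv h3]
  exact h4.inv

omit [DecidableEq n] in
lemma isUnit_one_sub_mul_conjTranspose {Z W : Matrix m n 𝕜} (hZ : (1 - Z * Zᴴ).PosDef)
    (hW : (1 - W * Wᴴ).PosDef) : IsUnit (1 - Z * Wᴴ) := by
  -- twice the hermitian part is positive definite
  have h1 : ((1 - Z * Wᴴ) + (1 - Z * Wᴴ)ᴴ).PosDef := by
    have h2 := (hZ.add hW).add_posSemidef (posSemidef_self_mul_conjTranspose (Z - W))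
    convert h2 using 1
    simp only [conjTranspose_sub, conjTranspose_one, conjTranspose_mul, conjTranspose_conjTranspose,
      Matrix.mul_sub, Matrix.sub_mul]
    abel
  rw [Matrix.isUnit_iff_isUnit_det, isUnit_iff_ne_zero]
  intro h0
  obtain ⟨x, hx, hx0⟩ := Matrix.exists_mulVec_eq_zero_iff.2 h0
  have h3 := h1.dotProduct_mulVec_pos hx
  rw [Matrix.add_mulVec, hx0, zero_add, Matrix.dotProduct_mulVec, ← Matrix.star_mulVec, hx0] at h3
  simp at h3

/-- The conditions on the matrices `Z₀`, `A`, `D` under which `mobius Z₀ A D` is an automorphism of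
the matrix ball. -/
structure IsMobiusData (Z₀ : Matrix m n 𝕜) (A : Matrix m m 𝕜) (D : Matrix n n 𝕜) : Prop where
  posDef : (1 - Z₀ * Z₀ᴴ).PosDef
  left : Aᴴ * A = (1 - Z₀ * Z₀ᴴ)⁻¹
  right : Dᴴ * D = (1 - Z₀ᴴ * Z₀)⁻¹

namespace IsMobiusData

variable {Z₀ : Matrix m n 𝕜} {A : Matrix m m 𝕜} {D : Matrix n n 𝕜} (h : IsMobiusData Z₀ A D)
include h

lemma left_mul : Aᴴ * A * (1 - Z₀ * Z₀ᴴ) = 1 := by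
  rw [h.left]
  exact nonsing_inv_mul _ ((isUnit_iff_isUnit_det _).1 h.posDef.isUnit)

lemma right_mul : Dᴴ * D * (1 - Z₀ᴴ * Z₀) = 1 := by
  rw [h.right]
  exact nonsing_inv_mul _ ((isUnit_iff_isUnit_det _).1
    (posDef_one_sub_conjTranspose_mul h.posDef).isUnit)

lemma det_left : IsUnit A.det := by
  have := congrArg det h.left_mul
  rw [det_mul, det_mul, det_one] at this
  exact isUnit_iff_ne_zero.2 (right_ne_zero_of_mul (left_ne_zero_of_mul_eq_one this))

lemma det_right : IsUnit D.det := by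
  have := congrArg det h.right_mul
  rw [det_mul, det_mul, det_one] at this
  exact isUnit_iff_ne_zero.2 (right_ne_zero_of_mul (left_ne_zero_of_mul_eq_one this))

lemma push : Z₀ * (Dᴴ * D) = Aᴴ * A * Z₀ := by
  have h1 : (1 - Z₀ᴴ * Z₀) * (Dᴴ * D) = 1 := mul_eq_one_comm.1 h.right_mul
  calc Z₀ * (Dᴴ * D) = Aᴴ * A * (1 - Z₀ * Z₀ᴴ) * (Z₀ * (Dᴴ * D)) := by
        rw [h.left_mul, Matrix.one_mul]
    _ = Aᴴ * A * (Z₀ * ((1 - Z₀ᴴ * Z₀) * (Dᴴ * D))) := by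
        simp only [Matrix.mul_sub, Matrix.sub_mul, Matrix.mul_one, Matrix.one_mul,
          Matrix.mul_assoc]
    _ = _ := by rw [h1, Matrix.mul_one]

lemma push' : Dᴴ * D * Z₀ᴴ = Z₀ᴴ * (Aᴴ * A) := by
  simpa [Matrix.mul_assoc] using congrArg conjTranspose h.push

/-- The invariance of the hermitian form `|x|² - |y|²` under the block matrix of the map. -/
lemma form_invariant (Z W : Matrix m n 𝕜) :
    (1 - Wᴴ * Z₀) * (Dᴴ * D) * (1 - Z₀ᴴ * Z) - (W - Z₀)ᴴ * (Aᴴ * A) * (Z - Z₀) = 1 - Wᴴ * Z := by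
  have h1 := h.left_mul
  have h2 := h.right_mul
  have p1 := h.push
  have p2 := h.push'
  set E := Aᴴ * A
  set G := Dᴴ * D
  have e1 : E = 1 + E * Z₀ * Z₀ᴴ := by
    rw [Matrix.mul_sub, Matrix.mul_one, ← Matrix.mul_assoc] at h1
    rw [← h1, sub_add_cancel]
  have e2 : G = 1 + Z₀ᴴ * E * Z₀ := by
    rw [Matrix.mul_sub, Matrix.mul_one, ← Matrix.mul_assoc, p2] at h2
    rw [← h2, sub_add_cancel]
  have t1 : Wᴴ * E * Z = Wᴴ * Z + Wᴴ * E * Z₀ * Z₀ᴴ * Z := by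
    conv_lhs => rw [e1]
    simp only [Matrix.mul_add, Matrix.add_mul, Matrix.mul_one, Matrix.mul_assoc]
  have t2 : Wᴴ * Z₀ * G = Wᴴ * E * Z₀ := by rw [Matrix.mul_assoc, p1, ← Matrix.mul_assoc]
  have t3 : G * Z₀ᴴ * Z = Z₀ᴴ * E * Z := by rw [p2]
  have t4 : Wᴴ * Z₀ * G * Z₀ᴴ * Z = Wᴴ * E * Z₀ * Z₀ᴴ * Z := by rw [t2]
  simp only [conjTranspose_sub, Matrix.mul_sub, Matrix.sub_mul, Matrix.mul_one, Matrix.one_mul,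
    ← Matrix.mul_assoc]
  rw [t4, t2, t3, t1, e2]
  abel

/-- The transformation law of `1 - Wᴴ Z`. -/
lemma one_sub_mobius {Z W : Matrix m n 𝕜} (hZ : IsUnit (1 - Z₀ᴴ * Z)) (hW : IsUnit (1 - Z₀ᴴ * W)) :
    1 - (mobius Z₀ A D W)ᴴ * mobius Z₀ A D Z =
      ((1 - Z₀ᴴ * W)⁻¹ * D⁻¹)ᴴ * (1 - Wᴴ * Z) * ((1 - Z₀ᴴ * Z)⁻¹ * D⁻¹) := by
  have hD := h.det_right
  have hZ' := (isUnit_iff_isUnit_det _).1 hZ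
  have hW' := (isUnit_iff_isUnit_det _).1 hW
  rw [← h.form_invariant Z W]
  set P := 1 - Z₀ᴴ * Z
  have hQ : 1 - Wᴴ * Z₀ = (1 - Z₀ᴴ * W)ᴴ := by simp
  rw [hQ]
  set Q := 1 - Z₀ᴴ * W
  have e1 : (Q⁻¹ * D⁻¹)ᴴ * (Qᴴ * (Dᴴ * D) * P) * (P⁻¹ * D⁻¹) = 1 := by
    have a1 : (Q⁻¹ * D⁻¹)ᴴ * (Qᴴ * Dᴴ) = 1 := by
      rw [← conjTranspose_mul, ← conjTranspose_mul]
      have : D * Q * (Q⁻¹ * D⁻¹) = 1 := by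
        rw [← Matrix.mul_assoc, mul_nonsing_inv_cancel_right _ _ hW', mul_nonsing_inv _ hD]
      rw [this, conjTranspose_one]
    have a2 : D * P * (P⁻¹ * D⁻¹) = 1 := by
      rw [← Matrix.mul_assoc, mul_nonsing_inv_cancel_right _ _ hZ', mul_nonsing_inv _ hD]
    calc _ = (Q⁻¹ * D⁻¹)ᴴ * (Qᴴ * Dᴴ) * (D * P * (P⁻¹ * D⁻¹)) := by
          simp only [Matrix.mul_assoc]
      _ = 1 := by rw [a1, a2, Matrix.mul_one]
  have e2 : (mobius Z₀ A D W)ᴴ * mobius Z₀ A D Z =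
      (Q⁻¹ * D⁻¹)ᴴ * ((W - Z₀)ᴴ * (Aᴴ * A) * (Z - Z₀)) * (P⁻¹ * D⁻¹) := by
    have a1 : ∀ X : Matrix m n 𝕜, mobius Z₀ A D X =
        A * (X - Z₀) * ((1 - Z₀ᴴ * X)⁻¹ * D⁻¹) := fun X => by
      rw [mobius, Matrix.mul_assoc]
    rw [a1, a1, conjTranspose_mul, conjTranspose_mul A]
    simp only [Matrix.mul_assoc]
    rfl
  rw [Matrix.mul_sub, Matrix.sub_mul, e1, e2]

lemma isUnit_one_sub {Z : Matrix m n 𝕜} (hZ : (1 - Z * Zᴴ).PosDef) : IsUnit (1 - Z₀ᴴ * Z) := by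
  have h1 := isUnit_one_sub_mul_conjTranspose hZ h.posDef
  rw [isUnit_iff_isUnit_det] at h1 ⊢
  rwa [← det_one_sub_mul_comm]

lemma posDef_mobius {Z : Matrix m n 𝕜} (hZ : (1 - Z * Zᴴ).PosDef) :
    (1 - mobius Z₀ A D Z * (mobius Z₀ A D Z)ᴴ).PosDef := by
  have hP := h.isUnit_one_sub hZ
  have h1 : (1 - (mobius Z₀ A D Z)ᴴ * mobius Z₀ A D Z).PosDef := by
    rw [h.one_sub_mobius hP hP]
    refine (posDef_one_sub_conjTranspose_mul hZ).conjTranspose_mul_mul_same ?_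
    refine Matrix.mulVec_injective_iff_isUnit.2 ?_
    rw [isUnit_iff_isUnit_det] at hP ⊢
    rw [det_mul]
    exact (isUnit_nonsing_inv_det _ hP).mul (isUnit_nonsing_inv_det _ h.det_right)
  have h2 := posDef_one_sub_conjTranspose_mul (Z := (mobius Z₀ A D Z)ᴴ)
    (by rwa [conjTranspose_conjTranspose])
  rwa [conjTranspose_conjTranspose] at h2

/-- The transformation law of `det (1 - Z Wᴴ)`. -/
lemma det_mobius {Z W : Matrix m n 𝕜} (hZ : (1 - Z * Zᴴ).PosDef) (hW : (1 - W * Wᴴ).PosDef) :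
    (1 - mobius Z₀ A D Z * (mobius Z₀ A D W)ᴴ).det *
      ((1 - Z * Z₀ᴴ).det * (1 - Z₀ * Wᴴ).det) = (1 - Z * Wᴴ).det * (1 - Z₀ * Z₀ᴴ).det := by
  have hP := h.isUnit_one_sub hZ
  have hQ := h.isUnit_one_sub hW
  have hP' := ((isUnit_iff_isUnit_det _).1 hP).ne_zero
  have hQ' := ((isUnit_iff_isUnit_det _).1 hQ).ne_zero
  have hD := h.det_right.ne_zero
  have e0 : (1 - Z₀ * Wᴴ).det = star (1 - Z₀ᴴ * W).det := by
    rw [← det_conjTranspose, ← det_one_sub_mul_comm]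
    simp
  have e1 := congrArg det h.right_mul
  rw [det_mul, det_mul, det_one, ← det_one_sub_mul_comm, det_conjTranspose] at e1
  rw [det_one_sub_mul_comm, h.one_sub_mobius hP hQ, det_one_sub_mul_comm Z Z₀ᴴ,
    det_one_sub_mul_comm Z Wᴴ, e0]
  simp only [det_mul, det_conjTranspose, det_nonsing_inv, Ring.inverse_eq_inv', star_mul', star_inv₀]
  have hQs : star (1 - Z₀ᴴ * W).det ≠ 0 := star_ne_zero.2 hQ'
  have hDs : star D.det ≠ 0 := star_ne_zero.2 hD
  have e2 : (1 - Z₀ * Z₀ᴴ).det = (star D.det * D.det)⁻¹ := eq_inv_of_mul_eq_one_right e1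
  rw [e2]
  field_simp

lemma left_mul_eq : A * (1 - Z₀ * Z₀ᴴ) * Aᴴ = 1 :=
  mul_eq_one_comm.1 (by rw [← Matrix.mul_assoc]; exact h.left_mul)

/-- The data of the inverse map. -/
lemma inverse : IsMobiusData (mobius Z₀ A D 0) Aᴴ Dᴴ := by
  have h0 : (1 - (0 : Matrix m n 𝕜) * (0 : Matrix m n 𝕜)ᴴ).PosDef := by
    simpa using PosDef.one
  have hp := h.posDef_mobius h0
  refine ⟨hp, ?_, ?_⟩
  · refine (inv_eq_left_inv ?_).symm
    rw [conjTranspose_conjTranspose, mobius_zero, Matrix.neg_mul, conjTranspose_neg,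
      Matrix.mul_neg, neg_neg]
    have hDD : D⁻¹ * (D⁻¹)ᴴ = 1 - Z₀ᴴ * Z₀ := by
      rw [conjTranspose_nonsing_inv, ← Matrix.mul_inv_rev, h.right, nonsing_inv_nonsing_inv]
      exact (isUnit_iff_isUnit_det _).1 (posDef_one_sub_conjTranspose_mul h.posDef).isUnit
    have e1 : A * Z₀ * D⁻¹ * (A * Z₀ * D⁻¹)ᴴ = A * (1 - Z₀ * Z₀ᴴ) * (Z₀ * Z₀ᴴ) * Aᴴ := by
      rw [conjTranspose_mul, conjTranspose_mul]
      calc _ = A * Z₀ * (D⁻¹ * (D⁻¹)ᴴ) * Z₀ᴴ * Aᴴ := by simp only [Matrix.mul_assoc]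
        _ = _ := by
          rw [hDD]
          simp only [Matrix.mul_sub, Matrix.sub_mul, Matrix.mul_one, Matrix.mul_assoc]
    rw [e1, Matrix.mul_sub, Matrix.mul_one]
    have e2 : A * Aᴴ * (A * (1 - Z₀ * Z₀ᴴ) * (Z₀ * Z₀ᴴ) * Aᴴ) =
        A * (Aᴴ * A * (1 - Z₀ * Z₀ᴴ)) * (Z₀ * Z₀ᴴ) * Aᴴ := by simp only [Matrix.mul_assoc]
    rw [e2, h.left_mul, Matrix.mul_one, ← h.left_mul_eq]
    simp only [Matrix.mul_sub, Matrix.sub_mul, Matrix.mul_one]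
  · refine (inv_eq_left_inv ?_).symm
    have hu : IsUnit (1 - Z₀ᴴ * (0 : Matrix m n 𝕜)) := by simp
    rw [h.one_sub_mobius hu hu, conjTranspose_conjTranspose]
    simp only [Matrix.mul_zero, sub_zero, inv_one, Matrix.one_mul, Matrix.mul_one]
    have hD := h.det_right
    have hDs : IsUnit Dᴴ.det := by rw [det_conjTranspose]; exact hD.star
    rw [conjTranspose_nonsing_inv]
    calc D * Dᴴ * (Dᴴ⁻¹ * D⁻¹) = D * (Dᴴ * Dᴴ⁻¹) * D⁻¹ := by simp only [Matrix.mul_assoc]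
      _ = 1 := by rw [mul_nonsing_inv _ hDs, Matrix.mul_one, mul_nonsing_inv _ hD]

/-- The map of the inverse data is the inverse map, on one side. -/
lemma inverse_apply {Z : Matrix m n 𝕜} (hZ : (1 - Z * Zᴴ).PosDef) :
    mobius (mobius Z₀ A D 0) Aᴴ Dᴴ (mobius Z₀ A D Z) = Z := by
  have hP := h.isUnit_one_sub hZ
  have hPd := (isUnit_iff_isUnit_det _).1 hP
  have hu : IsUnit (1 - Z₀ᴴ * (0 : Matrix m n 𝕜)) := by simp
  have hD := h.det_right
  have hDs : IsUnit Dᴴ.det := by rw [det_conjTranspose]; exact hD.star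
  have e1 := h.one_sub_mobius hP hu
  simp only [conjTranspose_zero, Matrix.zero_mul, Matrix.mul_zero, sub_zero, inv_one,
    Matrix.one_mul, Matrix.mul_one] at e1
  have e2 : (1 - (mobius Z₀ A D 0)ᴴ * mobius Z₀ A D Z)⁻¹ = D * (1 - Z₀ᴴ * Z) * Dᴴ := by
    rw [e1, Matrix.mul_inv_rev, Matrix.mul_inv_rev, nonsing_inv_nonsing_inv _ hD,
      nonsing_inv_nonsing_inv _ hPd, conjTranspose_nonsing_inv, nonsing_inv_nonsing_inv _ hDs]
  have e3 : mobius Z₀ A D Z - mobius Z₀ A D 0 =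
      A * (1 - Z₀ * Z₀ᴴ) * Z * (1 - Z₀ᴴ * Z)⁻¹ * D⁻¹ := by
    have e4 : A * Z₀ * D⁻¹ = A * Z₀ * (1 - Z₀ᴴ * Z) * (1 - Z₀ᴴ * Z)⁻¹ * D⁻¹ := by
      rw [mul_nonsing_inv_cancel_right _ _ hPd]
    rw [mobius_zero, sub_neg_eq_add, e4, mobius, ← Matrix.add_mul, ← Matrix.add_mul]
    congr 2
    simp only [Matrix.mul_sub, Matrix.sub_mul, Matrix.mul_one, Matrix.mul_assoc]
    abel
  have e5 : mobius (mobius Z₀ A D 0) Aᴴ Dᴴ (mobius Z₀ A D Z) =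
      Aᴴ * (mobius Z₀ A D Z - mobius Z₀ A D 0) *
        (1 - (mobius Z₀ A D 0)ᴴ * mobius Z₀ A D Z)⁻¹ * Dᴴ⁻¹ := rfl
  rw [e5, e2, e3]
  calc _ = Aᴴ * A * (1 - Z₀ * Z₀ᴴ) * Z * ((1 - Z₀ᴴ * Z)⁻¹ * (D⁻¹ * D) * (1 - Z₀ᴴ * Z)) *
        (Dᴴ * Dᴴ⁻¹) := by simp only [Matrix.mul_assoc]
    _ = Z := by
      rw [h.left_mul, nonsing_inv_mul _ hD, Matrix.mul_one, nonsing_inv_mul _ hPd,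
        mul_nonsing_inv _ hDs, Matrix.mul_one, Matrix.mul_one, Matrix.one_mul]

lemma apply_inverse {Z : Matrix m n 𝕜} (hZ : (1 - Z * Zᴴ).PosDef) :
    mobius Z₀ A D (mobius (mobius Z₀ A D 0) Aᴴ Dᴴ Z) = Z := by
  have h1 := h.inverse.inverse_apply hZ
  have h2 : mobius (mobius Z₀ A D 0) Aᴴ Dᴴ 0 = Z₀ := by
    have := h.inverse_apply h.posDef
    rwa [mobius_self] at this
  rwa [h2, conjTranspose_conjTranspose, conjTranspose_conjTranspose] at h1

end IsMobiusData

open scoped MatrixOrder Matrix.Norms.L2Operator in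
lemma exists_conjTranspose_mul_self_eq {M : Matrix n n 𝕜} (hM : M.PosDef) :
    ∃ A : Matrix n n 𝕜, Aᴴ * A = M := by
  obtain ⟨B, hB⟩ := CStarAlgebra.nonneg_iff_eq_star_mul_self.mp hM.posSemidef.nonneg
  exact ⟨B, hB.symm⟩

end MatrixMobius


/-! ### Domains of matrix type -/

section MatrixDomain

open Set Matrix

section Entries

variable {E : Type*} [NormedAddCommGroup E] [NormedSpace ℂ E] {U : Set E} {l m n : Type*}
  [Fintype m]

/-- Entrywise holomorphy of a matrix-valued function. -/
def MatrixHolomorphicOn (M : E → Matrix l m ℂ) (U : Set E) : Prop :=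
  ∀ i j, DifferentiableOn ℂ (fun z => M z i j) U

namespace MatrixHolomorphicOn

omit [Fintype m] in
lemma const (M : Matrix l m ℂ) : MatrixHolomorphicOn (fun _ : E => M) U := fun i j =>
  differentiableOn_const (M i j)

omit [Fintype m] in
lemma sub {M M' : E → Matrix l m ℂ} (h : MatrixHolomorphicOn M U)
    (h' : MatrixHolomorphicOn M' U) : MatrixHolomorphicOn (fun z => M z - M' z) U := fun i j =>
  (h i j).sub (h' i j)

lemma mul {M : E → Matrix l m ℂ} {M' : E → Matrix m n ℂ} (h : MatrixHolomorphicOn M U)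
    (h' : MatrixHolomorphicOn M' U) : MatrixHolomorphicOn (fun z => M z * M' z) U := fun i j => by
  simp only [Matrix.mul_apply]
  exact DifferentiableOn.fun_sum fun k _ => (h i k).mul (h' k j)

lemma inv [DecidableEq m] {M : E → Matrix m m ℂ} (h : MatrixHolomorphicOn M U)
    (h0 : ∀ z ∈ U, IsUnit (M z)) : MatrixHolomorphicOn (fun z => (M z)⁻¹) U := fun i j => by
  simp only [Matrix.inv_def, Ring.inverse_eq_inv', Matrix.smul_apply, smul_eq_mul,
    Matrix.adjugate_apply]
  refine ((differentiableOn_matrix_det h).inv fun z hz =>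
    ((isUnit_iff_isUnit_det _).1 (h0 z hz)).ne_zero).mul (differentiableOn_matrix_det fun a b => ?_)
  by_cases hab : a = j
  · subst hab
    simp only [Matrix.updateRow_self]
    exact differentiableOn_const _
  · simp only [Matrix.updateRow_ne hab]
    exact h a b

end MatrixHolomorphicOn

end Entries

section Frobenius

variable {m n : Type*} [Fintype m] [DecidableEq m] [Fintype n]

lemma one_sub_sum_le_prod {ι : Type*} (s : Finset ι) {x : ι → ℝ} (h0 : ∀ i ∈ s, 0 ≤ x i)
    (h1 : ∀ i ∈ s, x i ≤ 1) : 1 - ∑ i ∈ s, (1 - x i) ≤ ∏ i ∈ s, x i := by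
  induction s using Finset.cons_induction with
  | empty => simp
  | cons a s ha ih =>
    rw [Finset.sum_cons, Finset.prod_cons]
    have i1 := ih (fun i hi => h0 i (Finset.mem_cons_of_mem hi))
      fun i hi => h1 i (Finset.mem_cons_of_mem hi)
    have i2 := h0 a (Finset.mem_cons_self a s)
    have i3 := h1 a (Finset.mem_cons_self a s)
    have i4 : ∏ i ∈ s, x i ≤ 1 := Finset.prod_le_one
      (fun i hi => h0 i (Finset.mem_cons_of_mem hi)) fun i hi => h1 i (Finset.mem_cons_of_mem hi)
    nlinarith

omit [Fintype m] in
lemma isHermitian_one_sub (Z : Matrix m n ℂ) : (1 - Z * Zᴴ).IsHermitian :=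
  isHermitian_one.sub (isHermitian_mul_conjTranspose_self Z)

lemma eigenvalues_one_sub_le (Z : Matrix m n ℂ) (i : m) :
    (isHermitian_one_sub Z).eigenvalues i ≤ 1 := by
  have hH := isHermitian_one_sub Z
  rw [hH.eigenvalues_eq]
  set v := (hH.eigenvectorBasis i).ofLp
  have h1 : star v ⬝ᵥ v = 1 := by
    have := hH.eigenvectorBasis.orthonormal.1 i
    have h2 : ‖hH.eigenvectorBasis i‖ ^ 2 = 1 := by rw [this, one_pow]
    rw [EuclideanSpace.norm_sq_eq] at h2
    simp only [dotProduct, Pi.star_apply, Complex.star_def, ← Complex.normSq_eq_conj_mul_self,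
      Complex.normSq_eq_norm_sq]
    exact_mod_cast h2
  have h3 := (posSemidef_self_mul_conjTranspose Z).dotProduct_mulVec_nonneg v
  rw [sub_mulVec, one_mulVec, dotProduct_sub, h1]
  have h4 := (Complex.nonneg_iff.1 h3).1
  simp only [map_sub, Complex.one_re, RCLike.re_eq_complex_re]
  linarith

lemma sum_one_sub_eigenvalues (Z : Matrix m n ℂ) :
    ∑ i, (1 - (isHermitian_one_sub Z).eigenvalues i) = ∑ i, ∑ j, ‖Z i j‖ ^ 2 := by
  have h1 := (isHermitian_one_sub Z).trace_eq_sum_eigenvalues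
  have h2 : (Z * Zᴴ).trace = ((∑ i, ∑ j, ‖Z i j‖ ^ 2 : ℝ) : ℂ) := by
    simp [Matrix.trace, Matrix.mul_apply, Complex.mul_conj, Complex.normSq_eq_norm_sq]
  rw [trace_sub, trace_one, h2] at h1
  rw [Finset.sum_sub_distrib, Finset.sum_const, Finset.card_univ, nsmul_eq_mul, mul_one]
  have h3 : (Fintype.card m : ℝ) - ∑ i, ∑ j, ‖Z i j‖ ^ 2 =
      ∑ i, (isHermitian_one_sub Z).eigenvalues i := by
    simp only [RCLike.ofReal_eq_complex_ofReal] at h1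
    exact_mod_cast h1
  linarith

lemma det_one_sub_re (Z : Matrix m n ℂ) :
    (1 - Z * Zᴴ).det.re = ∏ i, (isHermitian_one_sub Z).eigenvalues i := by
  rw [(isHermitian_one_sub Z).det_eq_prod_eigenvalues]
  exact_mod_cast rfl

lemma det_one_sub_le {Z : Matrix m n ℂ} (hZ : (1 - Z * Zᴴ).PosDef) :
    Fintype.card m * (1 - Z * Zᴴ).det.re ≤ Fintype.card m - ∑ i, ∑ j, ‖Z i j‖ ^ 2 := by
  have hpos := (isHermitian_one_sub Z).posDef_iff_eigenvalues_pos.1 hZ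
  have hle := eigenvalues_one_sub_le Z
  rw [det_one_sub_re, ← sum_one_sub_eigenvalues Z]
  set x := (isHermitian_one_sub Z).eigenvalues
  have h1 : ∀ j, ∏ i, x i ≤ x j := fun j => by
    rw [← Finset.mul_prod_erase _ _ (Finset.mem_univ j)]
    exact mul_le_of_le_one_right (hpos j).le
      (Finset.prod_le_one (fun i _ => (hpos i).le) fun i _ => hle i)
  have h2 := Finset.sum_le_sum fun j (_ : j ∈ Finset.univ) => h1 j
  rw [Finset.sum_const, Finset.card_univ, nsmul_eq_mul] at h2
  rw [Finset.sum_sub_distrib, Finset.sum_const, Finset.card_univ, nsmul_eq_mul]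
  linarith

lemma posDef_one_sub_of_lt {Z : Matrix m n ℂ} (hZ : ∑ i, ∑ j, ‖Z i j‖ ^ 2 < 1) :
    (1 - Z * Zᴴ).PosDef ∧ 1 - ∑ i, ∑ j, ‖Z i j‖ ^ 2 ≤ (1 - Z * Zᴴ).det.re := by
  have hle := eigenvalues_one_sub_le Z
  rw [← sum_one_sub_eigenvalues Z] at hZ ⊢
  have hpos : ∀ i, 0 < (isHermitian_one_sub Z).eigenvalues i := fun i => by
    have := Finset.single_le_sum
      (f := fun i => 1 - (isHermitian_one_sub Z).eigenvalues i)
      (fun j _ => by simpa using hle j) (Finset.mem_univ i)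
    linarith
  refine ⟨(isHermitian_one_sub Z).posDef_iff_eigenvalues_pos.2 hpos, ?_⟩
  rw [det_one_sub_re]
  exact one_sub_sum_le_prod _ (fun i _ => (hpos i).le) fun i _ => hle i

end Frobenius

variable {κ m n : Type*} [Fintype κ] [Fintype m] [DecidableEq m] [Fintype n]

/-- The domain of matrices `Z` with `1 - Z Zᴴ > 0` in the image of the linear parametrization `f`,
in terms of the coordinates. -/
def matrixBall (f : (κ → ℂ) →ₗ[ℂ] Matrix m n ℂ) : Set (κ → ℂ) := {z | (1 - f z * (f z)ᴴ).PosDef}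

/-- `det (1 - Z Wᴴ)` in terms of the coordinates. -/
noncomputable def matrixNorm (f : (κ → ℂ) →ₗ[ℂ] Matrix m n ℂ) (z w : κ → ℂ) : ℂ :=
  (1 - f z * (f w)ᴴ).det

section Topology

variable (f : (κ → ℂ) →ₗ[ℂ] Matrix m n ℂ)

omit [Fintype m] [DecidableEq m] [Fintype n] in
lemma continuous_parametrization : Continuous f := f.continuous_of_finiteDimensional

lemma continuous_matrixForm : Continuous fun p : (κ → ℂ) × (m → ℂ) =>
    (star p.2 ⬝ᵥ (1 - f p.1 * (f p.1)ᴴ) *ᵥ p.2).re := by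
  have hf := (continuous_parametrization f).comp (continuous_fst (X := κ → ℂ) (Y := m → ℂ))
  exact Complex.continuous_re.comp (Continuous.dotProduct continuous_snd.star
    (Continuous.matrix_mulVec (continuous_const.sub (hf.matrix_mul hf.matrix_conjTranspose))
      continuous_snd))

lemma isOpen_matrixBall : IsOpen (matrixBall f) := by
  refine isOpen_iff_mem_nhds.2 fun z hz => ?_
  have hev : ∀ᶠ x in 𝓝 z, ∀ y ∈ Metric.sphere (0 : m → ℂ) 1,
      0 < (star y ⬝ᵥ (1 - f x * (f x)ᴴ) *ᵥ y).re := by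
    refine (isCompact_sphere _ _).eventually_forall_of_forall_eventually fun y hy => ?_
    have hy0 : y ≠ 0 := by rintro rfl; simp at hy
    exact (continuous_matrixForm f).continuousAt.eventually_const_lt
      (Complex.pos_iff.1 (hz.dotProduct_mulVec_pos hy0)).1
  filter_upwards [hev] with x hx
  refine PosDef.of_dotProduct_mulVec_pos (isHermitian_one_sub _) fun y hy => ?_
  have him := (isHermitian_one_sub (f x)).im_star_dotProduct_mulVec_self y
  refine Complex.pos_iff.2 ⟨?_, him.symm⟩
  have hn : 0 < ‖y‖ := norm_pos_iff.2 hy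
  have h1 := hx ((‖y‖ : ℂ)⁻¹ • y) (by simp [norm_smul, hn.ne'])
  rw [mulVec_smul, dotProduct_smul, star_smul, smul_dotProduct, smul_smul, smul_eq_mul] at h1
  have h2 : ((‖y‖ : ℂ)⁻¹ * star (‖y‖ : ℂ)⁻¹) = (((‖y‖ ^ 2)⁻¹ : ℝ) : ℂ) := by
    simp
    ring
  rw [h2, Complex.re_ofReal_mul] at h1
  exact pos_of_mul_pos_right h1 (by positivity)

lemma mem_matrixBall_of_mem_closure {z : κ → ℂ} (hz : z ∈ closure (matrixBall f))
    (h : 0 < (matrixNorm f z z).re) : z ∈ matrixBall f := by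
  have hps : (1 - f z * (f z)ᴴ).PosSemidef := by
    refine PosSemidef.of_dotProduct_mulVec_nonneg (isHermitian_one_sub _) fun y => ?_
    refine Complex.nonneg_iff.2
      ⟨?_, ((isHermitian_one_sub (f z)).im_star_dotProduct_mulVec_self y).symm⟩
    have hc : Continuous fun x => (star y ⬝ᵥ (1 - f x * (f x)ᴴ) *ᵥ y).re :=
      (continuous_matrixForm f).comp (continuous_id.prodMk continuous_const)
    exact closure_minimal (fun x hx =>
      (Complex.nonneg_iff.1 ((PosDef.posSemidef hx).dotProduct_mulVec_nonneg y)).1)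
      (isClosed_le continuous_const hc) hz
  exact hps.posDef_iff_det_ne_zero.2 fun h0 => by
    rw [matrixNorm, h0] at h
    simp at h

omit [Fintype m] [DecidableEq m] [Fintype n] in
lemma differentiable_entry (i : m) (j : n) : Differentiable ℂ fun z => f z i j :=
  (LinearMap.toContinuousLinearMap ((Matrix.entryLinearMap ℂ ℂ i j).comp f)).differentiable

omit [Fintype m] [DecidableEq m] [Fintype n] in
lemma matrixHolomorphicOn_parametrization (U : Set (κ → ℂ)) : MatrixHolomorphicOn f U :=
  fun i j => (differentiable_entry f i j).differentiableOn

lemma contDiff_matrixNorm : ContDiff ℝ ∞ fun z => (matrixNorm f z z).re := by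
  have h1 : ∀ i j, ContDiff ℝ ∞ fun z => f z i j := fun i j =>
    ((LinearMap.toContinuousLinearMap
      ((Matrix.entryLinearMap ℂ ℂ i j).comp f)).restrictScalars ℝ).contDiff
  have h2 : ∀ i j, ContDiff ℝ ∞ fun z => (1 - f z * (f z)ᴴ : Matrix m m ℂ) i j := fun i j => by
    simp only [Matrix.sub_apply, Matrix.mul_apply, conjTranspose_apply]
    exact contDiff_const.sub (ContDiff.sum fun k _ => (h1 i k).mul
      (Complex.conjCLE.contDiff.comp (h1 j k)))
  refine Complex.reCLM.contDiff.comp ?_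
  simp only [matrixNorm, Matrix.det_apply']
  exact ContDiff.sum fun σ _ => contDiff_const.mul (contDiff_prod fun i _ => h2 _ _)

lemma differentiable_matrixNorm (w : κ → ℂ) : Differentiable ℂ fun z => matrixNorm f z w := by
  rw [← differentiableOn_univ]
  exact differentiableOn_matrix_det ((MatrixHolomorphicOn.const 1).sub
    ((matrixHolomorphicOn_parametrization f univ).mul (MatrixHolomorphicOn.const (f w)ᴴ)))

end Topology

variable [DecidableEq n] {f : (κ → ℂ) →ₗ[ℂ] Matrix m n ℂ} {Φ : (κ → ℂ) → Set ((κ → ℂ) → κ → ℂ)}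

lemma isHolomorphicAutomorphism_of_mobius {e : κ → m × n}
    (he : ∀ z k, f z (e k).1 (e k).2 = z k) {z₀ : κ → ℂ} {A : Matrix m m ℂ} {D : Matrix n n ℂ}
    (h : IsMobiusData (f z₀) A D) {φ ψ : (κ → ℂ) → κ → ℂ}
    (hφ : ∀ z ∈ matrixBall f, f (φ z) = mobius (f z₀) A D (f z))
    (hψ : ∀ z ∈ matrixBall f, f (ψ z) = mobius (mobius (f z₀) A D 0) Aᴴ Dᴴ (f z)) :
    IsHolomorphicAutomorphism φ (matrixBall f) := by
  have hinj : Function.Injective f := fun z w hzw => by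
    funext k
    rw [← he z, ← he w, hzw]
  have hdiff : ∀ {Z₀ : Matrix m n ℂ} {A : Matrix m m ℂ} {D : Matrix n n ℂ} {φ : (κ → ℂ) → κ → ℂ},
      IsMobiusData Z₀ A D → (∀ z ∈ matrixBall f, f (φ z) = mobius Z₀ A D (f z)) →
      DifferentiableOn ℂ φ (matrixBall f) ∧ MapsTo φ (matrixBall f) (matrixBall f) := by
    intro Z₀ A D φ h hφ
    refine ⟨differentiableOn_pi.2 fun k => ?_, fun z hz => ?_⟩
    · have h1 : ∀ z ∈ matrixBall f, φ z k = mobius Z₀ A D (f z) (e k).1 (e k).2 := fun z hz => by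
        rw [← hφ z hz, he]
      refine DifferentiableOn.congr ?_ h1
      have hf := matrixHolomorphicOn_parametrization f (matrixBall f)
      exact ((((MatrixHolomorphicOn.const A).mul (hf.sub (MatrixHolomorphicOn.const Z₀))).mul
        (((MatrixHolomorphicOn.const 1).sub ((MatrixHolomorphicOn.const Z₀ᴴ).mul hf)).inv
          fun z hz => h.isUnit_one_sub hz)).mul (MatrixHolomorphicOn.const D⁻¹)) _ _
    · change (1 - f (φ z) * (f (φ z))ᴴ).PosDef
      rw [hφ z hz]
      exact h.posDef_mobius hz
  obtain ⟨h1, h2⟩ := hdiff h hφ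
  obtain ⟨h3, h4⟩ := hdiff h.inverse hψ
  refine ⟨h1, h2, ψ, h3, h4, fun z hz => hinj ?_, fun z hz => hinj ?_⟩
  · rw [hψ _ (h2 hz), hφ z hz, h.inverse_apply hz]
  · rw [hφ _ (h4 hz), hψ z hz, h.apply_inverse hz]

/-- A domain of matrix type whose parametrization is compatible with sufficiently many pairs
`(A, D)` is homogeneous. -/
theorem isHomogeneousDatum_matrixBall [Nonempty m] {e : κ → m × n}
    (he : ∀ z k, f z (e k).1 (e k).2 = z k) {P : Matrix m m ℂ → Matrix n n ℂ → Prop}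
    (hP : ∀ A D, P A D → P Aᴴ Dᴴ)
    (hex : ∀ z ∈ matrixBall f, ∃ A D, P A D ∧ IsMobiusData (f z) A D)
    (hran : ∀ z₀ ∈ matrixBall f, ∀ A D, P A D → IsMobiusData (f z₀) A D → ∀ z ∈ matrixBall f,
      ∃ w, f w = mobius (f z₀) A D (f z))
    (hΦ : ∀ z₀ ∈ matrixBall f, ∀ φ, φ ∈ Φ z₀ ↔ ∃ A D, P A D ∧ IsMobiusData (f z₀) A D ∧
      ∀ z ∈ matrixBall f, f (φ z) = mobius (f z₀) A D (f z)) :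
    IsHomogeneousDatum (matrixBall f) (matrixNorm f) Φ := by
  -- the condition on `e` makes `f` injective, and bounds `|z|` by the Frobenius norm of `f z`
  have hinj : Function.Injective f := fun z w hzw => by
    funext k
    rw [← he z, ← he w, hzw]
  have h0 : (0 : κ → ℂ) ∈ matrixBall f := by
    change (1 - f 0 * (f 0)ᴴ).PosDef
    simpa using PosDef.one
  have hcard : (0 : ℝ) < Fintype.card m := by exact_mod_cast Fintype.card_pos
  have hcn : ∀ z, coordNormSq z ≤ Fintype.card κ * ∑ i, ∑ j, ‖f z i j‖ ^ 2 := fun z => by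
    calc coordNormSq z ≤ ∑ _k : κ, ∑ i, ∑ j, ‖f z i j‖ ^ 2 := by
          refine Finset.sum_le_sum fun k _ => ?_
          rw [← he z k]
          refine le_trans ?_ (Finset.single_le_sum (f := fun i => ∑ j, ‖f z i j‖ ^ 2)
            (fun i _ => by positivity) (Finset.mem_univ (e k).1))
          exact Finset.single_le_sum (f := fun j => ‖f z (e k).1 j‖ ^ 2)
            (fun i _ => by positivity) (Finset.mem_univ (e k).2)
      _ = _ := by simp
  obtain ⟨C, hC, hCf⟩ : ∃ C > 0, ∀ z, ∑ i, ∑ j, ‖f z i j‖ ^ 2 ≤ C * coordNormSq z := by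
    refine exists_forall_le_of_pos (q₁ := fun z => ∑ i, ∑ j, ‖f z i j‖ ^ 2) ?_
      (contDiff_coordNormSq (n := 0)).continuous (fun t z => ?_) coordNormSq_smul
      fun v hv => coordNormSq_pos hv
    · exact continuous_finsetSum _ fun i _ => continuous_finsetSum _ fun j _ =>
        (differentiable_entry f i j).continuous.norm.pow 2
    · have : f (t • z) = (t : ℂ) • f z := by
        rw [← map_smul]
        rfl
      simp [this, mul_pow, Finset.mul_sum]
  have hupper : ∃ c > 0, ∀ z ∈ matrixBall f, (matrixNorm f z z).re ≤ 1 - c * coordNormSq z := by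
    refine ⟨((Fintype.card κ + 1) * Fintype.card m : ℝ)⁻¹, by positivity, fun z hz => ?_⟩
    have h1 := det_one_sub_le hz
    have h2 := hcn z
    have h3 : 0 ≤ ∑ i, ∑ j, ‖f z i j‖ ^ 2 := by positivity
    set F := ∑ i, ∑ j, ‖f z i j‖ ^ 2
    have h4 : ((Fintype.card κ + 1) * Fintype.card m : ℝ)⁻¹ * coordNormSq z ≤
        F / Fintype.card m := by
      rw [inv_mul_le_iff₀ (by positivity)]
      calc coordNormSq z ≤ (Fintype.card κ + 1) * F := by linarith
        _ = _ := by field_simp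
    have h5 : (matrixNorm f z z).re ≤ 1 - F / Fintype.card m := by
      rw [← mul_le_mul_iff_right₀ hcard, mul_sub, mul_one, mul_div_cancel₀ _ hcard.ne']
      exact h1
    linarith
  have hpos : ∀ z ∈ matrixBall f, 0 < (matrixNorm f z z).re := fun z hz =>
    (Complex.pos_iff.1 (PosDef.det_pos hz)).1
  refine
    { isOpen := isOpen_matrixBall f
      smul_mem := fun z hz t ht0 ht1 => ?_
      differentiable := differentiable_matrixNorm f
      contDiff := contDiff_matrixNorm f
      conj_symm := fun z w => ?_
      apply_zero := fun z => by simp [matrixNorm]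
      ne_zero := fun z hz w hw =>
        ((isUnit_iff_isUnit_det _).1 (isUnit_one_sub_mul_conjTranspose hz hw)).ne_zero
      pos := hpos
      upper := hupper
      lower := ⟨C, hC, fun z hz => ?_⟩
      mem_of_mem_closure := fun z hz h => mem_matrixBall_of_mem_closure f hz h
      bounded := ?_
      nonempty := fun z₀ hz₀ => ?_
      automorphism := fun z₀ hz₀ φ hφ => ?_
      map_self := fun z₀ hz₀ φ hφ => ?_
      transform := fun z₀ hz₀ φ hφ z hz w hw => ?_ }
  · have h1 : f (t • z) = (t : ℂ) • f z := by
      rw [← map_smul]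
      rfl
    have h2 : 1 - f (t • z) * (f (t • z))ᴴ =
        (1 - f z * (f z)ᴴ) + ((1 - t ^ 2 : ℝ) : ℂ) • (f z * (f z)ᴴ) := by
      rw [h1, conjTranspose_smul, Matrix.smul_mul, Matrix.mul_smul, smul_smul]
      simp only [Complex.star_def, Complex.conj_ofReal]
      push_cast
      module
    change (1 - f (t • z) * (f (t • z))ᴴ).PosDef
    rw [h2]
    refine PosDef.add_posSemidef hz ((posSemidef_self_mul_conjTranspose (f z)).smul ?_)
    exact_mod_cast (by nlinarith : 0 ≤ 1 - t ^ 2)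
  · rw [matrixNorm, ← Complex.star_def, ← det_conjTranspose, matrixNorm]
    simp
  · have h1 := hCf z
    obtain ⟨h2, h3⟩ := posDef_one_sub_of_lt (Z := f z) (h1.trans_lt hz)
    exact ⟨h2, le_trans (by linarith) h3⟩
  · obtain ⟨c, hc, hup⟩ := hupper
    have hb : Bornology.IsBounded (matrixBall f) := by
      refine isBounded_iff_forall_norm_le.2 ⟨1 / c + 1, fun z hz => ?_⟩
      have h1 := hup z hz
      have h2 := hpos z hz
      have h3 := norm_sq_le_coordNormSq z
      have h4 : ‖z‖ ^ 2 ≤ 1 / c := by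
        rw [le_div_iff₀ hc]; nlinarith
      nlinarith [sq_nonneg (‖z‖ - 1), norm_nonneg z, (by positivity : 0 < 1 / c)]
    have hcont : Continuous fun p : (κ → ℂ) × (κ → ℂ) => matrixNorm f p.1 p.2 := by
      have hf1 := (continuous_parametrization f).comp (continuous_fst (X := κ → ℂ) (Y := κ → ℂ))
      have hf2 := (continuous_parametrization f).comp (continuous_snd (X := κ → ℂ) (Y := κ → ℂ))
      exact (continuous_const.sub (hf1.matrix_mul hf2.matrix_conjTranspose)).matrix_det
    obtain ⟨M, hM⟩ := ((hb.isCompact_closure.prod hb.isCompact_closure).image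
      hcont).isBounded.exists_norm_le
    exact ⟨M, fun z hz w hw => hM _
      ⟨(z, w), ⟨subset_closure hz, subset_closure hw⟩, rfl⟩⟩
  · obtain ⟨A, D, hAD, hd⟩ := hex z₀ hz₀
    choose! φ hφ using hran z₀ hz₀ A D hAD hd
    exact ⟨φ, (hΦ z₀ hz₀ φ).2 ⟨A, D, hAD, hd, hφ⟩⟩
  · obtain ⟨A, D, hAD, hd, hφ'⟩ := (hΦ z₀ hz₀ φ).1 hφ
    have h1 := hφ' 0 h0
    rw [map_zero] at h1
    have h2 : φ 0 ∈ matrixBall f := by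
      change (1 - f (φ 0) * (f (φ 0))ᴴ).PosDef
      rw [h1]
      exact hd.inverse.posDef
    -- the inverse of `φ` has base point `φ 0` and the conjugate transposes of `A` and `D`
    have h3 := hran (φ 0) h2 _ _ (hP _ _ hAD) (by rw [h1]; exact hd.inverse)
    choose! ψ hψ using h3
    rw [h1] at hψ
    exact isHolomorphicAutomorphism_of_mobius he hd hφ' hψ
  · obtain ⟨A, D, hAD, hd, hφ'⟩ := (hΦ z₀ hz₀ φ).1 hφ
    refine hinj ?_
    rw [hφ' z₀ hz₀, mobius_self, map_zero]
  · obtain ⟨A, D, hAD, hd, hφ'⟩ := (hΦ z₀ hz₀ φ).1 hφ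
    simp only [matrixNorm]
    rw [hφ' z hz, hφ' w hw]
    exact hd.det_mobius hz hw

end MatrixDomain


/-! ### The unit ball and the classical domains of the first three types -/

section ClassicalMatrixDomains

open Set Matrix

section

variable {m n : Type*} [Fintype m] [DecidableEq m] [Fintype n] [DecidableEq n]

lemma exists_isMobiusData {𝕜 : Type*} [RCLike 𝕜] {Z : Matrix m n 𝕜} (hZ : (1 - Z * Zᴴ).PosDef) :
    ∃ A D, IsMobiusData Z A D := by
  obtain ⟨A, hA⟩ := exists_conjTranspose_mul_self_eq hZ.inv
  obtain ⟨D, hD⟩ := exists_conjTranspose_mul_self_eq (posDef_one_sub_conjTranspose_mul hZ).inv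
  exact ⟨A, D, hZ, hA, hD⟩

/-- Any parametrization of the space of all matrices gives a homogeneous domain. -/
lemma isHomogeneousDatum_matrixBall_of_surjective {κ : Type*} [Fintype κ] [Nonempty m]
    {f : (κ → ℂ) →ₗ[ℂ] Matrix m n ℂ} {e : κ → m × n} (he : ∀ z k, f z (e k).1 (e k).2 = z k)
    (hf : Function.Surjective f) :
    IsHomogeneousDatum (matrixBall f) (matrixNorm f) fun z₀ => {φ | ∃ A D,
      IsMobiusData (f z₀) A D ∧ ∀ z ∈ matrixBall f, f (φ z) = mobius (f z₀) A D (f z)} := by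
  refine isHomogeneousDatum_matrixBall he (P := fun _ _ => True) (fun _ _ _ => trivial)
    (fun z hz => ?_) (fun z₀ _ A D _ _ z _ => hf _) fun z₀ _ φ => by simp
  obtain ⟨A, D, h⟩ := exists_isMobiusData hz
  exact ⟨A, D, trivial, h⟩

end

section Ball

variable (ι : Type*) [Fintype ι]

/-- A vector as a matrix with a single row. -/
def rowParam : (ι → ℂ) →ₗ[ℂ] Matrix Unit ι ℂ where
  toFun z := Matrix.of fun _ j => z j
  map_add' _ _ := rfl
  map_smul' _ _ := rfl

omit [Fintype ι] in
lemma rowParam_apply (z : ι → ℂ) (i : Unit) (j : ι) : rowParam ι z i j = z j := rfl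

lemma exists_isHomogeneousDatum_ball :
    ∃ Φ, IsHomogeneousDatum {z : ι → ℂ | coordNormSq z < 1}
      (fun z w => 1 - ∑ i, z i * conj (w i)) Φ := by
  classical
  have h1 : matrixNorm (rowParam ι) = fun z w => 1 - ∑ i, z i * conj (w i) := by
    ext z w
    simp [matrixNorm, rowParam_apply, Matrix.det_unique, Matrix.mul_apply]
  have h3 : ∀ z : ι → ℂ, ((1 : ℂ) - ∑ i, z i * conj (z i)).re = 1 - coordNormSq z := fun z => by
    simp [coordNormSq, Complex.mul_conj, Complex.normSq_eq_norm_sq, -Complex.ofReal_pow]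
  have h2 : matrixBall (rowParam ι) = {z : ι → ℂ | coordNormSq z < 1} := by
    ext z
    constructor
    · intro hz
      have h4 := (Complex.pos_iff.1 (PosDef.det_pos hz)).1
      change 0 < (matrixNorm (rowParam ι) z z).re at h4
      rw [h1, h3] at h4
      exact sub_pos.1 h4
    · intro hz
      refine (posDef_one_sub_of_lt ?_).1
      simpa [rowParam_apply, coordNormSq] using hz
  have h := isHomogeneousDatum_matrixBall_of_surjective (f := rowParam ι)
    (e := fun k => ((), k)) (fun _ _ => rfl)
    fun M => ⟨fun j => M () j, by ext i j; rfl⟩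
  rw [h1, h2] at h
  exact ⟨_, h⟩

end Ball

/-- The coordinates of `m × n` matrices. -/
def paramI (m n : ℕ) : (Fin m × Fin n → ℂ) →ₗ[ℂ] Matrix (Fin m) (Fin n) ℂ where
  toFun := matI
  map_add' _ _ := rfl
  map_smul' _ _ := rfl

lemma isHomogeneousDatum_domI {m n : ℕ} (hm : 1 ≤ m) :
    IsHomogeneousDatum (domI m n) normI (movesI m n) := by
  have : Nonempty (Fin m) := ⟨⟨0, hm⟩⟩
  refine isHomogeneousDatum_matrixBall (f := paramI m n) (e := id) (fun _ _ => rfl)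
    (P := fun _ _ => True) (fun _ _ _ => trivial) (fun z hz => ?_)
    (fun z₀ _ A D _ _ z _ => ⟨fun k => mobius (paramI m n z₀) A D (paramI m n z) k.1 k.2, rfl⟩)
    fun z₀ hz₀ φ => ?_
  · obtain ⟨A, D, h⟩ := exists_isMobiusData hz
    exact ⟨A, D, trivial, h⟩
  · constructor
    · rintro ⟨A, D, h1, h2, h3⟩
      exact ⟨A, D, trivial, ⟨hz₀, h1, h2⟩, h3⟩
    · rintro ⟨A, D, -, ⟨-, h1, h2⟩, h3⟩
      exact ⟨A, D, h1, h2, h3⟩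

section Symmetric

variable {m : Type*} [Fintype m] [DecidableEq m] {ε : ℂ} {Z₀ Z A : Matrix m m ℂ}

omit [Fintype m] [DecidableEq m] in
lemma transpose_conjTranspose_of_transpose (hs : star ε = ε) (h₀ : Z₀ᵀ = ε • Z₀) :
    (Z₀ᴴ)ᵀ = ε • Z₀ᴴ := by
  have := congrArg conjTranspose h₀
  rw [conjTranspose_smul, hs] at this
  rw [← this]
  rfl

/-- If `Z₀` is symmetric (`ε = 1`) or skew-symmetric (`ε = -1`), the condition on `A` implies that
on its conjugate. -/
lemma isMobiusData_of_transpose (hε : ε * ε = 1) (hs : star ε = ε) (h₀ : Z₀ᵀ = ε • Z₀)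
    (hZ₀ : (1 - Z₀ * Z₀ᴴ).PosDef) (hA : Aᴴ * A = (1 - Z₀ * Z₀ᴴ)⁻¹) :
    IsMobiusData Z₀ A (A.map conj) := by
  refine ⟨hZ₀, hA, ?_⟩
  have h1 : (A.map conj)ᴴ = Aᵀ := by ext i j; simp
  have h2 : A.map conj = (Aᴴ)ᵀ := rfl
  rw [h1, h2, ← transpose_mul, hA, transpose_nonsing_inv, transpose_sub, transpose_one,
    transpose_mul, transpose_conjTranspose_of_transpose hs h₀, h₀, Matrix.smul_mul,
    Matrix.mul_smul, smul_smul, hε, one_smul]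

/-- The maps with `D` the conjugate of `A` preserve symmetry and skew-symmetry. The transpose of
`mobius Z₀ A D Z` has the inverted factors on the left; `key` moves them to the right. -/
lemma transpose_mobius (hε : ε * ε = 1) (hs : star ε = ε) (h₀ : Z₀ᵀ = ε • Z₀) (hZ : Zᵀ = ε • Z)
    (h : IsMobiusData Z₀ A (A.map conj)) (hZp : (1 - Z * Zᴴ).PosDef) :
    (mobius Z₀ A (A.map conj) Z)ᵀ = ε • mobius Z₀ A (A.map conj) Z := by
  set D := A.map conj with hDdef
  have hAt : Aᵀ = Dᴴ := by ext i j; simp [hDdef]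
  have hDt : Dᵀ = Aᴴ := rfl
  have hP := (isUnit_iff_isUnit_det _).1 (h.isUnit_one_sub hZp)
  have hQ := (isUnit_iff_isUnit_det _).1 (isUnit_one_sub_mul_conjTranspose hZp h.posDef)
  have hD := h.det_right
  have hAs : IsUnit Aᴴ.det := by rw [det_conjTranspose]; exact h.det_left.star
  have hPt : (1 - Z₀ᴴ * Z)ᵀ = 1 - Z * Z₀ᴴ := by
    rw [transpose_sub, transpose_one, transpose_mul,
      transpose_conjTranspose_of_transpose hs h₀, hZ, Matrix.smul_mul, Matrix.mul_smul, smul_smul,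
      hε, one_smul]
  have key : (1 - Z * Z₀ᴴ) * (Aᴴ * A) * (Z - Z₀) = (Z - Z₀) * (Dᴴ * D) * (1 - Z₀ᴴ * Z) := by
    have h1 := h.left_mul
    have h2 := h.right_mul
    have p1 := h.push
    have p2 := h.push'
    generalize Aᴴ * A = E at *
    generalize Dᴴ * D = G at *
    have e1 : E * Z = Z + E * Z₀ * Z₀ᴴ * Z := by
      have := congrArg (· * Z) h1
      simp only [Matrix.mul_sub, Matrix.mul_one, Matrix.sub_mul, Matrix.one_mul] at this
      rw [← Matrix.mul_assoc] at this
      exact sub_eq_iff_eq_add.1 this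
    have e2 : Z * G = Z + Z * Z₀ᴴ * E * Z₀ := by
      have := congrArg (Z * ·) h2
      simp only [Matrix.mul_sub, Matrix.mul_one] at this
      rw [← Matrix.mul_assoc G, p2, ← Matrix.mul_assoc, ← Matrix.mul_assoc] at this
      exact sub_eq_iff_eq_add.1 this
    have t1 : Z * G * Z₀ᴴ * Z = Z * Z₀ᴴ * E * Z := by
      rw [Matrix.mul_assoc Z, p2, ← Matrix.mul_assoc]
    have t2 : Z₀ * G * Z₀ᴴ * Z = E * Z₀ * Z₀ᴴ * Z := by rw [p1]
    simp only [Matrix.mul_sub, Matrix.sub_mul, Matrix.mul_one, Matrix.one_mul, ← Matrix.mul_assoc]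
    rw [t1, t2, e1, e2, p1]
    abel
  have h3 : (mobius Z₀ A D Z)ᵀ = ε • (Aᴴ⁻¹ * (1 - Z * Z₀ᴴ)⁻¹ * (Z - Z₀) * Dᴴ) := by
    rw [mobius, transpose_mul, transpose_mul, transpose_mul, transpose_nonsing_inv,
      transpose_nonsing_inv, hDt, hPt, hAt, transpose_sub, hZ, h₀, ← smul_sub, Matrix.smul_mul,
      Matrix.mul_smul, Matrix.mul_smul]
    simp only [Matrix.mul_assoc]
  rw [h3]
  congr 1
  have h4 : (1 - Z * Z₀ᴴ) * Aᴴ * mobius Z₀ A D Z = (Z - Z₀) * Dᴴ := by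
    calc _ = (1 - Z * Z₀ᴴ) * (Aᴴ * A) * (Z - Z₀) * (1 - Z₀ᴴ * Z)⁻¹ * D⁻¹ := by
          simp only [mobius, Matrix.mul_assoc]
      _ = (Z - Z₀) * Dᴴ * (D * ((1 - Z₀ᴴ * Z) * (1 - Z₀ᴴ * Z)⁻¹) * D⁻¹) := by
          rw [key]; simp only [Matrix.mul_assoc]
      _ = _ := by rw [mul_nonsing_inv _ hP, Matrix.mul_one, mul_nonsing_inv _ hD, Matrix.mul_one]
  rw [Matrix.mul_assoc _ (Z - Z₀), ← h4]
  calc _ = Aᴴ⁻¹ * ((1 - Z * Z₀ᴴ)⁻¹ * (1 - Z * Z₀ᴴ)) * Aᴴ * mobius Z₀ A D Z := by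
        simp only [Matrix.mul_assoc]
    _ = _ := by
      rw [nonsing_inv_mul _ hQ, Matrix.mul_one, nonsing_inv_mul _ hAs, Matrix.one_mul]

/-- The domains of symmetric and of skew-symmetric matrices are homogeneous. -/
lemma isHomogeneousDatum_matrixBall_of_transpose {κ : Type*} [Fintype κ] [Nonempty m]
    {f : (κ → ℂ) →ₗ[ℂ] Matrix m m ℂ} {e : κ → m × m} (he : ∀ z k, f z (e k).1 (e k).2 = z k)
    (hε : ε * ε = 1) (hs : star ε = ε) (hf : ∀ z, (f z)ᵀ = ε • f z)
    (hf' : ∀ M : Matrix m m ℂ, Mᵀ = ε • M → ∃ w, f w = M)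
    {Φ : (κ → ℂ) → Set ((κ → ℂ) → κ → ℂ)}
    (hΦ : ∀ z₀ φ, φ ∈ Φ z₀ ↔ ∃ A : Matrix m m ℂ, Aᴴ * A = (1 - f z₀ * (f z₀)ᴴ)⁻¹ ∧
      ∀ z ∈ matrixBall f, f (φ z) = mobius (f z₀) A (A.map conj) (f z)) :
    IsHomogeneousDatum (matrixBall f) (matrixNorm f) Φ := by
  refine isHomogeneousDatum_matrixBall he (P := fun A D => D = A.map conj)
    (fun A D hAD => ?_) (fun z hz => ?_) (fun z₀ hz₀ A D hAD h z hz => hf' _ ?_)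
    fun z₀ hz₀ φ => ?_
  · rw [hAD]; ext i j; simp
  · obtain ⟨A, D, h⟩ := exists_isMobiusData hz
    exact ⟨A, _, rfl, isMobiusData_of_transpose hε hs (hf z) hz h.left⟩
  · subst hAD
    exact transpose_mobius hε hs (hf z₀) (hf z) h hz
  · rw [hΦ]
    constructor
    · rintro ⟨A, h1, h2⟩
      exact ⟨A, _, rfl, isMobiusData_of_transpose hε hs (hf z₀) hz₀ h1, h2⟩
    · rintro ⟨A, D, rfl, h1, h2⟩
      exact ⟨A, h1.left, h2⟩

end Symmetric

/-- The coordinates of symmetric matrices. -/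
def paramII (p : ℕ) : (Sym2 (Fin p) → ℂ) →ₗ[ℂ] Matrix (Fin p) (Fin p) ℂ where
  toFun := matII
  map_add' _ _ := rfl
  map_smul' _ _ := rfl

lemma paramII_apply (p : ℕ) (z : Sym2 (Fin p) → ℂ) (i j : Fin p) :
    paramII p z i j = z s(i, j) := rfl

lemma isHomogeneousDatum_domII {p : ℕ} (hp : 1 ≤ p) :
    IsHomogeneousDatum (domII p) normII (movesII p) := by
  have : Nonempty (Fin p) := ⟨⟨0, hp⟩⟩
  refine isHomogeneousDatum_matrixBall_of_transpose (f := paramII p) (ε := 1)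
    (e := fun k => Quot.out k) (fun z k => ?_) (one_mul 1) (star_one _) (fun z => ?_)
    (fun M hM => ⟨Sym2.lift ⟨fun i j => M i j, fun i j => ?_⟩, ?_⟩) fun z₀ φ => Iff.rfl
  · change z (Quot.mk _ (Quot.out k)) = z k
    rw [Quot.out_eq]
  · ext i j
    simp [paramII_apply, Sym2.eq_swap]
  · have := congrFun (congrFun hM j) i
    simpa using this
  · ext i j
    simp [paramII_apply]

/-- The coordinates of skew-symmetric matrices. -/
def paramIII (q : ℕ) : (SkewIndex q → ℂ) →ₗ[ℂ] Matrix (Fin q) (Fin q) ℂ where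
  toFun := matIII
  map_add' z w := by
    ext i j
    simp only [matIII, Matrix.add_apply, Matrix.of_apply, Pi.add_apply]
    split_ifs <;> ring
  map_smul' t z := by
    ext i j
    simp only [matIII, Matrix.smul_apply, Matrix.of_apply, Pi.smul_apply, smul_eq_mul,
      RingHom.id_apply]
    split_ifs <;> ring

lemma isHomogeneousDatum_domIII {q : ℕ} (hq : 1 ≤ q) :
    IsHomogeneousDatum (domIII q) normIII (movesIII q) := by
  have : Nonempty (Fin q) := ⟨⟨0, hq⟩⟩
  refine isHomogeneousDatum_matrixBall_of_transpose (f := paramIII q) (ε := -1)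
    (e := fun k => k.1) (fun z k => ?_) (by ring) (by simp) (fun z => ?_)
    (fun M hM => ⟨fun k => M k.1.1 k.1.2, ?_⟩) fun z₀ φ => Iff.rfl
  · have := k.2
    simp [paramIII, matIII, this]
  · ext i j
    simp only [paramIII, matIII, LinearMap.coe_mk, AddHom.coe_mk, transpose_apply, of_apply,
      Matrix.smul_apply, smul_eq_mul]
    rcases lt_trichotomy i j with h | h | h
    · simp [h, h.not_gt]
    · simp [h]
    · simp [h, h.not_gt]
  · ext i j
    have hij := congrFun (congrFun hM j) i
    simp only [transpose_apply, Matrix.smul_apply, smul_eq_mul, neg_one_mul] at hij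
    simp only [paramIII, matIII, LinearMap.coe_mk, AddHom.coe_mk, of_apply]
    rcases lt_trichotomy i j with h | h | h
    · simp [h]
    · subst h
      simp only [lt_self_iff_false, dite_false]
      exact (self_eq_neg.1 hij).symm
    · simp [h, h.not_gt, hij]

end ClassicalMatrixDomains


/-! ### The Lie ball -/

section LieBall

open Set Matrix

variable {n : ℕ}

section Lift

/-- The bilinear form of signature `(2, n)`. -/
def lieForm (u v : Fin 2 ⊕ Fin n → ℂ) : ℂ :=
  ∑ i, u (Sum.inl i) * v (Sum.inl i) - ∑ k, u (Sum.inr k) * v (Sum.inr k)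

/-- The matrix of `lieForm`. -/
def lieSign (n : ℕ) (R : Type*) [Ring R] : Matrix (Fin 2 ⊕ Fin n) (Fin 2 ⊕ Fin n) R :=
  fromBlocks 1 0 0 (-1)

/-- The embedding of `ℂⁿ` into the null quadric of `lieForm`. -/
noncomputable def lieLift (z : Fin n → ℂ) : Fin 2 ⊕ Fin n → ℂ := Sum.elim (vecIV z) z

/-- The homogeneous coordinate normalized to `1` on the image of `lieLift`. -/
def lieDenom (u : Fin 2 ⊕ Fin n → ℂ) : ℂ := u (Sum.inl 0) + Complex.I * u (Sum.inl 1)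

/-- The homogeneous coordinate complementary to `lieDenom`; it is `z ⬝ᵥ z` at `lieLift z`. -/
def lieNum (u : Fin 2 ⊕ Fin n → ℂ) : ℂ := u (Sum.inl 0) - Complex.I * u (Sum.inl 1)

lemma lieForm_eq (u v : Fin 2 ⊕ Fin n → ℂ) : lieForm u v = (u ᵥ* lieSign n ℂ) ⬝ᵥ v := by
  rw [lieSign, vecMul_fromBlocks]
  simp [dotProduct, Fintype.sum_sum_type, lieForm, vecMul_neg, sub_eq_add_neg]

lemma lieForm_lieLift_star (z w : Fin n → ℂ) :
    lieForm (lieLift z) (star (lieLift w)) = normIV z w / 2 := by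
  simp only [lieForm, lieLift, normIV, Fin.sum_univ_two, Sum.elim_inl, Sum.elim_inr, vecIV,
    Pi.star_apply, dotProduct, cons_val_zero, cons_val_one]
  simp only [star_div₀, star_mul', star_add, star_sub, star_one, RCLike.star_def, Complex.conj_I,
    map_ofNat]
  ring_nf
  simp only [Complex.I_sq]
  ring

lemma lieForm_lieLift (z : Fin n → ℂ) : lieForm (lieLift z) (lieLift z) = 0 := by
  simp only [lieForm, lieLift, Fin.sum_univ_two, Sum.elim_inl, Sum.elim_inr, vecIV, dotProduct,
    cons_val_zero, cons_val_one]
  ring_nf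
  simp only [Complex.I_sq]
  ring

lemma lieDenom_lieLift (z : Fin n → ℂ) : lieDenom (lieLift z) = 1 := by
  simp only [lieDenom, lieLift, Sum.elim_inl, vecIV, cons_val_zero, cons_val_one]
  ring_nf
  simp only [Complex.I_sq]
  ring

lemma lieDenom_smul (c : ℂ) (u : Fin 2 ⊕ Fin n → ℂ) : lieDenom (c • u) = c * lieDenom u := by
  simp only [lieDenom, Pi.smul_apply, smul_eq_mul]; ring

lemma lieDenom_mul_lieNum {u : Fin 2 ⊕ Fin n → ℂ} (hu : lieForm u u = 0) :
    lieDenom u * lieNum u = ∑ k, u (Sum.inr k) * u (Sum.inr k) := by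
  rw [lieForm, sub_eq_zero] at hu
  rw [← hu, Fin.sum_univ_two, lieDenom, lieNum]
  ring_nf
  simp only [Complex.I_sq]
  ring

/-- The point of `ℂⁿ` with homogeneous coordinates `u`. -/
noncomputable def lieProj (u : Fin 2 ⊕ Fin n → ℂ) : Fin n → ℂ :=
  (lieDenom u)⁻¹ • (u ∘ Sum.inr)

lemma lieProj_lieLift (z : Fin n → ℂ) : lieProj (lieLift z) = z := by
  rw [lieProj, lieDenom_lieLift, inv_one, one_smul]
  rfl

lemma lieProj_smul {c : ℂ} (hc : c ≠ 0) (u : Fin 2 ⊕ Fin n → ℂ) : lieProj (c • u) = lieProj u := by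
  ext k
  simp only [lieProj, lieDenom_smul, Pi.smul_apply, Function.comp_apply, smul_eq_mul]
  rw [mul_inv, mul_mul_mul_comm, mul_comm c⁻¹, mul_assoc, mul_comm, mul_assoc]
  field_simp

lemma lieProj_dotProduct {u : Fin 2 ⊕ Fin n → ℂ} (hu : lieForm u u = 0) (h0 : lieDenom u ≠ 0) :
    lieProj u ⬝ᵥ lieProj u = lieNum u / lieDenom u := by
  have h1 := lieDenom_mul_lieNum hu
  have h2 : (u ∘ Sum.inr) ⬝ᵥ (u ∘ Sum.inr) = lieDenom u * lieNum u := by rw [h1]; rfl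
  rw [lieProj, smul_dotProduct, dotProduct_smul, h2, smul_eq_mul, smul_eq_mul]
  field_simp

lemma smul_lieLift_lieProj {u : Fin 2 ⊕ Fin n → ℂ} (hu : lieForm u u = 0) (h0 : lieDenom u ≠ 0) :
    lieDenom u • lieLift (lieProj u) = u := by
  have h1 := lieProj_dotProduct hu h0
  ext (i | k)
  · simp only [lieLift, Pi.smul_apply, Sum.elim_inl, vecIV, h1, smul_eq_mul]
    have e0 : lieDenom u * (lieNum u / lieDenom u) = lieNum u := mul_div_cancel₀ _ h0
    fin_cases i
    · simp only [Fin.zero_eta, cons_val_zero]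
      rw [mul_div_assoc', mul_add, e0, lieNum, lieDenom]
      ring
    · simp only [Fin.mk_one, cons_val_one, cons_val_fin_one]
      rw [mul_div_assoc', mul_left_comm, mul_sub, e0, lieNum, lieDenom]
      ring_nf
      simp only [Complex.I_sq]
      ring
  · simp only [lieLift, lieProj, Pi.smul_apply, Sum.elim_inr, Function.comp_apply, smul_eq_mul]
    field_simp

lemma norm_lieDenom_sq_add (u : Fin 2 ⊕ Fin n → ℂ) :
    ‖lieDenom u‖ ^ 2 + ‖lieNum u‖ ^ 2 = 2 * (‖u (Sum.inl 0)‖ ^ 2 + ‖u (Sum.inl 1)‖ ^ 2) := by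
  simp only [lieDenom, lieNum, ← Complex.normSq_eq_norm_sq, Complex.normSq_apply, Complex.add_re,
    Complex.add_im, Complex.sub_re, Complex.sub_im, Complex.mul_re, Complex.mul_im, Complex.I_re,
    Complex.I_im]
  ring

lemma norm_dotProduct_self_le (z : Fin n → ℂ) : ‖z ⬝ᵥ z‖ ≤ coordNormSq z := by
  refine (norm_sum_le _ _).trans (Finset.sum_le_sum fun i _ => ?_)
  rw [norm_mul, sq]

lemma re_lieForm_star (u : Fin 2 ⊕ Fin n → ℂ) : (lieForm u (star u)).re =
    ‖u (Sum.inl 0)‖ ^ 2 + ‖u (Sum.inl 1)‖ ^ 2 - coordNormSq (u ∘ Sum.inr) := by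
  simp only [lieForm, Pi.star_apply, RCLike.star_def, Complex.mul_conj, Fin.sum_univ_two,
    Complex.normSq_eq_norm_sq, coordNormSq, Function.comp_apply]
  rw [← Complex.ofReal_sum, ← Complex.ofReal_add, ← Complex.ofReal_sub, Complex.ofReal_re]

/-- A positive null vector does not lie on the hypersurface `‖lieNum u‖ = ‖lieDenom u‖`. -/
lemma norm_lieNum_ne {u : Fin 2 ⊕ Fin n → ℂ} (hu : lieForm u u = 0)
    (hp : 0 < (lieForm u (star u)).re) : ‖lieNum u‖ ≠ ‖lieDenom u‖ := by
  intro he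
  have h1 := norm_lieDenom_sq_add u
  have h2 := norm_dotProduct_self_le (u ∘ Sum.inr)
  have h3 : (u ∘ Sum.inr) ⬝ᵥ (u ∘ Sum.inr) = lieDenom u * lieNum u :=
    (lieDenom_mul_lieNum hu).symm
  rw [h3, norm_mul, he] at h2
  rw [re_lieForm_star] at hp
  rw [he] at h1
  nlinarith

end Lift

end LieBall


section LieBallGroup

open Set Matrix

variable {n : ℕ}

lemma normIV_self (z : Fin n → ℂ) :
    (normIV z z).re = 1 + ‖z ⬝ᵥ z‖ ^ 2 - 2 * coordNormSq z := by
  have h1 : z ⬝ᵥ star z = (coordNormSq z : ℂ) := by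
    simp [dotProduct, coordNormSq, Complex.mul_conj, Complex.normSq_eq_norm_sq,
      -Complex.ofReal_pow]
  rw [normIV, h1, Complex.mul_conj, Complex.normSq_eq_norm_sq]
  simp [-Complex.ofReal_pow]

lemma coordNormSq_lt_one_of_mem_domIV {z : Fin n → ℂ} (hz : z ∈ domIV n) : coordNormSq z < 1 := by
  have h1 := hz.1
  rw [normIV_self] at h1
  nlinarith [hz.2, norm_nonneg (z ⬝ᵥ z)]

lemma smul_mem_domIV {z : Fin n → ℂ} (hz : z ∈ domIV n) {t : ℝ} (h0 : 0 ≤ t) (h1 : t ≤ 1) :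
    t • z ∈ domIV n := by
  have e1 : (t • z) ⬝ᵥ (t • z) = ((t ^ 2 : ℝ) : ℂ) * (z ⬝ᵥ z) := by
    simp only [smul_dotProduct, dotProduct_smul, Complex.real_smul]
    push_cast
    ring
  have e2 : ‖(t • z) ⬝ᵥ (t • z)‖ = t ^ 2 * ‖z ⬝ᵥ z‖ := by
    rw [e1, norm_mul, Complex.norm_real, Real.norm_of_nonneg (sq_nonneg t)]
  have ht2 : t ^ 2 ≤ 1 := pow_le_one₀ h0 h1
  have ht := sq_nonneg t
  obtain ⟨hz1, hz2⟩ := hz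
  rw [normIV_self] at hz1
  set s := ‖z ⬝ᵥ z‖
  have hs : 0 ≤ s := norm_nonneg _
  have hs2 : s ^ 2 < 1 := by nlinarith
  refine ⟨?_, ?_⟩
  · rw [normIV_self, e2, coordNormSq_smul]
    have k1 := mul_nonneg ht (by linarith : 0 ≤ 1 + s ^ 2 - 2 * coordNormSq z)
    have k2 : t ^ 2 * s ^ 2 < 1 := by nlinarith
    by_cases h : t ^ 2 = 1
    · rw [h]; nlinarith
    · have k3 : 0 < (1 - t ^ 2) * (1 - t ^ 2 * s ^ 2) :=
        mul_pos (sub_pos.2 (lt_of_le_of_ne ht2 h)) (by linarith)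
      nlinarith
  · rw [e2]; nlinarith

/-- The real linear maps that preserve `lieForm` and the orientation of the positive plane. They
act on the Lie ball by homographies in the homogeneous coordinates `lieLift`. -/
structure IsLieBallMap (g : Matrix (Fin 2 ⊕ Fin n) (Fin 2 ⊕ Fin n) ℝ) : Prop where
  form : g * lieSign n ℝ * gᵀ = lieSign n ℝ
  det_pos : 0 < g.toBlocks₁₁.det

/-- The action of a real matrix on homogeneous coordinates. -/
noncomputable def lieAct (g : Matrix (Fin 2 ⊕ Fin n) (Fin 2 ⊕ Fin n) ℝ) (u : Fin 2 ⊕ Fin n → ℂ) :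
    Fin 2 ⊕ Fin n → ℂ := u ᵥ* g.map Complex.ofReal

lemma lieAct_smul (g : Matrix (Fin 2 ⊕ Fin n) (Fin 2 ⊕ Fin n) ℝ) (c : ℂ)
    (u : Fin 2 ⊕ Fin n → ℂ) : lieAct g (c • u) = c • lieAct g u := smul_vecMul _ _ _

lemma lieAct_lieAct (g g' : Matrix (Fin 2 ⊕ Fin n) (Fin 2 ⊕ Fin n) ℝ)
    (u : Fin 2 ⊕ Fin n → ℂ) : lieAct g' (lieAct g u) = lieAct (g * g') u := by
  rw [lieAct, lieAct, lieAct, vecMul_vecMul]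
  congr 1
  exact (Matrix.map_mul (f := Complex.ofRealHom)).symm

lemma lieAct_one (u : Fin 2 ⊕ Fin n → ℂ) : lieAct 1 u = u := by
  rw [lieAct, Matrix.map_one _ Complex.ofReal_zero Complex.ofReal_one, vecMul_one]

lemma star_lieAct (g : Matrix (Fin 2 ⊕ Fin n) (Fin 2 ⊕ Fin n) ℝ) (u : Fin 2 ⊕ Fin n → ℂ) :
    star (lieAct g u) = lieAct g (star u) := by
  ext i
  simp [lieAct, vecMul, dotProduct]

lemma lieSign_map : (lieSign n ℝ).map Complex.ofReal = lieSign n ℂ := by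
  ext (i | i) (j | j) <;> simp [lieSign, Matrix.one_apply, apply_ite Complex.ofReal]

lemma lieSign_mul_self (R : Type*) [Ring R] : lieSign n R * lieSign n R = 1 := by
  simp [lieSign, fromBlocks_multiply]

/-- The map of `ℂⁿ` given by `g` in homogeneous coordinates. -/
noncomputable def lieMap (g : Matrix (Fin 2 ⊕ Fin n) (Fin 2 ⊕ Fin n) ℝ) (z : Fin n → ℂ) :
    Fin n → ℂ := lieProj (lieAct g (lieLift z))

lemma continuous_lieLift : Continuous (lieLift : (Fin n → ℂ) → Fin 2 ⊕ Fin n → ℂ) := by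
  refine continuous_pi fun i => ?_
  rcases i with i | k
  · fin_cases i <;> simp only [lieLift, vecIV, Sum.elim_inl, dotProduct] <;> fun_prop
  · exact continuous_apply k

lemma differentiable_lieAct_lieLift (g : Matrix (Fin 2 ⊕ Fin n) (Fin 2 ⊕ Fin n) ℝ)
    (i : Fin 2 ⊕ Fin n) : Differentiable ℂ fun z => lieAct g (lieLift z) i := by
  have h : ∀ i : Fin 2 ⊕ Fin n, Differentiable ℂ fun z : Fin n → ℂ => lieLift z i := by
    rintro (i | k)
    · fin_cases i <;> simp only [lieLift, vecIV, Sum.elim_inl, dotProduct, Fin.zero_eta, Fin.mk_one,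
        cons_val_zero, cons_val_one, cons_val_fin_one] <;> fun_prop
    · exact differentiable_apply k
  simp only [lieAct, vecMul, dotProduct]
  exact Differentiable.fun_sum fun i _ => (h i).mul_const _

namespace IsLieBallMap

variable {g : Matrix (Fin 2 ⊕ Fin n) (Fin 2 ⊕ Fin n) ℝ} (h : IsLieBallMap g)
include h

lemma lieForm_lieAct (u v : Fin 2 ⊕ Fin n → ℂ) :
    lieForm (lieAct g u) (lieAct g v) = lieForm u v := by
  have h1 : g.map Complex.ofReal * lieSign n ℂ * (g.map Complex.ofReal)ᵀ = lieSign n ℂ := by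
    have h2 : (g * lieSign n ℝ * gᵀ).map Complex.ofRealHom = (lieSign n ℝ).map Complex.ofRealHom :=
      congrArg (fun M => M.map Complex.ofRealHom) h.form
    rw [Matrix.map_mul, Matrix.map_mul] at h2
    rw [← lieSign_map]
    exact h2
  conv_rhs => rw [lieForm_eq, ← h1, ← vecMul_vecMul, ← vecMul_vecMul, ← dotProduct_mulVec,
    mulVec_transpose]
  exact lieForm_eq _ _

lemma lieForm_lieAct_lieLift (z : Fin n → ℂ) :
    lieForm (lieAct g (lieLift z)) (lieAct g (lieLift z)) = 0 := by
  rw [h.lieForm_lieAct, lieForm_lieLift]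

lemma lieForm_lieAct_star (z w : Fin n → ℂ) :
    lieForm (lieAct g (lieLift z)) (star (lieAct g (lieLift w))) = normIV z w / 2 := by
  rw [star_lieAct, h.lieForm_lieAct, lieForm_lieLift_star]

/-- The inverse of `g` for the composition of the maps. -/
lemma inverse : IsLieBallMap (lieSign n ℝ * gᵀ * lieSign n ℝ) := by
  have hJ := lieSign_mul_self (n := n) ℝ
  have h1 : g * (lieSign n ℝ * gᵀ * lieSign n ℝ) = 1 := by
    rw [← Matrix.mul_assoc, ← Matrix.mul_assoc, h.form, hJ]
  have h2 := mul_eq_one_comm.1 h1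
  refine ⟨?_, ?_⟩
  · have ht : (lieSign n ℝ)ᵀ = lieSign n ℝ := by simp [lieSign, fromBlocks_transpose]
    simp only [transpose_mul, transpose_transpose, ht]
    calc _ = lieSign n ℝ * gᵀ * (lieSign n ℝ * lieSign n ℝ) * lieSign n ℝ * g * lieSign n ℝ := by
          simp only [Matrix.mul_assoc]
      _ = lieSign n ℝ * gᵀ * lieSign n ℝ * g * lieSign n ℝ := by rw [hJ, Matrix.mul_one]
      _ = _ := by rw [h2, Matrix.one_mul]
  · have h3 : (lieSign n ℝ * gᵀ * lieSign n ℝ).toBlocks₁₁ = g.toBlocks₁₁ᵀ := by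
      conv_lhs => rw [← fromBlocks_toBlocks g]
      simp [lieSign, fromBlocks_transpose, fromBlocks_multiply]
    rw [h3, det_transpose]
    exact h.det_pos

lemma mul_inverse : g * (lieSign n ℝ * gᵀ * lieSign n ℝ) = 1 := by
  rw [← Matrix.mul_assoc, ← Matrix.mul_assoc, h.form, lieSign_mul_self]

lemma inverse_mul : (lieSign n ℝ * gᵀ * lieSign n ℝ) * g = 1 := mul_eq_one_comm.1 h.mul_inverse

/-- The homographies have no pole on the Lie ball: along the segment from the origin to a point of
the domain, `‖lieNum‖ - ‖lieDenom‖` keeps the negative sign that it has at the origin, where it is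
determined by the sign of the determinant. -/
lemma norm_lieNum_lt {z : Fin n → ℂ} (hz : z ∈ domIV n) :
    ‖lieNum (lieAct g (lieLift z))‖ < ‖lieDenom (lieAct g (lieLift z))‖ := by
  set F : ℝ → ℝ := fun t => ‖lieNum (lieAct g (lieLift (t • z)))‖ -
    ‖lieDenom (lieAct g (lieLift (t • z)))‖ with hF
  have hcont : Continuous F := by
    have h1 : Continuous fun t : ℝ => lieAct g (lieLift (t • z)) :=
      (continuous_lieLift.comp (continuous_id.smul continuous_const)).matrix_vecMul
        continuous_const
    have h2 : ∀ i, Continuous fun t : ℝ => lieAct g (lieLift (t • z)) i := fun i =>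
      (continuous_apply i).comp h1
    exact (((h2 _).sub (continuous_const.mul (h2 _))).norm).sub
      (((h2 _).add (continuous_const.mul (h2 _))).norm)
  have hne : ∀ t ∈ Icc (0 : ℝ) 1, F t ≠ 0 := fun t ht => by
    have hm := smul_mem_domIV hz ht.1 ht.2
    refine sub_ne_zero.2 (norm_lieNum_ne (h.lieForm_lieAct_lieLift _) ?_)
    rw [h.lieForm_lieAct_star]
    simpa using hm.1
  have h0 : F 0 < 0 := by
    have e : ∀ j : Fin 2, lieAct g (lieLift (0 : Fin n → ℂ)) (Sum.inl j) =
        ((g (Sum.inl 0) (Sum.inl j) : ℂ) - Complex.I * g (Sum.inl 1) (Sum.inl j)) / 2 := fun j => by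
      simp [lieAct, vecMul, dotProduct, lieLift, vecIV, Fintype.sum_sum_type]
      ring
    have hd := h.det_pos
    rw [det_fin_two] at hd
    simp only [toBlocks₁₁, of_apply] at hd
    have h1 : ‖lieNum (lieAct g (lieLift (0 : Fin n → ℂ)))‖ ^ 2 <
        ‖lieDenom (lieAct g (lieLift (0 : Fin n → ℂ)))‖ ^ 2 := by
      simp only [lieNum, lieDenom, e, ← Complex.normSq_eq_norm_sq, Complex.normSq_apply]
      simp
      nlinarith
    simp only [hF, zero_smul]
    exact sub_neg.2 (lt_of_pow_lt_pow_left₀ 2 (norm_nonneg _) h1)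
  have h1 : F 1 < 0 := by
    by_contra hcon
    obtain ⟨t, ht, h2⟩ := intermediate_value_Icc zero_le_one hcont.continuousOn
      ⟨h0.le, not_lt.1 hcon⟩
    exact hne t ht h2
  simpa [hF] using h1

lemma lieDenom_ne_zero {z : Fin n → ℂ} (hz : z ∈ domIV n) :
    lieDenom (lieAct g (lieLift z)) ≠ 0 :=
  norm_pos_iff.1 ((norm_nonneg _).trans_lt (h.norm_lieNum_lt hz))

lemma smul_lieLift_lieMap {z : Fin n → ℂ} (hz : z ∈ domIV n) :
    lieDenom (lieAct g (lieLift z)) • lieLift (lieMap g z) = lieAct g (lieLift z) :=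
  smul_lieLift_lieProj (h.lieForm_lieAct_lieLift z) (h.lieDenom_ne_zero hz)

/-- The transformation law of the norm, in terms of the factor of automorphy `lieDenom`. -/
lemma normIV_lieMap {z w : Fin n → ℂ} (hz : z ∈ domIV n) (hw : w ∈ domIV n) :
    normIV (lieMap g z) (lieMap g w) *
      (lieDenom (lieAct g (lieLift z)) * conj (lieDenom (lieAct g (lieLift w)))) =
        normIV z w := by
  have h1 := h.lieForm_lieAct_star z w
  rw [← h.smul_lieLift_lieMap hz, ← h.smul_lieLift_lieMap hw] at h1
  have h2 : ∀ (a b : ℂ) (u v : Fin 2 ⊕ Fin n → ℂ),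
      lieForm (a • u) (star (b • v)) = a * conj b * lieForm u (star v) := fun a b u v => by
    simp only [lieForm, Pi.smul_apply, Pi.star_apply, smul_eq_mul, star_mul', RCLike.star_def,
      mul_sub, Finset.mul_sum]
    congr 1 <;> exact Finset.sum_congr rfl fun i _ => by ring
  rw [h2, lieForm_lieLift_star] at h1
  linear_combination 2 * h1

lemma lieMap_mem {z : Fin n → ℂ} (hz : z ∈ domIV n) : lieMap g z ∈ domIV n := by
  have h0 := h.lieDenom_ne_zero hz
  refine ⟨?_, ?_⟩
  · have h1 := h.normIV_lieMap hz hz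
    rw [Complex.mul_conj] at h1
    have h2 := congrArg Complex.re h1
    rw [Complex.re_mul_ofReal] at h2
    have h3 := hz.1
    rw [← h2] at h3
    exact pos_of_mul_pos_left h3 (Complex.normSq_nonneg _)
  · rw [lieMap, lieProj_dotProduct (h.lieForm_lieAct_lieLift z) h0, norm_div,
      div_lt_one (norm_pos_iff.2 h0)]
    exact h.norm_lieNum_lt hz

lemma lieMap_lieMap {g' : Matrix (Fin 2 ⊕ Fin n) (Fin 2 ⊕ Fin n) ℝ} (hg : g * g' = 1)
    {z : Fin n → ℂ} (hz : z ∈ domIV n) : lieMap g' (lieMap g z) = z := by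
  have h0 := h.lieDenom_ne_zero hz
  calc lieMap g' (lieMap g z)
      = lieProj (lieDenom (lieAct g (lieLift z)) • lieAct g' (lieLift (lieMap g z))) :=
        (lieProj_smul h0 _).symm
    _ = z := by
        rw [← lieAct_smul, h.smul_lieLift_lieMap hz, lieAct_lieAct, hg, lieAct_one,
          lieProj_lieLift]

lemma differentiableOn_lieMap : DifferentiableOn ℂ (lieMap g) (domIV n) := by
  have h1 := fun i => (differentiable_lieAct_lieLift g i).differentiableOn (s := domIV n)
  refine differentiableOn_pi.2 fun k => ?_
  refine DifferentiableOn.mul (DifferentiableOn.inv ?_ fun z hz => h.lieDenom_ne_zero hz) (h1 _)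
  exact (h1 _).add ((h1 _).const_mul _)

lemma isHolomorphicAutomorphism : IsHolomorphicAutomorphism (lieMap g) (domIV n) :=
  ⟨h.differentiableOn_lieMap, fun _ hz => h.lieMap_mem hz, _,
    h.inverse.differentiableOn_lieMap, fun _ hz => h.inverse.lieMap_mem hz,
    fun _ hz => h.lieMap_lieMap h.mul_inverse hz,
    fun _ hz => h.inverse.lieMap_lieMap h.inverse_mul hz⟩

end IsLieBallMap

end LieBallGroup


section LieBallDatum

open Set Matrix

variable {n : ℕ}

/-- The matrix `(e, z) ↦ ((e - z Xᵗ) A, (z - e X) D)`. -/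
def lieBlock (X : Matrix (Fin 2) (Fin n) ℝ) (A : Matrix (Fin 2) (Fin 2) ℝ)
    (D : Matrix (Fin n) (Fin n) ℝ) : Matrix (Fin 2 ⊕ Fin n) (Fin 2 ⊕ Fin n) ℝ :=
  fromBlocks A (-(X * D)) (-(Xᵀ * A)) D

lemma isLieBallMap_lieBlock {X : Matrix (Fin 2) (Fin n) ℝ} {A : Matrix (Fin 2) (Fin 2) ℝ}
    {D : Matrix (Fin n) (Fin n) ℝ} (hX : (1 - X * Xᵀ).PosDef) (hA : A * Aᵀ = (1 - X * Xᵀ)⁻¹)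
    (hD : D * Dᵀ = (1 - Xᵀ * X)⁻¹) (hd : 0 < A.det) : IsLieBallMap (lieBlock X A D) := by
  have h : IsMobiusData X Aᵀ Dᵀ := ⟨by simpa [conjTranspose_eq_transpose_of_trivial] using hX,
    by simpa [conjTranspose_eq_transpose_of_trivial] using hA,
    by simpa [conjTranspose_eq_transpose_of_trivial] using hD⟩
  have h1 := h.left_mul
  have h2 := h.right_mul
  have h3 := h.push
  have h4 := h.push'
  simp only [conjTranspose_eq_transpose_of_trivial, transpose_transpose] at h1 h2 h3 h4
  refine ⟨?_, by simpa [lieBlock] using hd⟩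
  rw [lieBlock, lieSign, fromBlocks_transpose, fromBlocks_multiply, fromBlocks_multiply]
  simp only [transpose_neg, transpose_mul, transpose_transpose, Matrix.mul_zero, Matrix.mul_one,
    add_zero, zero_add, Matrix.mul_neg, Matrix.neg_mul, neg_neg]
  have e1 : X * D * (Dᵀ * Xᵀ) = A * Aᵀ * (X * Xᵀ) := by
    rw [← Matrix.mul_assoc, Matrix.mul_assoc X, h3, Matrix.mul_assoc]
  have e2 : Xᵀ * A * (Aᵀ * X) = D * Dᵀ * (Xᵀ * X) := by
    rw [← Matrix.mul_assoc, Matrix.mul_assoc Xᵀ, ← h4, Matrix.mul_assoc]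
  have e3 : A * (Aᵀ * X) = X * D * Dᵀ := by rw [← Matrix.mul_assoc, ← h3, Matrix.mul_assoc]
  have e4 : D * (Dᵀ * Xᵀ) = Xᵀ * A * Aᵀ := by rw [← Matrix.mul_assoc, h4, Matrix.mul_assoc]
  rw [Matrix.mul_sub, Matrix.mul_one] at h1 h2
  congr 1
  · rw [e1, ← sub_eq_add_neg, h1]
  · rw [e3]; abel
  · rw [e4]; abel
  · rw [e2, ← h2]; abel

lemma lieMap_lieBlock (X : Matrix (Fin 2) (Fin n) ℝ) (A : Matrix (Fin 2) (Fin 2) ℝ)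
    (D : Matrix (Fin n) (Fin n) ℝ) (z : Fin n → ℂ) : lieMap (lieBlock X A D) z =
      (((vecIV z - z ᵥ* toComplexMatrix Xᵀ) ᵥ* toComplexMatrix A) ⬝ᵥ ![1, Complex.I])⁻¹ •
        ((z - vecIV z ᵥ* toComplexMatrix X) ᵥ* toComplexMatrix D) := by
  have h1 : (lieBlock X A D).map Complex.ofReal = fromBlocks (toComplexMatrix A)
      (-(toComplexMatrix X * toComplexMatrix D)) (-(toComplexMatrix Xᵀ * toComplexMatrix A))
      (toComplexMatrix D) := by
    ext (i | i) (j | j) <;> simp [lieBlock, toComplexMatrix, Matrix.mul_apply]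
  have h2 : lieAct (lieBlock X A D) (lieLift z) =
      Sum.elim ((vecIV z - z ᵥ* toComplexMatrix Xᵀ) ᵥ* toComplexMatrix A)
        ((z - vecIV z ᵥ* toComplexMatrix X) ᵥ* toComplexMatrix D) := by
    rw [lieAct, h1, vecMul_fromBlocks, lieLift, Sum.elim_comp_inl, Sum.elim_comp_inr]
    congr 1
    · rw [vecMul_neg, ← vecMul_vecMul, sub_vecMul, sub_eq_add_neg]
    · rw [vecMul_neg, ← vecMul_vecMul, sub_vecMul, sub_eq_add_neg, add_comm]
  rw [lieMap, h2, lieProj, Sum.elim_comp_inr]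
  congr 2
  simp [lieDenom, dotProduct, Fin.sum_univ_two, mul_comm]

/-- Complex numbers are real linear combinations of two that are not parallel. -/
lemma exists_real_combination {a b : ℂ} (hab : (a * conj b).im ≠ 0) (c : ℂ) :
    ∃ x y : ℝ, c = a * x + b * y := by
  refine ⟨(c * conj b).im / (a * conj b).im, -(c * conj a).im / (a * conj b).im, ?_⟩
  simp only [Complex.mul_im, Complex.conj_re, Complex.conj_im] at hab ⊢
  refine Complex.ext ?_ ?_
  · simp only [Complex.add_re, Complex.mul_re, Complex.ofReal_re, Complex.ofReal_im, mul_zero,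
      sub_zero]
    rw [mul_div_assoc', mul_div_assoc', ← add_div, eq_div_iff hab]
    ring
  · simp only [Complex.add_im, Complex.mul_im, Complex.ofReal_re, Complex.ofReal_im, mul_zero,
      zero_add]
    rw [mul_div_assoc', mul_div_assoc', ← add_div, eq_div_iff hab]
    ring

lemma im_vecIV_mul_conj {z : Fin n → ℂ} (hz : z ∈ domIV n) :
    (vecIV z 0 * conj (vecIV z 1)).im ≠ 0 := by
  have h1 : (vecIV z 0 * conj (vecIV z 1)).im = (1 - Complex.normSq (z ⬝ᵥ z)) / 4 := by
    generalize hs : z ⬝ᵥ z = s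
    simp only [vecIV, hs, cons_val_zero, cons_val_one, cons_val_fin_one, Complex.normSq_apply]
    simp [Complex.mul_im, Complex.div_re, Complex.div_im, Complex.normSq_apply]
    ring
  have h2 := hz.2
  rw [h1, Complex.normSq_eq_norm_sq]
  have := norm_nonneg (z ⬝ᵥ z)
  have h3 : ‖z ⬝ᵥ z‖ ^ 2 < 1 := pow_lt_one₀ this h2 two_ne_zero
  exact (div_pos (sub_pos.2 h3) (by norm_num)).ne'

/-- The matrix `X₀` of a point of the Lie ball. -/
lemma exists_vecIV_vecMul_eq {z : Fin n → ℂ} (hz : z ∈ domIV n) :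
    ∃ X : Matrix (Fin 2) (Fin n) ℝ, z = vecIV z ᵥ* toComplexMatrix X := by
  choose x y hxy using fun k => exists_real_combination (im_vecIV_mul_conj hz) (z k)
  refine ⟨Matrix.of ![x, y], ?_⟩
  ext k
  rw [hxy k]
  simp [vecMul, dotProduct, Fin.sum_univ_two, toComplexMatrix]

/-- `1 - X Xᵗ` is a positive multiple of the identity in the real basis formed by the real and the
imaginary part of `vecIV z`. -/
lemma posDef_of_eq_vecIV_vecMul {z : Fin n → ℂ} (hz : z ∈ domIV n)
    {X : Matrix (Fin 2) (Fin n) ℝ} (hX : z = vecIV z ᵥ* toComplexMatrix X) :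
    (1 - X * Xᵀ).PosDef := by
  set e := vecIV z with he
  set M := 1 - X * Xᵀ with hM
  have hMt : M 0 1 = M 1 0 := by
    have : Mᵀ = M := by simp [hM]
    exact congrFun (congrFun this 1) 0
  have hform : ∀ e' : Fin 2 → ℂ, e ⬝ᵥ e' - (e ᵥ* toComplexMatrix X) ⬝ᵥ (e' ᵥ* toComplexMatrix X) =
      e 0 * e' 0 * M 0 0 + (e 0 * e' 1 + e 1 * e' 0) * M 1 0 + e 1 * e' 1 * M 1 1 := fun e' => by
    have h1 : (e ᵥ* toComplexMatrix X) ⬝ᵥ (e' ᵥ* toComplexMatrix X) =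
        (e ᵥ* (toComplexMatrix X * (toComplexMatrix X)ᵀ)) ⬝ᵥ e' := by
      rw [← vecMul_vecMul, ← dotProduct_mulVec (e ᵥ* toComplexMatrix X), mulVec_transpose]
    have h2 : toComplexMatrix X * (toComplexMatrix X)ᵀ = toComplexMatrix (1 - M) := by
      rw [hM, sub_sub_cancel]
      ext i j
      simp [toComplexMatrix, Matrix.mul_apply]
    rw [h1, h2]
    simp only [dotProduct, vecMul, Fin.sum_univ_two, toComplexMatrix, map_apply,
      Matrix.sub_apply]
    simp [hMt]
    ring
  have k1 := hform e
  have k2 := hform (star e)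
  have e1 : star e ᵥ* toComplexMatrix X = star z := by
    conv_rhs => rw [hX]
    ext i
    simp [toComplexMatrix, vecMul, dotProduct]
  rw [← hX] at k1
  rw [e1, ← hX] at k2
  have q1 : e ⬝ᵥ e - z ⬝ᵥ z = 0 := by
    have := lieForm_lieLift z
    simpa [lieForm, lieLift, dotProduct] using this
  have q2 : e ⬝ᵥ star e - z ⬝ᵥ star z = normIV z z / 2 := by
    rw [← lieForm_lieLift_star]; simp [lieForm, lieLift, dotProduct, he]
  -- `e M eᵗ = 0` and `e M ēᵗ = h(z, z) / 2` give the entries of `P M Pᵗ`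
  rw [q1] at k1
  rw [q2] at k2
  have hpos := hz.1
  have r1 := congrArg Complex.re k1
  have r2 := congrArg Complex.im k1
  have r3 := congrArg Complex.re k2
  -- the rows of `P` are the real and the imaginary part of `e`
  set P : Matrix (Fin 2) (Fin 2) ℝ := !![(e 0).re, (e 1).re; (e 0).im, (e 1).im] with hP
  have hdet : IsUnit P := by
    rw [isUnit_iff_isUnit_det, det_fin_two, isUnit_iff_ne_zero]
    have := im_vecIV_mul_conj hz
    rw [← he] at this
    simp only [hP, Complex.mul_im, Complex.conj_re, Complex.conj_im] at this ⊢
    simp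
    intro h
    apply this
    linarith
  have hPM : P * M * star P = ((normIV z z).re / 4) • (1 : Matrix (Fin 2) (Fin 2) ℝ) := by
    simp at r1 r2 r3
    ext i j
    fin_cases i <;> fin_cases j <;>
      simp [hP, Matrix.mul_apply, Fin.sum_univ_two, star_eq_conjTranspose, vecMul, dotProduct,
        hMt] <;> linarith
  rw [← hdet.posDef_star_right_conjugate_iff, hPM]
  exact PosDef.one.smul (by positivity)

/-- A square root of a positive definite matrix, with positive determinant. -/
lemma exists_mul_transpose_eq {S : Matrix (Fin 2) (Fin 2) ℝ} (hS : S.PosDef) :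
    ∃ A : Matrix (Fin 2) (Fin 2) ℝ, A * Aᵀ = S ∧ 0 < A.det := by
  obtain ⟨B, hB⟩ := exists_conjTranspose_mul_self_eq hS
  rw [conjTranspose_eq_transpose_of_trivial] at hB
  have h1 : B.det ≠ 0 := by
    intro h
    have h2 := hS.det_pos
    rw [← hB, det_mul, h, mul_zero] at h2
    exact h2.false
  rcases h1.lt_or_gt with h | h
  · -- a reflection corrects the orientation
    refine ⟨Bᵀ * diagonal ![1, -1], ?_, ?_⟩
    · have h3 : (diagonal ![1, -1] : Matrix (Fin 2) (Fin 2) ℝ) * diagonal ![1, -1] = 1 := by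
        rw [diagonal_mul_diagonal, ← diagonal_one]
        congr 1
        ext i
        fin_cases i <;> simp
      rw [transpose_mul, transpose_transpose, diagonal_transpose, ← Matrix.mul_assoc,
        Matrix.mul_assoc Bᵀ, h3, Matrix.mul_one, hB]
    · rw [det_mul, det_transpose, det_diagonal, Fin.prod_univ_two]
      simpa using h
  · exact ⟨Bᵀ, by rw [transpose_transpose, hB], by rwa [det_transpose]⟩

lemma movesIV_nonempty {z₀ : Fin n → ℂ} (hz₀ : z₀ ∈ domIV n) : (movesIV n z₀).Nonempty := by
  obtain ⟨X, hX⟩ := exists_vecIV_vecMul_eq hz₀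
  have hp := posDef_of_eq_vecIV_vecMul hz₀ hX
  obtain ⟨A, hA, hd⟩ := exists_mul_transpose_eq hp.inv
  obtain ⟨D, hD⟩ := exists_conjTranspose_mul_self_eq
    (posDef_one_sub_conjTranspose_mul (Z := X)
      (by simpa [conjTranspose_eq_transpose_of_trivial] using hp)).inv
  simp only [conjTranspose_eq_transpose_of_trivial] at hD
  exact ⟨_, X, A, Dᵀ, hX, hA, by rwa [transpose_transpose], hd, fun z _ => rfl⟩

lemma exists_isLieBallMap_of_mem_movesIV {z₀ : Fin n → ℂ} (hz₀ : z₀ ∈ domIV n)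
    {φ : (Fin n → ℂ) → Fin n → ℂ} (hφ : φ ∈ movesIV n z₀) :
    ∃ g, IsLieBallMap g ∧ (∀ z ∈ domIV n, φ z = lieMap g z) ∧ lieMap g z₀ = 0 := by
  obtain ⟨X, A, D, hX, hA, hD, hd, h⟩ := hφ
  refine ⟨lieBlock X A D, isLieBallMap_lieBlock (posDef_of_eq_vecIV_vecMul hz₀ hX) hA hD hd,
    fun z hz => by rw [lieMap_lieBlock, h z hz], ?_⟩
  rw [lieMap_lieBlock, ← hX, sub_self, zero_vecMul, smul_zero]

lemma normIV_zero_right (z : Fin n → ℂ) : normIV z 0 = 1 := by simp [normIV]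

lemma normIV_conj_symm (z w : Fin n → ℂ) : conj (normIV z w) = normIV w z := by
  have h1 : conj (z ⬝ᵥ star w) = w ⬝ᵥ star z := by
    simp [dotProduct, mul_comm]
  simp only [normIV, map_sub, map_add, map_mul, map_one, Complex.conj_conj, h1, map_ofNat]
  ring

/-- `normIV` is the product of factors of automorphy. -/
lemma lieDenom_mul_conj {g : Matrix (Fin 2 ⊕ Fin n) (Fin 2 ⊕ Fin n) ℝ} (hg : IsLieBallMap g)
    {z z₀ : Fin n → ℂ} (hz : z ∈ domIV n) (hz₀ : z₀ ∈ domIV n) (h0 : lieMap g z₀ = 0) :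
    lieDenom (lieAct g (lieLift z)) * conj (lieDenom (lieAct g (lieLift z₀))) = normIV z z₀ := by
  have := hg.normIV_lieMap hz hz₀
  rwa [h0, normIV_zero_right, one_mul] at this

lemma isHomogeneousDatum_domIV : IsHomogeneousDatum (domIV n) normIV (movesIV n) where
  isOpen := by
    have h1 : Continuous fun z : Fin n → ℂ => (normIV z z).re := by
      simp only [normIV_self, dotProduct]
      exact (continuous_const.add ((by fun_prop : Continuous fun z : Fin n → ℂ =>
        ‖∑ i, z i * z i‖ ^ 2))).sub
          (continuous_const.mul (contDiff_coordNormSq (n := 0)).continuous)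
    have h2 : Continuous fun z : Fin n → ℂ => ‖z ⬝ᵥ z‖ := by
      simp only [dotProduct]; fun_prop
    exact (isOpen_lt continuous_const h1).inter (isOpen_lt h2 continuous_const)
  smul_mem _ hz _ h0 h1 := smul_mem_domIV hz h0 h1
  differentiable w := by simp only [normIV, dotProduct]; fun_prop
  contDiff := by
    simp only [normIV_self, dotProduct]
    refine (contDiff_const.add ?_).sub (contDiff_const.mul contDiff_coordNormSq)
    exact (contDiff_norm_sq_complex (H := ℂ)).comp (ContDiff.sum fun i _ =>
      (contDiff_apply ℝ ℂ i).mul (contDiff_apply ℝ ℂ i))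
  conj_symm := normIV_conj_symm
  apply_zero := normIV_zero_right
  ne_zero z hz w hw := by
    obtain ⟨φ, hφ⟩ := movesIV_nonempty hw
    obtain ⟨g, hg, -, h0⟩ := exists_isLieBallMap_of_mem_movesIV hw hφ
    rw [← lieDenom_mul_conj hg hz hw h0]
    exact mul_ne_zero (hg.lieDenom_ne_zero hz)
      ((map_ne_zero conj).2 (hg.lieDenom_ne_zero hw))
  pos z hz := hz.1
  upper := by
    refine ⟨1, one_pos, fun z hz => ?_⟩
    have h1 := coordNormSq_lt_one_of_mem_domIV hz
    have h2 := norm_dotProduct_self_le z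
    have h3 := norm_nonneg (z ⬝ᵥ z)
    rw [normIV_self]
    nlinarith
  lower := by
    refine ⟨2, two_pos, fun z hz => ?_⟩
    have h2 := norm_dotProduct_self_le z
    have h3 := sq_nonneg ‖z ⬝ᵥ z‖
    have h4 : 1 - 2 * coordNormSq z ≤ (normIV z z).re := by rw [normIV_self]; linarith
    exact ⟨⟨by linarith, by linarith [coordNormSq_nonneg z]⟩, h4⟩
  mem_of_mem_closure z hz hpos := by
    have h2 : Continuous fun z : Fin n → ℂ => ‖z ⬝ᵥ z‖ := by
      simp only [dotProduct]; fun_prop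
    have h1 : ‖z ⬝ᵥ z‖ ≤ 1 :=
      closure_minimal (fun w hw => hw.2.le) (isClosed_le h2 continuous_const) hz
    refine ⟨hpos, lt_of_le_of_ne h1 fun h => ?_⟩
    have h3 := norm_dotProduct_self_le z
    rw [normIV_self, h] at hpos
    linarith
  bounded := by
    refine ⟨2 + 2 * n, fun z hz w hw => ?_⟩
    have hz1 := coordNormSq_lt_one_of_mem_domIV hz
    have hw1 := coordNormSq_lt_one_of_mem_domIV hw
    have hle : ∀ {z : Fin n → ℂ}, coordNormSq z < 1 → ∀ i, ‖z i‖ ≤ 1 := fun {z} hz i => by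
      have h1 := norm_le_pi_norm z i
      have h2 := norm_sq_le_coordNormSq z
      nlinarith [norm_nonneg z]
    have h3 : ‖z ⬝ᵥ star w‖ ≤ n := by
      refine (norm_sum_le _ _).trans ((Finset.sum_le_sum fun i _ => ?_).trans_eq
        (by simp : ∑ _i : Fin n, (1 : ℝ) = n))
      rw [norm_mul, Pi.star_apply, norm_star]
      exact mul_le_one₀ (hle hz1 i) (norm_nonneg _) (hle hw1 i)
    have h4 : ‖(z ⬝ᵥ z) * conj (w ⬝ᵥ w)‖ ≤ 1 := by
      rw [norm_mul, RCLike.norm_conj]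
      exact mul_le_one₀ hz.2.le (norm_nonneg _) hw.2.le
    calc ‖normIV z w‖ ≤ ‖(1 : ℂ) + (z ⬝ᵥ z) * conj (w ⬝ᵥ w)‖ + ‖2 * (z ⬝ᵥ star w)‖ :=
          norm_sub_le _ _
      _ ≤ (‖(1 : ℂ)‖ + ‖(z ⬝ᵥ z) * conj (w ⬝ᵥ w)‖) + ‖2 * (z ⬝ᵥ star w)‖ := by
          gcongr; exact norm_add_le _ _
      _ ≤ 2 + 2 * n := by
          rw [norm_one, norm_mul 2, RCLike.norm_ofNat]
          linarith
  nonempty _ hz₀ := movesIV_nonempty hz₀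
  automorphism z₀ hz₀ φ hφ := by
    obtain ⟨g, hg, h, -⟩ := exists_isLieBallMap_of_mem_movesIV hz₀ hφ
    obtain ⟨h1, h2, g', h3, h4, h5⟩ := hg.isHolomorphicAutomorphism
    refine ⟨h1.congr h, fun z hz => by rw [h z hz]; exact h2 hz, g', h3, h4, ?_, ?_⟩
    · exact fun z hz => by rw [h z hz]; exact h5.1 hz
    · exact fun z hz => by rw [h _ (h4 hz)]; exact h5.2 hz
  map_self z₀ hz₀ φ hφ := by
    obtain ⟨g, -, h, h0⟩ := exists_isLieBallMap_of_mem_movesIV hz₀ hφ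
    rw [h z₀ hz₀, h0]
  transform z₀ hz₀ φ hφ z hz w hw := by
    obtain ⟨g, hg, h, h0⟩ := exists_isLieBallMap_of_mem_movesIV hz₀ hφ
    have h1 := lieDenom_mul_conj hg hz hz₀ h0
    have h2 := congrArg conj (lieDenom_mul_conj hg hw hz₀ h0)
    rw [normIV_conj_symm, map_mul, Complex.conj_conj] at h2
    rw [h z hz, h w hw, ← h1, ← h2, ← lieDenom_mul_conj hg hz₀ hz₀ h0, ← hg.normIV_lieMap hz hw]
    ring

end LieBallDatum

/-! ### The four families of Cartan–Hartogs domains -/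

/-- The assertions of the theorem for a Hartogs domain over any homogeneous domain; the reference ball
lives in the same dimension. -/
lemma IsHomogeneousDatum.all_conclusions {κ : Type*} [Fintype κ] [DecidableEq κ]
    {R : Set (κ → ℂ)} {h : (κ → ℂ) → (κ → ℂ) → ℂ} {Φ : (κ → ℂ) → Set ((κ → ℂ) → κ → ℂ)}
    (H : IsHomogeneousDatum R h Φ) {N : ℕ} {c K l : ℝ} (hK : 0 < K) (hl : 0 < l)
    (hc : 0 < c + N / K) :
    IsKahlerPotentialOn (hartogsPotential h c K l) (hartogsDomain R h N K) ∧
      IsCompleteMetricOn (hartogsPotential h c K l) (hartogsDomain R h N K) ∧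
      IsInvariantMetricOn (hartogsPotential h c K l) (hartogsDomain R h N K)
        (hartogsAut R h Φ N K) ∧
      IsEquivalentToBergman (hartogsPotential h c K l) (hartogsDomain R h N K) := by
  obtain ⟨Φ', HB⟩ := exists_isHomogeneousDatum_ball (κ ⊕ Fin N)
  exact ⟨H.isKahlerPotentialOn_hartogsPotential hK hl hc,
    H.isCompleteMetricOn_hartogsPotential hK hl hc HB,
    H.isInvariantMetricOn_hartogsPotential hK,
    H.isEquivalentToBergman_hartogsPotential hK hl hc HB⟩

theorem mainTheorem1 (N : ℕ) (hN : 1 ≤ N) (K : ℝ) (hK : 0 < K) (l : ℝ) (hl : 0 < l) :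
    (∀ m n : ℕ, 1 ≤ m → 1 ≤ n →
      IsKahlerPotentialOn (logGI m n N K l) (YI m n N K) ∧
      IsCompleteMetricOn (logGI m n N K l) (YI m n N K) ∧
      IsInvariantMetricOn (logGI m n N K l) (YI m n N K) (autYI m n N K) ∧
      IsEquivalentToBergman (logGI m n N K l) (YI m n N K)) ∧
    (∀ p : ℕ, 1 ≤ p →
      IsKahlerPotentialOn (logGII p N K l) (YII p N K) ∧
      IsCompleteMetricOn (logGII p N K l) (YII p N K) ∧
      IsInvariantMetricOn (logGII p N K l) (YII p N K) (autYII p N K) ∧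
      IsEquivalentToBergman (logGII p N K l) (YII p N K)) ∧
    (∀ q : ℕ, 1 ≤ q →
      IsKahlerPotentialOn (logGIII q N K l) (YIII q N K) ∧
      IsCompleteMetricOn (logGIII q N K l) (YIII q N K) ∧
      IsInvariantMetricOn (logGIII q N K l) (YIII q N K) (autYIII q N K) ∧
      IsEquivalentToBergman (logGIII q N K l) (YIII q N K)) ∧
    (∀ n : ℕ, 1 ≤ n →
      IsKahlerPotentialOn (logGIV n N K l) (YIV n N K) ∧
      IsCompleteMetricOn (logGIV n N K l) (YIV n N K) ∧
      IsInvariantMetricOn (logGIV n N K l) (YIV n N K) (autYIV n N K) ∧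
      IsEquivalentToBergman (logGIV n N K l) (YIV n N K)) := by
  have hNK : 0 < (N : ℝ) / K := div_pos (Nat.cast_pos.2 hN) hK
  refine ⟨fun m n hm _ => ?_, fun p hp => ?_, fun q hq => ?_, fun n _ => ?_⟩
  · exact (isHomogeneousDatum_domI hm).all_conclusions hK hl (by positivity)
  · exact (isHomogeneousDatum_domII hp).all_conclusions hK hl (by positivity)
  · have hq' : (1 : ℝ) ≤ q := Nat.one_le_cast.2 hq
    exact (isHomogeneousDatum_domIII hq).all_conclusions hK hl (by linarith)
  · exact isHomogeneousDatum_domIV.all_conclusions hK hl (by positivity)
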